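/- Let $\epsilon_1,\epsilon_2\in\mathbb{C}$, $\epsilon_3=-\epsilon_1-\epsilon_2$, $\sigma_2=\epsilon_1^2+\epsilon_1\epsilon_2+\epsilon_2^2$, $\sigma_3=\epsilon_1\epsilon_2\epsilon_3$. Let $\mathcal{A}$ be the large-$N$ M2-brane algebra: the associative unital $\mathbb{C}$-algebra generated by $t_{a,b}$ ($a,b\ge 0$) subject to, for all $c,d\ge 0$ (terms with a negative index are absent), \[ [t_{0,0},t_{c,d}]=0,\quad [t_{1,0},t_{c,d}]=d\,t_{c,d-1},\quad [t_{0,1},t_{c,d}]=-c\,t_{c-1,d}, \] \[ [t_{2,0},t_{c,d}]=2d\,t_{c+1,d-1},\quad [t_{1,1},t_{c,d}]=(d-c)\,t_{c,d},\quad [t_{0,2},t_{c,d}]=-2c\,t_{c-1,d+1}, \] \[ [t_{3,0},t_{c,d}]=3d\,t_{c+2,d-1}+\sigma_2\tfrac{d(d-1)(d-2)}{4}\,t_{c,d-3}+\tfrac32\sigma_3\sum_{m=0}^{d-3}\sum_{n=0}^{c}\frac{\binom{m+n+1}{n+1}(n+1)\binom{d-m+c-n-2}{c-n+1}(c-n+1)}{\binom{d+c}{c}}\,t_{n,m}\,t_{c-n,d-3-m}.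 \] Let $c:\mathcal{A}\to\mathbb{C}$ be the augmentation, that is, the algebra homomorphism with $c(1)=1$ and $c(t_{a,b})=0$ for all $a,b$. Then there is exactly one algebra homomorphism $\Delta_{\mathcal A}:\mathcal{A}\to(\mathcal{A}\otimes\mathcal{A})(\!(w^{-1})\!)$ with \[ \Delta_{\mathcal A}(t_{0,n})=1\otimes t_{0,n}+\sum_{m=0}^n\binom nm w^{n-m}\,t_{0,m}\otimes 1\qquad(n\ge 0), \] \[ \Delta_{\mathcal A}(t_{2,0})=1\otimes t_{2,0}+t_{2,0}\otimes 1+2\sigma_3\sum_{m,n\ge 0}\frac{(m+n+1)!}{m!\,n!}(-1)^n w^{-n-m-2}\,t_{0,n}\otimes t_{0,m}, \] and $\mathcal{A}$ with the coproduct $Y(w)=\Delta_{\mathcal A}$ and the covacuum $c$ is a vertex coalgebra, i.e. for every $v\in\mathcal{A}$: (1) Left counit: $(c\otimes\mathrm{Id})Y(w)v=v$. (2) Cocreation: $(\mathrm{Id}\otimes c)Y(w)v\in\mathcal{A}[w]$ and $\lim_{w\to 0}(\mathrm{Id}\otimes c)Y(w)v=v$. (3) Jacobi identity: \[ w_0^{-1}\delta\!\left(\tfrac{w_1-w_2}{w_0}\right)(\mathrm{Id}\otimes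 Y(w_2))Y(w_1)v-w_0^{-1}\delta\!\left(\tfrac{w_2-w_1}{-w_0}\right)(T\otimes\mathrm{Id})(\mathrm{Id}\otimes Y(w_1))Y(w_2)v=w_2^{-1}\delta\!\left(\tfrac{w_1-w_0}{w_2}\right)(Y(w_0)\otimes\mathrm{Id})Y(w_2)v, \] where $T$ swaps the first two tensor factors and $\delta\!\left(\frac{y-x}{z}\right)=\sum_{n\in\mathbb{Z},\,m\ge 0}(-1)^m\binom nm y^{n-m}x^m z^{-n}$. -/

import Mathlib

open scoped TensorProduct

noncomputable section

/-! ### Vertex coalgebras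

`LaurentSeries R` is the ring of formal Laurent series in one variable, with finitely many negative
powers of that variable.  The variable is always taken to be `w⁻¹` here, so that
`LaurentSeries (V ⊗[ℂ] V)` is `(V ⊗ V)((w⁻¹))`, and the coefficient of `w ^ i` is the Hahn series
coefficient at `-i`. -/

namespace VertexCoalg

section
variable {V : Type*} [AddCommGroup V] [Module ℂ V]

/-- `coeffW Y i v` is the coefficient of `w ^ i` in `Y(w) v ∈ (V ⊗ V)((w⁻¹))`. -/
def coeffW (Y : V →ₗ[ℂ] LaurentSeries (V ⊗[ℂ] V)) (i : ℤ) : V →ₗ[ℂ] V ⊗[ℂ] V where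
  toFun v := (Y v).coeff (-i)
  map_add' := by intros; simp
  map_smul' := by intros; simp

/-- The coefficient of `w₁ ^ i * w₂ ^ j` in `(Id ⊗ Y(w₂)) Y(w₁) v ∈ V ⊗ V ⊗ V`. -/
def idY (Y : V →ₗ[ℂ] LaurentSeries (V ⊗[ℂ] V)) (i j : ℤ) (v : V) : V ⊗[ℂ] (V ⊗[ℂ] V) :=
  (coeffW Y j).lTensor V (coeffW Y i v)

/-- The coefficient of `w₁ ^ i * w₂ ^ j` in `(T ⊗ Id) (Id ⊗ Y(w₁)) Y(w₂) v`, where `T` swaps the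
first two tensor factors. -/
def swapIdY (Y : V →ₗ[ℂ] LaurentSeries (V ⊗[ℂ] V)) (i j : ℤ) (v : V) : V ⊗[ℂ] (V ⊗[ℂ] V) :=
  TensorProduct.leftComm ℂ V V V ((coeffW Y i).lTensor V (coeffW Y j v))

/-- The coefficient of `w₀ ^ i * w₂ ^ j` in `(Y(w₀) ⊗ Id) Y(w₂) v`. -/
def yId (Y : V →ₗ[ℂ] LaurentSeries (V ⊗[ℂ] V)) (i j : ℤ) (v : V) : V ⊗[ℂ] (V ⊗[ℂ] V) :=
  TensorProduct.assoc ℂ V V V ((coeffW Y i).rTensor V (coeffW Y j v))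

/-- The coefficient of `y ^ (n - m) * x ^ m * z ^ (-n)` in the formal delta series
`δ((y - x) / z) = ∑ₙ (y - x) ^ n * z ^ (-n)`, where `n` runs over `ℤ` and `(y - x) ^ n` is expanded
in nonnegative powers of `x`. -/
def deltaCoeff (n : ℤ) (m : ℕ) : ℂ := (-1) ^ m * ((Ring.choose n m : ℤ) : ℂ)

/-- The coefficient of `w₀ ^ a * w₁ ^ b * w₂ ^ d` in
`w₀⁻¹ δ((w₁ - w₂) / w₀) (Id ⊗ Y(w₂)) Y(w₁) v`.  The terms of the delta series which contribute
are those with `n = -a - 1`; only finitely many `m` contribute. -/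
def jacobiTerm₁ (Y : V →ₗ[ℂ] LaurentSeries (V ⊗[ℂ] V)) (a b d : ℤ) (v : V) :
    V ⊗[ℂ] (V ⊗[ℂ] V) :=
  ∑ᶠ m : ℕ, deltaCoeff (-a - 1) m • idY Y (b - (-a - 1 - m)) (d - m) v

/-- The coefficient of `w₀ ^ a * w₁ ^ b * w₂ ^ d` in
`w₀⁻¹ δ((w₂ - w₁) / (-w₀)) (T ⊗ Id) (Id ⊗ Y(w₁)) Y(w₂) v`.  The terms of the delta series which
contribute are those with `n = -a - 1`; only finitely many `m` contribute. -/
def jacobiTerm₂ (Y : V →ₗ[ℂ] LaurentSeries (V ⊗[ℂ] V)) (a b d : ℤ) (v : V) :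
    V ⊗[ℂ] (V ⊗[ℂ] V) :=
  ∑ᶠ m : ℕ, ((-1 : ℂ) ^ (-a - 1) * deltaCoeff (-a - 1) m) •
    swapIdY Y (b - m) (d - (-a - 1 - m)) v

/-- The coefficient of `w₀ ^ a * w₁ ^ b * w₂ ^ d` in
`w₂⁻¹ δ((w₁ - w₀) / w₂) (Y(w₀) ⊗ Id) Y(w₂) v`.  The terms of the delta series which contribute
are those with `n - m = b`; only finitely many `m` contribute. -/
def jacobiTerm₃ (Y : V →ₗ[ℂ] LaurentSeries (V ⊗[ℂ] V)) (a b d : ℤ) (v : V) :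
    V ⊗[ℂ] (V ⊗[ℂ] V) :=
  ∑ᶠ m : ℕ, deltaCoeff (b + m) m • yId Y (a - m) (d + 1 + (b + m)) v

theorem coeffW_finite (Y : V →ₗ[ℂ] LaurentSeries (V ⊗[ℂ] V)) (v : V) (k : ℤ) :
    {m : ℕ | coeffW Y (k + m) v ≠ 0}.Finite := by
  refine (Set.finite_Iic (-k - (Y v).order).toNat).subset fun m hm => ?_
  have h : (Y v).order ≤ -(k + m) := HahnSeries.order_le_of_coeff_ne_zero hm
  simp only [Set.mem_Iic]
  omega

/-- The sums in the three terms of the Jacobi identity are finite. -/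
theorem jacobiTerm₁_finite (Y : V →ₗ[ℂ] LaurentSeries (V ⊗[ℂ] V)) (a b d : ℤ) (v : V) :
    (Function.support fun m : ℕ =>
      deltaCoeff (-a - 1) m • idY Y (b - (-a - 1 - m)) (d - m) v).Finite := by
  refine (coeffW_finite Y v (b + a + 1)).subset fun m hm h0 => hm ?_
  have e : b - (-a - 1 - (m : ℤ)) = b + a + 1 + m := by ring
  simp [idY, e, h0]

theorem jacobiTerm₂_finite (Y : V →ₗ[ℂ] LaurentSeries (V ⊗[ℂ] V)) (a b d : ℤ) (v : V) :
    (Function.support fun m : ℕ => ((-1 : ℂ) ^ (-a - 1) * deltaCoeff (-a - 1) m) •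
      swapIdY Y (b - m) (d - (-a - 1 - m)) v).Finite := by
  refine (coeffW_finite Y v (d + a + 1)).subset fun m hm h0 => hm ?_
  have e : d - (-a - 1 - (m : ℤ)) = d + a + 1 + m := by ring
  simp [swapIdY, e, h0]

theorem jacobiTerm₃_finite (Y : V →ₗ[ℂ] LaurentSeries (V ⊗[ℂ] V)) (a b d : ℤ) (v : V) :
    (Function.support fun m : ℕ =>
      deltaCoeff (b + m) m • yId Y (a - m) (d + 1 + (b + m)) v).Finite := by
  refine (coeffW_finite Y v (d + 1 + b)).subset fun m hm h0 => hm ?_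
  have e : d + 1 + (b + (m : ℤ)) = d + 1 + b + m := by ring
  simp [yId, e, h0]

/-- `(V, Y, c)` is a vertex coalgebra: `Y(w) : V → (V ⊗ V)((w⁻¹))` is the coproduct and
`c : V → ℂ` the covacuum. -/
structure IsVertexCoalgebra (Y : V →ₗ[ℂ] LaurentSeries (V ⊗[ℂ] V)) (c : V →ₗ[ℂ] ℂ) : Prop where
  /-- `(c ⊗ Id) Y(w) v = v`. -/
  left_counit : ∀ (v : V) (i : ℤ),
    TensorProduct.lid ℂ V (c.rTensor V (coeffW Y i v)) = if i = 0 then v else 0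
  /-- `(Id ⊗ c) Y(w) v ∈ V[w]`. -/
  cocreation_polynomial : ∀ (v : V) (i : ℤ), i < 0 →
    TensorProduct.rid ℂ V (c.lTensor V (coeffW Y i v)) = 0
  /-- The limit of `(Id ⊗ c) Y(w) v` as `w → 0` is `v`. -/
  cocreation_limit : ∀ v : V, TensorProduct.rid ℂ V (c.lTensor V (coeffW Y 0 v)) = v
  /-- The Jacobi identity, coefficient by coefficient. -/
  jacobi : ∀ (v : V) (a b d : ℤ),
    jacobiTerm₁ Y a b d v - jacobiTerm₂ Y a b d v = jacobiTerm₃ Y a b d v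

end

end VertexCoalg

/-! ### The large-N M2-brane algebra -/

namespace M2Brane

/-- `σ₂ = ε₁² + ε₁ ε₂ + ε₂²`. -/
def σ₂ (ε₁ ε₂ : ℂ) : ℂ := ε₁ ^ 2 + ε₁ * ε₂ + ε₂ ^ 2

/-- `σ₃ = ε₁ ε₂ ε₃`, where `ε₁ + ε₂ + ε₃ = 0`. -/
def σ₃ (ε₁ ε₂ : ℂ) : ℂ := ε₁ * ε₂ * (-ε₁ - ε₂)

/-- The free generator `t_{a,b}`. -/
def gen (a b : ℕ) : FreeAlgebra ℂ (ℕ × ℕ) := FreeAlgebra.ι ℂ (a, b)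

/-- The defining commutation relations.  Whenever a truncated subtraction in an index would be
negative, the term carries the coefficient `0`, or the sum it stands in is empty. -/
inductive Rel (ε₁ ε₂ : ℂ) : FreeAlgebra ℂ (ℕ × ℕ) → FreeAlgebra ℂ (ℕ × ℕ) → Prop
  | t00 (c d : ℕ) : Rel ε₁ ε₂ ⁅gen 0 0, gen c d⁆ 0
  | t10 (c d : ℕ) : Rel ε₁ ε₂ ⁅gen 1 0, gen c d⁆ ((d : ℂ) • gen c (d - 1))
  | t01 (c d : ℕ) : Rel ε₁ ε₂ ⁅gen 0 1, gen c d⁆ (-(c : ℂ) • gen (c - 1) d)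
  | t20 (c d : ℕ) : Rel ε₁ ε₂ ⁅gen 2 0, gen c d⁆ ((2 * d : ℂ) • gen (c + 1) (d - 1))
  | t11 (c d : ℕ) : Rel ε₁ ε₂ ⁅gen 1 1, gen c d⁆ ((d - c : ℂ) • gen c d)
  | t02 (c d : ℕ) : Rel ε₁ ε₂ ⁅gen 0 2, gen c d⁆ (-(2 * c : ℂ) • gen (c - 1) (d + 1))
  | t30 (c d : ℕ) : Rel ε₁ ε₂ ⁅gen 3 0, gen c d⁆
      ((3 * d : ℂ) • gen (c + 2) (d - 1)
        + (σ₂ ε₁ ε₂ * ((d : ℂ) * (d - 1) * (d - 2) / 4)) • gen c (d - 3)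
        + (3 / 2 * σ₃ ε₁ ε₂) •
          ∑ m ∈ Finset.range (d - 2), ∑ n ∈ Finset.range (c + 1),
            ((((m + n + 1).choose (n + 1) : ℂ) * (n + 1)
                * ((d - 3 - m + (c - n) + 1).choose (c - n + 1) : ℂ) * ((c - n : ℕ) + 1))
              / ((d + c).choose c : ℂ)) • (gen n m * gen (c - n) (d - 3 - m)))

end M2Brane

/-- The large-N M2-brane algebra `𝒜`: the associative unital `ℂ`-algebra generated by the
`t_{a,b}`, `a, b ≥ 0`, subject to the commutation relations `M2Brane.Rel`. -/
def M2Algebra (ε₁ ε₂ : ℂ) : Type := RingQuot (M2Brane.Rel ε₁ ε₂)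

namespace M2Brane

instance (ε₁ ε₂ : ℂ) : Ring (M2Algebra ε₁ ε₂) :=
  inferInstanceAs (Ring (RingQuot (M2Brane.Rel ε₁ ε₂)))

instance (ε₁ ε₂ : ℂ) : Algebra ℂ (M2Algebra ε₁ ε₂) :=
  inferInstanceAs (Algebra ℂ (RingQuot (M2Brane.Rel ε₁ ε₂)))

/-- The element `t_{a,b}` of `𝒜`. -/
def t (ε₁ ε₂ : ℂ) (a b : ℕ) : M2Algebra ε₁ ε₂ :=
  RingQuot.mkAlgHom ℂ (Rel ε₁ ε₂) (gen a b)

/-- The algebra homomorphism from the free algebra to `ℂ` which kills every generator. -/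
def freeAug : FreeAlgebra ℂ (ℕ × ℕ) →ₐ[ℂ] ℂ := FreeAlgebra.lift ℂ fun _ => 0

theorem freeAug_gen (a b : ℕ) : freeAug (gen a b) = 0 := by simp [freeAug, gen]

theorem freeAug_rel (ε₁ ε₂ : ℂ) ⦃x y : FreeAlgebra ℂ (ℕ × ℕ)⦄ (h : Rel ε₁ ε₂ x y) :
    freeAug x = freeAug y := by
  cases h <;> simp [Ring.lie_def, freeAug_gen]

/-- The augmentation `c : 𝒜 → ℂ`, the algebra homomorphism which sends `1` to `1` and every
`t_{a,b}` to `0`. -/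
def augmentation (ε₁ ε₂ : ℂ) : M2Algebra ε₁ ε₂ →ₐ[ℂ] ℂ :=
  RingQuot.liftAlgHom ℂ ⟨freeAug, freeAug_rel ε₁ ε₂⟩

theorem augmentation_t (ε₁ ε₂ : ℂ) (a b : ℕ) : augmentation ε₁ ε₂ (t ε₁ ε₂ a b) = 0 :=
  (RingQuot.liftAlgHom_mkAlgHom_apply ℂ freeAug (freeAug_rel ε₁ ε₂) (gen a b)).trans
    (freeAug_gen a b)

/-- `∑_{m,n ≥ 0} (m+n+1)! / (m! n!) (-1)^n w^{-n-m-2} t_{0,n} ⊗ t_{0,m}` in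
`(𝒜 ⊗ 𝒜)((w⁻¹))`. -/
def crossTerm (ε₁ ε₂ : ℂ) : LaurentSeries (M2Algebra ε₁ ε₂ ⊗[ℂ] M2Algebra ε₁ ε₂) :=
  HahnSeries.single 2 1 * HahnSeries.ofPowerSeries ℤ _ (PowerSeries.mk fun k =>
    ∑ p ∈ Finset.HasAntidiagonal.antidiagonal k,
      (((p.1 + p.2 + 1).factorial : ℂ) / ((p.2.factorial : ℂ) * (p.1.factorial : ℂ)) * (-1) ^ p.1)
        • (t ε₁ ε₂ 0 p.1 ⊗ₜ[ℂ] t ε₁ ε₂ 0 p.2))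

/-- The algebra homomorphism `Δ : 𝒜 → (𝒜 ⊗ 𝒜)((w⁻¹))` takes the prescribed values on the generators
`t_{0,n}` and `t_{2,0}`. -/
structure IsMeromorphicCoproduct (ε₁ ε₂ : ℂ)
    (Δ : M2Algebra ε₁ ε₂ →ₐ[ℂ] LaurentSeries (M2Algebra ε₁ ε₂ ⊗[ℂ] M2Algebra ε₁ ε₂)) : Prop where
  /-- `Δ(t_{0,n}) = 1 ⊗ t_{0,n} + ∑_{m ≤ n} binom(n,m) w^{n-m} t_{0,m} ⊗ 1`. -/
  map_t0 : ∀ n : ℕ, Δ (t ε₁ ε₂ 0 n) =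
    HahnSeries.C (1 ⊗ₜ[ℂ] t ε₁ ε₂ 0 n)
      + ∑ m ∈ Finset.range (n + 1),
          HahnSeries.single (-((n : ℤ) - m)) ((n.choose m : ℂ) • (t ε₁ ε₂ 0 m ⊗ₜ[ℂ] 1))
  /-- `Δ(t_{2,0}) = 1 ⊗ t_{2,0} + t_{2,0} ⊗ 1
    + 2 σ₃ ∑_{m,n ≥ 0} (m+n+1)! / (m! n!) (-1)^n w^{-n-m-2} t_{0,n} ⊗ t_{0,m}`. -/
  map_t20 : Δ (t ε₁ ε₂ 2 0) =
    HahnSeries.C (1 ⊗ₜ[ℂ] t ε₁ ε₂ 2 0) + HahnSeries.C (t ε₁ ε₂ 2 0 ⊗ₜ[ℂ] 1)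
      + (2 * σ₃ ε₁ ε₂) • crossTerm ε₁ ε₂

end M2Brane

end

/-!
Write `t_a` for the linear map `x ^ n ↦ t_{a,n}` on polynomials (a current) and `D = t_{2,0}`.

**Uniqueness.** The relation `[t_{2,0}, t_{c,d+1}] = 2 (d + 1) t_{c+1,d}` shows that the `t_{0,n}` and
`D` generate `𝒜` (`adjoin_generators`). So an algebra homomorphism is determined by its values on them,
and a property which is closed under the algebra operations only has to be checked on them
(`generator_induction`).

**A small presentation.** For the same reason a homomorphism `𝒜 → B` can be built from the images
`p n` of `t_{0,n}` and the image of `D`. The relations with `c = 0` and a few brackets with `D` suffice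
(`CurrentData`): the others follow by applying `ad D`. The only obstruction is `[D, t_{c,0}] = 0`. It
holds because `p 2`, `q 1` (the image of `t_{1,1}`) and `D` form an `𝔰𝔩₂`-triple up to scalars, and
`p n` is a vector of highest weight `n` on which `ad D` is nilpotent (`CurrentData.ad_pow_succ_p`).

**Existence.** The coproduct sends `t_{0,n}` to `t_0((x + w) ^ n) ⊗ 1 + 1 ⊗ t_0(y ^ n)`, and `D` to the
sum of its two copies and of `2 σ₃ (t_0 ⊗ t_0)(f)` with `f = (w + x - y) ^ (-2)`, expanded in `w⁻¹`.
All relations are formal consequences of `f (X - Y) ^ 2 = 1` for `X = x + w`, `Y = y`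
(`CrossData.currentData`), up to one identity. The quadratic part of `[t_{3,0}, t_{0,n}]` is described
by the polynomials `kpoly n`. They are compatible with translations (`kpoly_add`), and
`(X - Y) ^ 3 kpoly n X Y` has a closed form (`cube_mul_kpoly`); this closed form says exactly that the
mixed quadratic terms are produced by the interaction `f` (`CrossData.mul_f_eq`). The remaining
identity is needed for `[D, t_{3,0}] = 0`. It equates the quadratic part of `ad t_{3,0}` on `f` with
the bracket of `(t_1 ⊗ t_0)(f)` and `(t_0 ⊗ t_0)(f)`, and comes down to
`∂ₓ (f(x, y₁) f(x, y₂)) = -(kmap₃ f)(x, y₁, y₂)` (`lmap_kmap₃_invSq`).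

**Counit and cocreation.** Both statements are closed under products, hence reduce to the generators.

**Jacobi identity.** The three iterated coproducts are algebra homomorphisms into iterated Laurent
series. Triples of series which are the expansions, in the three regions, of one element of
`ℂ[w₁ ^ ±1, w₂ ^ ±1, (w₁ - w₂) ^ ±1]` with coefficients in `𝒜 ⊗ 𝒜 ⊗ 𝒜` (completed by degree) form a
subalgebra (`commonExpansions`), and every such triple satisfies the Jacobi identity, because the delta
function does (`delta_identity`, `jacobi_expansions`). The generators land in this subalgebra: the
iterated coproduct of `D` has the three pairwise interactions as functions of `w₁`, `w₂` and
`w₁ - w₂` (`iterated_t20_mem`).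
-/

open scoped TensorProduct

noncomputable section

-- Makes the commutator bracket of an associative ring satisfy the laws of a Lie ring.
attribute [local instance] LieRing.ofAssociativeRing

/-! ### Homomorphisms out of the M2-brane algebra -/

namespace M2Brane

/-- The quadratic part of `[t_{3,0}, t_{0,d}]`. -/
def quadZero {B : Type*} [Ring B] [Algebra ℂ B] (p : ℕ → B) (d : ℕ) : B :=
  ∑ m ∈ Finset.range (d - 2), (((m : ℂ) + 1) * (((d - 3 - m : ℕ) : ℂ) + 1)) • (p m * p (d - 3 - m))

/-- Elements of an algebra `B` which determine a homomorphism `𝒜 → B`: the images `p n`, `q n`,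
`r n` of `t_{0,n}`, `t_{1,n}`, `t_{2,n}`, the image `D` of `t_{2,0}` and the image `e` of `t_{3,0}`.
The laws are the few consequences of the defining relations from which all of these relations can be
recovered by applying `ad D`. -/
structure CurrentData (ε₁ ε₂ : ℂ) (B : Type*) [Ring B] [Algebra ℂ B] where
  /-- The image of `t_{0,n}`. -/
  p : ℕ → B
  /-- The image of `t_{1,n}`. -/
  q : ℕ → B
  /-- The image of `t_{2,n}`. -/
  r : ℕ → B
  /-- The image of `t_{2,0}`. -/
  D : B
  /-- The image of `t_{3,0}`. -/
  e : B
  p_p : ∀ m n, ⁅p m, p n⁆ = 0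
  D_p : ∀ n, ⁅D, p n⁆ = (2 * n : ℂ) • q (n - 1)
  D_q : ∀ n, ⁅D, q n⁆ = (2 * n : ℂ) • r (n - 1)
  r_zero : r 0 = D
  D_r_one : ⁅D, r 1⁆ = (2 : ℂ) • e
  D_e : ⁅D, e⁆ = 0
  q_p : ∀ n m, ⁅q n, p m⁆ = (m : ℂ) • p (n + m - 1)
  e_p : ∀ d : ℕ, ⁅e, p d⁆ = (3 * d : ℂ) • r (d - 1)
    + (σ₂ ε₁ ε₂ * ((d : ℂ) * (d - 1) * (d - 2) / 4)) • p (d - 3)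
    + (3 / 2 * σ₃ ε₁ ε₂) • quadZero p d

namespace CurrentData

open Finset.HasAntidiagonal (antidiagonal mem_antidiagonal)

variable {ε₁ ε₂ : ℂ} {B : Type*} [Ring B] [Algebra ℂ B] (Γ : CurrentData ε₁ ε₂ B)

/-- The image of `t_{c,d}`, obtained from `p (c + d)` by solving
`[t_{2,0}, t_{c,d+1}] = 2 (d + 1) t_{c+1,d}` for the right-hand side. -/
def T : ℕ → ℕ → B
  | 0, d => Γ.p d
  | c + 1, d => (1 / (2 * ((d : ℂ) + 1))) • ⁅Γ.D, T c (d + 1)⁆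

theorem T_zero (d : ℕ) : Γ.T 0 d = Γ.p d := rfl

theorem T_succ (c d : ℕ) :
    Γ.T (c + 1) d = (1 / (2 * ((d : ℂ) + 1))) • ⁅Γ.D, Γ.T c (d + 1)⁆ := rfl

theorem D_T_succ (c d : ℕ) :
    ⁅Γ.D, Γ.T c (d + 1)⁆ = (2 * ((d : ℂ) + 1)) • Γ.T (c + 1) d := by
  have h : (2 * ((d : ℂ) + 1)) ≠ 0 := mul_ne_zero two_ne_zero (Nat.cast_add_one_ne_zero d)
  rw [T_succ, smul_smul, mul_one_div_cancel h, one_smul]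

theorem T_one (n : ℕ) : Γ.T 1 n = Γ.q n := by
  have h : (2 * ((n : ℂ) + 1)) ≠ 0 := mul_ne_zero two_ne_zero (Nat.cast_add_one_ne_zero n)
  rw [T_succ, T_zero, D_p, smul_smul]
  push_cast
  rw [one_div_mul_cancel h, one_smul]

theorem T_two (n : ℕ) : Γ.T 2 n = Γ.r n := by
  have h : (2 * ((n : ℂ) + 1)) ≠ 0 := mul_ne_zero two_ne_zero (Nat.cast_add_one_ne_zero n)
  rw [T_succ, T_one, D_q, smul_smul]
  push_cast
  rw [one_div_mul_cancel h, one_smul]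

theorem T_three_zero : Γ.T 3 0 = Γ.e := by
  rw [T_succ, T_two, D_r_one, smul_smul]
  norm_num

/-- `ad D` raises the first index, up to a constant. -/
theorem ad_pow_p (c d : ℕ) : ((LieAlgebra.ad ℂ B Γ.D) ^ c) (Γ.p (c + d))
    = (2 ^ c * ((c + d).factorial : ℂ) / (d.factorial : ℂ)) • Γ.T c d := by
  induction c generalizing d with
  | zero => simp [T_zero, Nat.cast_ne_zero.2 d.factorial_ne_zero]
  | succ c ih =>
    have h := ih (d + 1)
    rw [show c + 1 + d = c + (d + 1) by ring, pow_succ', Module.End.mul_apply, h, map_smul,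
      LieAlgebra.ad_apply, D_T_succ, smul_smul]
    congr 1
    have h1 : (d.factorial : ℂ) ≠ 0 := Nat.cast_ne_zero.2 d.factorial_ne_zero
    have h2 : (d : ℂ) + 1 ≠ 0 := Nat.cast_add_one_ne_zero d
    rw [Nat.factorial_succ d]
    push_cast
    field_simp
    ring

theorem q_one_D : ⁅Γ.q 1, Γ.D⁆ = (-2 : ℂ) • Γ.D := by
  rw [← lie_skew, D_q]
  simp [r_zero]

theorem p_two_D : ⁅Γ.p 2, Γ.D⁆ = (-4 : ℂ) • Γ.q 1 := by
  rw [← lie_skew, D_p, ← neg_smul]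
  norm_num

theorem q_one_ad_pow (n k : ℕ) : ⁅Γ.q 1, ((LieAlgebra.ad ℂ B Γ.D) ^ k) (Γ.p n)⁆
    = ((n : ℂ) - 2 * k) • ((LieAlgebra.ad ℂ B Γ.D) ^ k) (Γ.p n) := by
  induction k with
  | zero => simp [q_p]
  | succ k ih =>
    rw [pow_succ', Module.End.mul_apply, LieAlgebra.ad_apply, leibniz_lie, ih, q_one_D, smul_lie,
      lie_smul, ← add_smul]
    push_cast
    congr 1
    ring

theorem p_two_ad_pow (n k : ℕ) : ⁅Γ.p 2, ((LieAlgebra.ad ℂ B Γ.D) ^ (k + 1)) (Γ.p n)⁆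
    = (-4 * (k + 1) * ((n : ℂ) - k)) • ((LieAlgebra.ad ℂ B Γ.D) ^ k) (Γ.p n) := by
  induction k with
  | zero =>
    have := Γ.q_one_ad_pow n 0
    simp only [pow_zero, Module.End.one_apply] at this
    rw [zero_add, pow_one, LieAlgebra.ad_apply, leibniz_lie, p_p, lie_zero, p_two_D, smul_lie,
      this, smul_smul, add_zero]
    simp
  | succ k ih =>
    rw [pow_succ', Module.End.mul_apply, LieAlgebra.ad_apply, leibniz_lie, ih, p_two_D, smul_lie,
      lie_smul, q_one_ad_pow, smul_smul, pow_succ' _ k, Module.End.mul_apply, LieAlgebra.ad_apply,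
      ← add_smul]
    push_cast
    congr 1
    ring

/-- `ad D` acts locally nilpotently on the `p n`: it kills `p 0`, `q 0` and `e`, hence acts
nilpotently on `p 1` and `q 2`, and `ad (q 2)` raises the index of `p n`. -/
theorem p_mem_engel (n : ℕ) : Γ.p n ∈ LieSubalgebra.engel ℂ Γ.D := by
  have h0 : Γ.p 0 ∈ LieSubalgebra.engel ℂ Γ.D :=
    (LieSubalgebra.mem_engel_iff ℂ _ _).2 ⟨1, by simp [D_p]⟩
  have hq0 : Γ.q 0 ∈ LieSubalgebra.engel ℂ Γ.D :=
    (LieSubalgebra.mem_engel_iff ℂ _ _).2 ⟨1, by simp [D_q]⟩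
  have he : Γ.e ∈ LieSubalgebra.engel ℂ Γ.D :=
    (LieSubalgebra.mem_engel_iff ℂ _ _).2 ⟨1, by simp [D_e]⟩
  have up : ∀ x y : B, ∀ a : ℂ, ⁅Γ.D, x⁆ = a • y → y ∈ LieSubalgebra.engel ℂ Γ.D →
      x ∈ LieSubalgebra.engel ℂ Γ.D := by
    intro x y a hxy hy
    obtain ⟨k, hk⟩ := (LieSubalgebra.mem_engel_iff ℂ _ _).1 hy
    refine (LieSubalgebra.mem_engel_iff ℂ _ _).2 ⟨k + 1, ?_⟩
    rw [pow_succ, Module.End.mul_apply, LieAlgebra.ad_apply, hxy, map_smul, hk, smul_zero]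
  have hr1 := up _ _ _ Γ.D_r_one he
  have hq2 : Γ.q 2 ∈ LieSubalgebra.engel ℂ Γ.D := up _ _ _ (Γ.D_q 2) hr1
  induction n with
  | zero => exact h0
  | succ n ih =>
    rcases Nat.eq_zero_or_pos n with rfl | hn
    · exact up _ _ _ (Γ.D_p 1) hq0
    · have h := LieSubalgebra.lie_mem _ hq2 ih
      rw [q_p, show 2 + n - 1 = n + 1 by omega] at h
      have h' := (LieSubalgebra.engel ℂ Γ.D).smul_mem ((n : ℂ)⁻¹) h
      rwa [smul_smul, inv_mul_cancel₀ (Nat.cast_ne_zero.2 hn.ne'), one_smul] at h'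

/-- The elements `p 2`, `q 1` and `D` span a copy of `𝔰𝔩₂` up to rescaling, and `p n` is killed by
`p 2` and has weight `n` for `q 1`. As `ad D` is nilpotent on it, the string through `p n` has
length `n + 1`. -/
theorem ad_pow_succ_p (n : ℕ) : ((LieAlgebra.ad ℂ B Γ.D) ^ (n + 1)) (Γ.p n) = 0 := by
  obtain ⟨k, hk⟩ := (LieSubalgebra.mem_engel_iff ℂ _ _).1 (Γ.p_mem_engel n)
  have hk' : ((LieAlgebra.ad ℂ B Γ.D) ^ (n + 1 + k)) (Γ.p n) = 0 := by
    rw [pow_add, Module.End.mul_apply, hk, map_zero]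
  clear hk
  induction k with
  | zero => exact hk'
  | succ k ih =>
    refine ih ?_
    -- Above the length of the string, `ad (p 2)` takes each power of `ad D` to a nonzero multiple of
    -- the preceding one.
    have h := Γ.p_two_ad_pow n (n + 1 + k)
    rw [show n + 1 + k + 1 = n + 1 + (k + 1) by ring, hk', lie_zero] at h
    refine (smul_eq_zero.1 h.symm).resolve_left ?_
    push_cast
    have h1 : ((n : ℂ) + 1 + k + 1) ≠ 0 := by exact_mod_cast (by omega : n + 1 + k + 1 ≠ 0)
    have h2 : ((k : ℂ) + 1) ≠ 0 := Nat.cast_add_one_ne_zero k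
    have h3 : (n : ℂ) - (n + 1 + k) = -(k + 1) := by ring
    rw [h3]
    exact mul_ne_zero (mul_ne_zero (by norm_num) h1) (neg_ne_zero.2 h2)

/-- The relation `[t_{2,0}, t_{c,0}] = 0`, the only one for `t_{2,0}` which does not hold by the
construction of `T`. -/
theorem D_T_zero (c : ℕ) : ⁅Γ.D, Γ.T c 0⁆ = 0 := by
  have h := Γ.ad_pow_succ_p c
  have h' := Γ.ad_pow_p c 0
  rw [add_zero] at h'
  rw [pow_succ', Module.End.mul_apply, h', map_smul, LieAlgebra.ad_apply] at h
  refine (smul_eq_zero.1 h).resolve_left ?_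
  have h1 : (c.factorial : ℂ) ≠ 0 := Nat.cast_ne_zero.2 c.factorial_ne_zero
  simp [h1]

theorem D_T (c d : ℕ) : ⁅Γ.D, Γ.T c d⁆ = (2 * d : ℂ) • Γ.T (c + 1) (d - 1) := by
  cases d with
  | zero => simp [D_T_zero]
  | succ d => simpa using Γ.D_T_succ c d

/-- Brackets with `T` are determined inductively along the first index. -/
theorem lie_T_succ (x : B) (c d : ℕ) : ⁅x, Γ.T (c + 1) d⁆
    = (1 / (2 * ((d : ℂ) + 1))) • (⁅⁅x, Γ.D⁆, Γ.T c (d + 1)⁆ + ⁅Γ.D, ⁅x, Γ.T c (d + 1)⁆⁆) := by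
  rw [T_succ, lie_smul, leibniz_lie]

theorem p_zero_T (c d : ℕ) : ⁅Γ.p 0, Γ.T c d⁆ = 0 := by
  induction c generalizing d with
  | zero => exact Γ.p_p 0 d
  | succ c ih =>
    have h : ⁅Γ.p 0, Γ.D⁆ = 0 := by rw [← lie_skew, D_p]; simp
    rw [lie_T_succ, ih, h]
    simp

theorem q_zero_T (c d : ℕ) : ⁅Γ.q 0, Γ.T c d⁆ = (d : ℂ) • Γ.T c (d - 1) := by
  induction c generalizing d with
  | zero => rw [T_zero, q_p, zero_add, T_zero]
  | succ c ih =>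
    have h : ⁅Γ.q 0, Γ.D⁆ = 0 := by rw [← lie_skew, D_q]; simp
    have h2 : (d : ℂ) + 1 ≠ 0 := Nat.cast_add_one_ne_zero d
    rw [lie_T_succ, ih, h, zero_lie, zero_add, lie_smul, Nat.add_sub_cancel, D_T, smul_smul,
      smul_smul]
    push_cast
    congr 1
    field_simp

theorem p_one_T (c d : ℕ) : ⁅Γ.p 1, Γ.T c d⁆ = (-(c : ℂ)) • Γ.T (c - 1) d := by
  induction c generalizing d with
  | zero => simp [T_zero, p_p]
  | succ c ih =>
    have h : ⁅Γ.p 1, Γ.D⁆ = (-2 : ℂ) • Γ.q 0 := by rw [← lie_skew, D_p, ← neg_smul]; norm_num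
    have h2 : (d : ℂ) + 1 ≠ 0 := Nat.cast_add_one_ne_zero d
    rw [lie_T_succ, ih, h, smul_lie, q_zero_T, lie_smul, D_T]
    rcases c with _ | c
    · rw [Nat.cast_zero, neg_zero, zero_smul, add_zero, smul_smul, smul_smul, Nat.add_sub_cancel]
      push_cast
      congr 1
      field_simp
    · simp only [smul_smul, ← add_smul, Nat.add_sub_cancel]
      push_cast
      congr 1
      field_simp
      ring

theorem q_one_T (c d : ℕ) : ⁅Γ.q 1, Γ.T c d⁆ = ((d : ℂ) - c) • Γ.T c d := by
  induction c generalizing d with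
  | zero => simp [T_zero, q_p]
  | succ c ih =>
    have h2 : (d : ℂ) + 1 ≠ 0 := Nat.cast_add_one_ne_zero d
    rw [lie_T_succ, ih, q_one_D, smul_lie, lie_smul, D_T]
    simp only [smul_smul, ← add_smul, Nat.add_sub_cancel]
    push_cast
    congr 1
    field_simp
    ring

theorem p_two_T (c d : ℕ) : ⁅Γ.p 2, Γ.T c d⁆ = (-(2 * c : ℂ)) • Γ.T (c - 1) (d + 1) := by
  induction c generalizing d with
  | zero => simp [T_zero, p_p]
  | succ c ih =>
    have h2 : (d : ℂ) + 1 ≠ 0 := Nat.cast_add_one_ne_zero d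
    rw [lie_T_succ, ih, p_two_D, smul_lie, q_one_T, lie_smul, D_T]
    rcases c with _ | c
    · rw [Nat.cast_zero, mul_zero, neg_zero, zero_smul, add_zero, smul_smul, smul_smul,
        Nat.add_sub_cancel]
      push_cast
      congr 1
      field_simp
      ring
    · simp only [smul_smul, ← add_smul, Nat.add_sub_cancel]
      push_cast
      congr 1
      field_simp
      ring

/-- The rescaled generators for which the quadratic part of `[t_{3,0}, t_{c,d}]` has constant
coefficients. -/
def U (n m : ℕ) : B :=
  (((m + n + 1).factorial : ℂ) / (n.factorial * m.factorial)) • Γ.T n m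

theorem D_U_zero (n : ℕ) : ⁅Γ.D, Γ.U n 0⁆ = 0 := by simp [U, D_T]

theorem D_U_succ (n m : ℕ) : ⁅Γ.D, Γ.U n (m + 1)⁆ = (2 * ((n : ℂ) + 1)) • Γ.U (n + 1) m := by
  have h1 : (n.factorial : ℂ) ≠ 0 := Nat.cast_ne_zero.2 n.factorial_ne_zero
  have h2 : (m.factorial : ℂ) ≠ 0 := Nat.cast_ne_zero.2 m.factorial_ne_zero
  have h3 : (m : ℂ) + 1 ≠ 0 := Nat.cast_add_one_ne_zero m
  have h4 : (n : ℂ) + 1 ≠ 0 := Nat.cast_add_one_ne_zero n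
  rw [U, U, lie_smul, D_T, smul_smul, smul_smul, Nat.add_sub_cancel,
    show m + 1 + n + 1 = m + (n + 1) + 1 by ring, Nat.factorial_succ m, Nat.factorial_succ n]
  push_cast
  congr 1
  field_simp

/-- The quadratic part of `[t_{3,0}, t_{c,d+3}]` up to a constant; the sum over the first and over
the second indices is a convolution, so `ad D` acts on it as on a single `U c d`. -/
def V (c d : ℕ) : B :=
  ∑ x ∈ antidiagonal d, ∑ y ∈ antidiagonal c, Γ.U y.1 x.1 * Γ.U y.2 x.2

theorem D_mul (x y : B) : ⁅Γ.D, x * y⁆ = ⁅Γ.D, x⁆ * y + x * ⁅Γ.D, y⁆ := by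
  simp only [Ring.lie_def]
  noncomm_ring

theorem D_V_zero (c : ℕ) : ⁅Γ.D, Γ.V c 0⁆ = 0 := by
  simp [V, lie_sum, D_mul, D_U_zero]

theorem D_V_succ (c d : ℕ) : ⁅Γ.D, Γ.V c (d + 1)⁆ = (2 * ((c : ℂ) + 1)) • Γ.V (c + 1) d := by
  have e1 : ∑ x ∈ antidiagonal (d + 1), ∑ y ∈ antidiagonal c,
      ⁅Γ.D, Γ.U y.1 x.1⁆ * Γ.U y.2 x.2 = ∑ x ∈ antidiagonal d,
      ∑ y ∈ antidiagonal (c + 1), (2 * (y.1 : ℂ)) • (Γ.U y.1 x.1 * Γ.U y.2 x.2) := by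
    rw [Finset.Nat.sum_antidiagonal_succ]
    simp only [D_U_zero, zero_mul, Finset.sum_const_zero, zero_add]
    refine Finset.sum_congr rfl fun x _ => ?_
    rw [Finset.Nat.sum_antidiagonal_succ]
    simp [D_U_succ]
  have e2 : ∑ x ∈ antidiagonal (d + 1), ∑ y ∈ antidiagonal c,
      Γ.U y.1 x.1 * ⁅Γ.D, Γ.U y.2 x.2⁆ = ∑ x ∈ antidiagonal d,
      ∑ y ∈ antidiagonal (c + 1), (2 * (y.2 : ℂ)) • (Γ.U y.1 x.1 * Γ.U y.2 x.2) := by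
    rw [Finset.Nat.sum_antidiagonal_succ']
    simp only [D_U_zero, mul_zero, Finset.sum_const_zero, zero_add]
    refine Finset.sum_congr rfl fun x _ => ?_
    rw [Finset.Nat.sum_antidiagonal_succ']
    simp [D_U_succ]
  rw [V, V]
  simp only [lie_sum, D_mul, Finset.sum_add_distrib, e1, e2, Finset.smul_sum]
  rw [← Finset.sum_add_distrib]
  refine Finset.sum_congr rfl fun x _ => ?_
  rw [← Finset.sum_add_distrib]
  refine Finset.sum_congr rfl fun y hy => ?_
  rw [← add_smul]
  congr 1
  have : (y.1 : ℂ) + y.2 = c + 1 := by exact_mod_cast mem_antidiagonal.1 hy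
  rw [← mul_add, this]

/-- The quadratic part of `[t_{3,0}, t_{c,d}]`. -/
def quad (c d : ℕ) : B :=
  ∑ m ∈ Finset.range (d - 2), ∑ n ∈ Finset.range (c + 1),
    ((((m + n + 1).choose (n + 1) : ℂ) * (n + 1)
        * ((d - 3 - m + (c - n) + 1).choose (c - n + 1) : ℂ) * ((c - n : ℕ) + 1))
      / ((d + c).choose c : ℂ)) • (Γ.T n m * Γ.T (c - n) (d - 3 - m))

theorem choose_mul_eq (m n : ℕ) : ((m + n + 1).choose (n + 1) : ℂ) * (n + 1)
    = ((m + n + 1).factorial : ℂ) / (n.factorial * m.factorial) := by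
  have h1 : (n.factorial : ℂ) ≠ 0 := Nat.cast_ne_zero.2 n.factorial_ne_zero
  have h2 : (m.factorial : ℂ) ≠ 0 := Nat.cast_ne_zero.2 m.factorial_ne_zero
  have h := Nat.add_choose_mul_factorial_mul_factorial m (n + 1)
  rw [Nat.factorial_succ] at h
  rw [eq_div_iff (mul_ne_zero h1 h2), ← add_assoc] at *
  rw [← h]
  push_cast
  ring

theorem quad_add_three (c d : ℕ) : Γ.quad c (d + 3)
    = ((c.factorial : ℂ) * (d + 3).factorial / (c + d + 3).factorial) • Γ.V c d := by
  rw [quad, V, Finset.Nat.sum_antidiagonal_eq_sum_range_succ_mk, Finset.smul_sum]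
  refine Finset.sum_congr (by congr 1) fun m hm => ?_
  rw [Finset.Nat.sum_antidiagonal_eq_sum_range_succ_mk, Finset.smul_sum]
  refine Finset.sum_congr rfl fun n hn => ?_
  rw [Nat.add_sub_cancel]
  rw [U, U, smul_mul_smul_comm, smul_smul, choose_mul_eq, mul_assoc, choose_mul_eq]
  congr 1
  have h := Nat.add_choose_mul_factorial_mul_factorial (d + 3) c
  have h1 : (c.factorial : ℂ) ≠ 0 := Nat.cast_ne_zero.2 c.factorial_ne_zero
  have h2 : ((d + 3).factorial : ℂ) ≠ 0 := Nat.cast_ne_zero.2 (Nat.factorial_ne_zero _)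
  have h3 : (((d + 3 + c).choose c : ℕ) : ℂ) ≠ 0 :=
    Nat.cast_ne_zero.2 (Nat.choose_pos (by omega)).ne'
  rw [show c + d + 3 = d + 3 + c by ring, ← h]
  push_cast
  field_simp

theorem quad_of_lt (c d : ℕ) (hd : d < 3) : Γ.quad c d = 0 := by
  rw [quad, show d - 2 = 0 by omega]
  simp

theorem quad_zero (d : ℕ) : Γ.quad 0 d = quadZero Γ.p d := by
  rw [quad, quadZero]
  refine Finset.sum_congr rfl fun m _ => ?_
  simp [T_zero]

theorem D_quad_succ (c d : ℕ) :
    ⁅Γ.D, Γ.quad c (d + 1)⁆ = (2 * ((d : ℂ) + 1)) • Γ.quad (c + 1) d := by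
  rcases Nat.lt_or_ge d 2 with hd | hd
  · rw [quad_of_lt _ _ _ (by omega), quad_of_lt _ _ _ (by omega), lie_zero, smul_zero]
  obtain ⟨d, rfl⟩ := Nat.exists_eq_add_of_le' hd
  rcases d with _ | d
  · rw [quad_of_lt _ (c + 1) _ (by omega), quad_add_three, lie_smul, D_V_zero, smul_zero, smul_zero]
  · rw [quad_add_three, show d + 1 + 2 + 1 = d + 1 + 3 by ring, quad_add_three, lie_smul, D_V_succ,
      smul_smul, smul_smul, show c + 1 + d + 3 = c + (d + 1) + 3 by ring, Nat.factorial_succ c,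
      show d + 1 + 3 = d + 3 + 1 by ring, Nat.factorial_succ (d + 3)]
    push_cast
    congr 1
    ring

theorem e_T (c d : ℕ) : ⁅Γ.e, Γ.T c d⁆ = (3 * d : ℂ) • Γ.T (c + 2) (d - 1)
    + (σ₂ ε₁ ε₂ * ((d : ℂ) * (d - 1) * (d - 2) / 4)) • Γ.T c (d - 3)
    + (3 / 2 * σ₃ ε₁ ε₂) • Γ.quad c d := by
  induction c generalizing d with
  | zero => rw [T_zero, e_p, T_two, T_zero, quad_zero]
  | succ c ih =>
    have h : ⁅Γ.e, Γ.D⁆ = 0 := by rw [← lie_skew, D_e, neg_zero]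
    have h2 : (d : ℂ) + 1 ≠ 0 := Nat.cast_add_one_ne_zero d
    rw [lie_T_succ, ih, h, zero_lie, zero_add, lie_add, lie_add, lie_smul, lie_smul, lie_smul,
      D_quad_succ, D_T, D_T, smul_add, smul_add]
    congr 1
    · congr 1
      · simp only [smul_smul, Nat.add_sub_cancel]
        push_cast
        congr 1
        field_simp
      · rcases Nat.lt_or_ge d 3 with hd | hd
        · interval_cases d <;> norm_num
        · rw [show d + 1 - 3 - 1 = d - 3 by omega, smul_smul, smul_smul,
            show d + 1 - 3 = d - 2 by omega, Nat.cast_sub (by omega : 2 ≤ d)]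
          push_cast
          congr 1
          field_simp
          ring
    · simp only [smul_smul]
      congr 1
      field_simp

/-- The homomorphism `𝒜 → B` with `t_{c,d} ↦ T c d`. -/
def hom : M2Algebra ε₁ ε₂ →ₐ[ℂ] B :=
  RingQuot.liftAlgHom ℂ ⟨FreeAlgebra.lift ℂ fun x => Γ.T x.1 x.2, by
    have hg : ∀ a b, FreeAlgebra.lift ℂ (fun x : ℕ × ℕ => Γ.T x.1 x.2) (gen a b) = Γ.T a b := by
      intro a b; simp [gen]
    have hl : ∀ x y, FreeAlgebra.lift ℂ (fun x : ℕ × ℕ => Γ.T x.1 x.2) ⁅x, y⁆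
        = ⁅FreeAlgebra.lift ℂ (fun x : ℕ × ℕ => Γ.T x.1 x.2) x,
          FreeAlgebra.lift ℂ (fun x : ℕ × ℕ => Γ.T x.1 x.2) y⁆ := by
      intro x y; simp [Ring.lie_def]
    intro x y h
    cases h with
    | t00 c d => rw [hl, hg, hg, T_zero, p_zero_T, map_zero]
    | t10 c d => rw [hl, hg, hg, T_one, q_zero_T, map_smul, hg]
    | t01 c d => rw [hl, hg, hg, T_zero, p_one_T, map_smul, hg]
    | t20 c d => rw [hl, hg, hg, T_two, r_zero, D_T, map_smul, hg]
    | t11 c d => rw [hl, hg, hg, T_one, q_one_T, map_smul, hg]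
    | t02 c d => rw [hl, hg, hg, T_zero, p_two_T, map_smul, hg]
    | t30 c d =>
      rw [hl, hg, hg, T_three_zero, e_T, map_add, map_add, map_smul, map_smul, map_smul, hg, hg,
        quad, map_sum]
      simp only [map_sum, map_smul, map_mul, hg]⟩

theorem hom_t (a b : ℕ) : Γ.hom (t ε₁ ε₂ a b) = Γ.T a b :=
  (RingQuot.liftAlgHom_mkAlgHom_apply ℂ _ _ (gen a b)).trans (by simp [gen])

end CurrentData

end M2Brane

/-! ### Generators and relations -/

namespace M2Brane

variable (ε₁ ε₂ : ℂ)

/-- The projection from the free algebra onto `𝒜`. -/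
def proj : FreeAlgebra ℂ (ℕ × ℕ) →ₐ[ℂ] M2Algebra ε₁ ε₂ := RingQuot.mkAlgHom ℂ (Rel ε₁ ε₂)

theorem proj_gen (a b : ℕ) : proj ε₁ ε₂ (gen a b) = t ε₁ ε₂ a b := rfl

theorem proj_surjective : Function.Surjective (proj ε₁ ε₂) :=
  RingQuot.mkAlgHom_surjective ℂ (Rel ε₁ ε₂)

theorem proj_rel {x y : FreeAlgebra ℂ (ℕ × ℕ)} (h : Rel ε₁ ε₂ x y) :
    proj ε₁ ε₂ x = proj ε₁ ε₂ y :=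
  RingQuot.mkAlgHom_rel ℂ h

theorem proj_lie (x y : FreeAlgebra ℂ (ℕ × ℕ)) :
    proj ε₁ ε₂ ⁅x, y⁆ = ⁅proj ε₁ ε₂ x, proj ε₁ ε₂ y⁆ := by
  simp [Ring.lie_def]

theorem lie_t00 (c d : ℕ) : ⁅t ε₁ ε₂ 0 0, t ε₁ ε₂ c d⁆ = 0 := by
  simpa only [proj_lie, proj_gen, map_zero] using proj_rel ε₁ ε₂ (Rel.t00 c d)

theorem lie_t01 (c d : ℕ) : ⁅t ε₁ ε₂ 0 1, t ε₁ ε₂ c d⁆ = (-(c : ℂ)) • t ε₁ ε₂ (c - 1) d := by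
  simpa only [proj_lie, proj_gen, map_smul] using proj_rel ε₁ ε₂ (Rel.t01 c d)

theorem lie_t10 (c d : ℕ) : ⁅t ε₁ ε₂ 1 0, t ε₁ ε₂ c d⁆ = (d : ℂ) • t ε₁ ε₂ c (d - 1) := by
  simpa only [proj_lie, proj_gen, map_smul] using proj_rel ε₁ ε₂ (Rel.t10 c d)

theorem lie_t20 (c d : ℕ) :
    ⁅t ε₁ ε₂ 2 0, t ε₁ ε₂ c d⁆ = (2 * d : ℂ) • t ε₁ ε₂ (c + 1) (d - 1) := by
  simpa only [proj_lie, proj_gen, map_smul] using proj_rel ε₁ ε₂ (Rel.t20 c d)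

theorem lie_t02 (c d : ℕ) :
    ⁅t ε₁ ε₂ 0 2, t ε₁ ε₂ c d⁆ = (-(2 * c : ℂ)) • t ε₁ ε₂ (c - 1) (d + 1) := by
  simpa only [proj_lie, proj_gen, map_smul] using proj_rel ε₁ ε₂ (Rel.t02 c d)

theorem lie_t30_t0 (d : ℕ) : ⁅t ε₁ ε₂ 3 0, t ε₁ ε₂ 0 d⁆ = (3 * d : ℂ) • t ε₁ ε₂ 2 (d - 1)
    + (σ₂ ε₁ ε₂ * ((d : ℂ) * (d - 1) * (d - 2) / 4)) • t ε₁ ε₂ 0 (d - 3)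
    + (3 / 2 * σ₃ ε₁ ε₂) • quadZero (t ε₁ ε₂ 0) d := by
  have h := proj_rel ε₁ ε₂ (Rel.t30 0 d)
  rw [proj_lie, proj_gen, proj_gen, map_add, map_add, map_smul, map_smul, map_smul, proj_gen,
    proj_gen, map_sum] at h
  rw [h, quadZero]
  congr 2
  refine Finset.sum_congr rfl fun m _ => ?_
  simp [proj_gen]

theorem lie_t02_t0 (d : ℕ) : ⁅t ε₁ ε₂ 0 2, t ε₁ ε₂ 0 d⁆ = 0 := by
  simp [lie_t02]

theorem lie_t02_quadZero (d : ℕ) : ⁅t ε₁ ε₂ 0 2, quadZero (t ε₁ ε₂ 0) d⁆ = 0 := by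
  have h : ∀ x y z : M2Algebra ε₁ ε₂, ⁅x, y * z⁆ = ⁅x, y⁆ * z + y * ⁅x, z⁆ := by
    intro x y z
    simp only [Ring.lie_def]
    noncomm_ring
  simp [quadZero, lie_sum, h, lie_t02_t0]

/-- Apply `ad t_{0,2}` to the relation for `[t_{3,0}, t_{0,d}]`; the quadratic terms, which
consist of elements `t_{0,m}` only, are killed. -/
theorem lie_t21_t0 (d : ℕ) : ⁅t ε₁ ε₂ 2 1, t ε₁ ε₂ 0 d⁆ = (2 * d : ℂ) • t ε₁ ε₂ 1 d := by
  have h := congrArg (fun x => ⁅t ε₁ ε₂ 0 2, x⁆) (lie_t30_t0 ε₁ ε₂ d)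
  simp only [leibniz_lie (t ε₁ ε₂ 0 2), lie_t02_t0, lie_zero, lie_add, lie_smul, lie_t02_quadZero,
    smul_zero, add_zero] at h
  rw [lie_t02, lie_t02, smul_lie] at h
  rcases Nat.eq_zero_or_pos d with rfl | hd
  · rw [← lie_skew, lie_t00]; simp
  · rw [show d - 1 + 1 = d by omega, smul_smul] at h
    have h2 := congrArg (fun x => (-(1 / 6) : ℂ) • x) h
    simp only [smul_smul] at h2
    norm_num at h2
    rw [h2]
    congr 1
    ring

theorem lie_t12_t0 (d : ℕ) : ⁅t ε₁ ε₂ 1 2, t ε₁ ε₂ 0 d⁆ = (d : ℂ) • t ε₁ ε₂ 0 (d + 1) := by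
  have h := congrArg (fun x => ⁅t ε₁ ε₂ 0 2, x⁆) (lie_t21_t0 ε₁ ε₂ d)
  simp only [leibniz_lie (t ε₁ ε₂ 0 2), lie_t02_t0, lie_zero, lie_smul, add_zero] at h
  rw [lie_t02, lie_t02, smul_lie, smul_smul] at h
  have h2 := congrArg (fun x => (-(1 / 4) : ℂ) • x) h
  simp only [smul_smul] at h2
  norm_num at h2
  rw [h2]
  congr 1
  ring

/-- The `t_{0,n}` commute: this holds for `n ≤ 1`, and `ad t_{1,2}` raises the index. -/
theorem lie_t0_t0 (n m : ℕ) : ⁅t ε₁ ε₂ 0 n, t ε₁ ε₂ 0 m⁆ = 0 := by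
  induction n generalizing m with
  | zero => exact lie_t00 ε₁ ε₂ 0 m
  | succ n ih =>
    rcases Nat.eq_zero_or_pos n with rfl | hn
    · simp [lie_t01]
    · have h : ⁅⁅t ε₁ ε₂ 1 2, t ε₁ ε₂ 0 n⁆, t ε₁ ε₂ 0 m⁆ = 0 := by
        rw [lie_lie, ih, lie_zero, lie_t12_t0, lie_smul, ih, smul_zero, sub_zero]
      rw [lie_t12_t0, smul_lie] at h
      exact (smul_eq_zero.1 h).resolve_left (Nat.cast_ne_zero.2 hn.ne')

/-- Apply `ad t_{2,1}` to `[t_{0,n}, t_{0,m}] = 0`. -/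
theorem lie_t1_t0_symm (n m : ℕ) : (n : ℂ) • ⁅t ε₁ ε₂ 1 n, t ε₁ ε₂ 0 m⁆
    = (m : ℂ) • ⁅t ε₁ ε₂ 1 m, t ε₁ ε₂ 0 n⁆ := by
  have h := congrArg (fun x => ⁅t ε₁ ε₂ 2 1, x⁆) (lie_t0_t0 ε₁ ε₂ n m)
  simp only [leibniz_lie (t ε₁ ε₂ 2 1), lie_t21_t0, lie_zero, lie_smul, smul_lie] at h
  rw [← lie_skew (t ε₁ ε₂ 0 n), smul_neg, ← sub_eq_add_neg, sub_eq_zero, mul_smul, mul_smul] at h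
  exact smul_right_injective _ (two_ne_zero (α := ℂ)) h

/-- Apply `ad t_{2,0}` to `[t_{0,n+1}, t_{0,m}] = 0`. -/
theorem lie_t1_t0_shift (n m : ℕ) : ((n : ℂ) + 1) • ⁅t ε₁ ε₂ 1 n, t ε₁ ε₂ 0 m⁆
    = (m : ℂ) • ⁅t ε₁ ε₂ 1 (m - 1), t ε₁ ε₂ 0 (n + 1)⁆ := by
  have h := congrArg (fun x => ⁅t ε₁ ε₂ 2 0, x⁆) (lie_t0_t0 ε₁ ε₂ (n + 1) m)
  simp only [leibniz_lie (t ε₁ ε₂ 2 0), lie_t20, lie_zero, lie_smul, smul_lie] at h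
  rw [← lie_skew (t ε₁ ε₂ 0 (n + 1)), smul_neg, ← sub_eq_add_neg, sub_eq_zero, mul_smul,
    mul_smul] at h
  simpa using smul_right_injective _ (two_ne_zero (α := ℂ)) h

theorem lie_t1_t0 (n m : ℕ) :
    ⁅t ε₁ ε₂ 1 n, t ε₁ ε₂ 0 m⁆ = (m : ℂ) • t ε₁ ε₂ 0 (n + m - 1) := by
  induction n generalizing m with
  | zero => rw [lie_t10, zero_add]
  | succ n ih =>
    rcases Nat.eq_zero_or_pos m with rfl | hm
    · rw [← lie_skew, lie_t00]; simp
    have hm' : (m : ℂ) ≠ 0 := Nat.cast_ne_zero.2 hm.ne'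
    have h1 := lie_t1_t0_symm ε₁ ε₂ (n + 1) m
    have h2 := lie_t1_t0_shift ε₁ ε₂ n (m + 1)
    rw [ih, Nat.add_sub_cancel] at h2
    have hn : ((n : ℂ) + 1) ≠ 0 := Nat.cast_add_one_ne_zero n
    have hm1 : ((m : ℂ) + 1) ≠ 0 := Nat.cast_add_one_ne_zero m
    push_cast at h1 h2
    rw [smul_comm] at h2
    have h3 := smul_right_injective _ hm1 h2
    rw [← h3, smul_comm] at h1
    have h4 := smul_right_injective _ hn h1
    rw [h4]
    congr 2
    omega

/-- `𝒜` is generated by the `t_{0,n}` and `t_{2,0}`, because `ad t_{2,0}` raises the first index. -/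
theorem adjoin_generators :
    Algebra.adjoin ℂ (Set.range (t ε₁ ε₂ 0) ∪ {t ε₁ ε₂ 2 0}) = ⊤ := by
  have key : ∀ c d, t ε₁ ε₂ c d ∈ Algebra.adjoin ℂ (Set.range (t ε₁ ε₂ 0) ∪ {t ε₁ ε₂ 2 0}) := by
    intro c
    induction c with
    | zero => exact fun d => Algebra.subset_adjoin (Or.inl ⟨d, rfl⟩)
    | succ c ih =>
      intro d
      have h2 : (2 * ((d : ℂ) + 1)) ≠ 0 := mul_ne_zero two_ne_zero (Nat.cast_add_one_ne_zero d)
      have h20 : t ε₁ ε₂ 2 0 ∈ Algebra.adjoin ℂ (Set.range (t ε₁ ε₂ 0) ∪ {t ε₁ ε₂ 2 0}) :=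
        Algebra.subset_adjoin (Or.inr rfl)
      have h := lie_t20 ε₁ ε₂ c (d + 1)
      rw [Nat.add_sub_cancel, Nat.cast_succ, Ring.lie_def] at h
      rw [← one_smul ℂ (t ε₁ ε₂ (c + 1) d), ← inv_mul_cancel₀ h2, mul_smul, ← h]
      exact Subalgebra.smul_mem _ (Subalgebra.sub_mem _ (Subalgebra.mul_mem _ h20 (ih _))
        (Subalgebra.mul_mem _ (ih _) h20)) _
  rw [eq_top_iff]
  rintro v -
  obtain ⟨x, rfl⟩ := proj_surjective ε₁ ε₂ v
  have hx : x ∈ Algebra.adjoin ℂ (Set.range (FreeAlgebra.ι ℂ : ℕ × ℕ → _)) := by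
    rw [FreeAlgebra.adjoin_range_ι]; trivial
  have : proj ε₁ ε₂ x ∈ (Algebra.adjoin ℂ (Set.range (FreeAlgebra.ι ℂ))).map (proj ε₁ ε₂) :=
    Subalgebra.mem_map.2 ⟨x, hx, rfl⟩
  rw [AlgHom.map_adjoin] at this
  refine Algebra.adjoin_le ?_ this
  rintro _ ⟨_, ⟨⟨a, b⟩, rfl⟩, rfl⟩
  exact key a b

variable {ε₁ ε₂}

theorem algHom_ext {R : Type*} [Semiring R] [Algebra ℂ R] {φ ψ : M2Algebra ε₁ ε₂ →ₐ[ℂ] R}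
    (h0 : ∀ n, φ (t ε₁ ε₂ 0 n) = ψ (t ε₁ ε₂ 0 n)) (h2 : φ (t ε₁ ε₂ 2 0) = ψ (t ε₁ ε₂ 2 0)) :
    φ = ψ := by
  refine AlgHom.ext_of_adjoin_eq_top (adjoin_generators ε₁ ε₂) ?_
  rintro _ (⟨n, rfl⟩ | rfl)
  · exact h0 n
  · exact h2

@[elab_as_elim]
theorem generator_induction {P : M2Algebra ε₁ ε₂ → Prop} (v : M2Algebra ε₁ ε₂)
    (t0 : ∀ n, P (t ε₁ ε₂ 0 n)) (t20 : P (t ε₁ ε₂ 2 0))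
    (algebraMap : ∀ r, P (algebraMap ℂ _ r)) (add : ∀ x y, P x → P y → P (x + y))
    (mul : ∀ x y, P x → P y → P (x * y)) : P v := by
  have hv : v ∈ Algebra.adjoin ℂ (Set.range (t ε₁ ε₂ 0) ∪ {t ε₁ ε₂ 2 0}) := by
    rw [adjoin_generators]; trivial
  induction hv using Algebra.adjoin_induction with
  | mem x hx =>
    rcases hx with ⟨n, rfl⟩ | rfl
    exacts [t0 n, t20]
  | algebraMap r => exact algebraMap r
  | add x y _ _ hx hy => exact add x y hx hy
  | mul x y _ _ hx hy => exact mul x y hx hy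

end M2Brane

/-! ### Laurent series and coefficientwise maps -/

namespace LaurentSeries

section coeff

variable {R : Type*} [Ring R]

theorem exists_coeff_eq_zero {V : Type*} [Zero V] (F : LaurentSeries V) :
    ∃ a : ℤ, ∀ i < a, F.coeff i = 0 :=
  ⟨F.order, fun _ hi => HahnSeries.coeff_eq_zero_of_lt_order hi⟩

/-- The coefficients of a product, as sums over an explicit interval of exponents. -/
theorem coeff_mul_Icc (F G : LaurentSeries R) (a b n : ℤ) (hF : ∀ i < a, F.coeff i = 0)
    (hG : ∀ i < b, G.coeff i = 0) :
    (F * G).coeff n = ∑ i ∈ Finset.Icc a (n - b), F.coeff i * G.coeff (n - i) := by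
  rw [HahnSeries.coeff_mul]
  refine Finset.sum_of_injOn Prod.fst ?_ ?_ ?_ ?_
  · rintro ⟨i, j⟩ h ⟨i', j'⟩ h' hii
    simp only [Finset.mem_coe, Finset.mem_antidiagonal] at h h'
    simp only at hii
    ext
    · exact hii
    · simp only; omega
  · rintro ⟨i, j⟩ h
    simp only [Finset.mem_coe, Finset.mem_antidiagonal, HahnSeries.mem_support] at h
    simp only [Finset.coe_Icc, Set.mem_Icc]
    have h1 : a ≤ i := by
      by_contra hlt
      exact h.1 (hF i (by omega))
    have h2 : b ≤ j := by
      by_contra hlt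
      exact h.2.1 (hG j (by omega))
    omega
  · intro i _ hi
    by_contra h0
    refine hi ⟨(i, n - i), ?_, rfl⟩
    simp only [Finset.mem_coe, Finset.mem_antidiagonal, HahnSeries.mem_support]
    exact ⟨left_ne_zero_of_mul h0, right_ne_zero_of_mul h0, by ring⟩
  · rintro ⟨i, j⟩ h
    simp only [Finset.mem_antidiagonal] at h
    simp only
    rw [show n - i = j by omega]

end coeff

section lmap

variable {V V' V'' : Type*} [AddCommGroup V] [Module ℂ V] [AddCommGroup V'] [Module ℂ V']
  [AddCommGroup V''] [Module ℂ V'']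

/-- A linear map applied to the coefficients of Laurent series. -/
def lmap (α : V →ₗ[ℂ] V') : LaurentSeries V →ₗ[ℂ] LaurentSeries V' where
  toFun F := F.map α
  map_add' F G := by ext; simp
  map_smul' c F := by ext; simp

@[simp]
theorem lmap_coeff (α : V →ₗ[ℂ] V') (F : LaurentSeries V) (n : ℤ) :
    (lmap α F).coeff n = α (F.coeff n) := rfl

theorem lmap_single (α : V →ₗ[ℂ] V') (n : ℤ) (v : V) :
    lmap α (HahnSeries.single n v) = HahnSeries.single n (α v) := by
  ext i
  rw [lmap_coeff]
  by_cases h : i = n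
  · subst h; simp
  · simp [HahnSeries.coeff_single_of_ne h]

theorem lmap_comp (β : V' →ₗ[ℂ] V'') (α : V →ₗ[ℂ] V') (F : LaurentSeries V) :
    lmap (β ∘ₗ α) F = lmap β (lmap α F) := rfl

theorem lmap_congr {α β : V →ₗ[ℂ] V'} (h : ∀ v, α v = β v) (F : LaurentSeries V) :
    lmap α F = lmap β F := by
  ext; simp [h]

theorem lmap_add_map (α β : V →ₗ[ℂ] V') (F : LaurentSeries V) :
    lmap (α + β) F = lmap α F + lmap β F := by
  ext; simp

theorem lmap_smul_map (c : ℂ) (α : V →ₗ[ℂ] V') (F : LaurentSeries V) :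
    lmap (c • α) F = c • lmap α F := by
  ext; simp

end lmap

section mul

variable {V V' S U : Type*} [AddCommGroup V] [Module ℂ V] [AddCommGroup V'] [Module ℂ V']
  [Ring S] [Algebra ℂ S] [CommRing U] [Algebra ℂ U]

/-- An identity between products of linear maps extends to Laurent series. -/
theorem lmap_mul_lmap {α : V →ₗ[ℂ] S} {β : V' →ₗ[ℂ] S} {μ : U →ₗ[ℂ] S}
    {i : V →ₗ[ℂ] U} {j : V' →ₗ[ℂ] U} (h : ∀ a b, α a * β b = μ (i a * j b))
    (F : LaurentSeries V) (G : LaurentSeries V') :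
    lmap α F * lmap β G = lmap μ (lmap i F * lmap j G) := by
  obtain ⟨a, ha⟩ := exists_coeff_eq_zero F
  obtain ⟨b, hb⟩ := exists_coeff_eq_zero G
  ext n
  rw [lmap_coeff, coeff_mul_Icc _ _ a b, coeff_mul_Icc _ _ a b, map_sum]
  · exact Finset.sum_congr rfl fun k _ => by simp [h]
  all_goals intro k hk; simp [ha, hb, hk]

/-- An identity between brackets of linear maps extends to Laurent series. -/
theorem lmap_lie_lmap {α : V →ₗ[ℂ] S} {β : V' →ₗ[ℂ] S} {μ : U →ₗ[ℂ] S}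
    {i : V →ₗ[ℂ] U} {j : V' →ₗ[ℂ] U} (h : ∀ a b, ⁅α a, β b⁆ = μ (i a * j b))
    (F : LaurentSeries V) (G : LaurentSeries V') :
    ⁅lmap α F, lmap β G⁆ = lmap μ (lmap i F * lmap j G) := by
  obtain ⟨a, ha⟩ := exists_coeff_eq_zero F
  obtain ⟨b, hb⟩ := exists_coeff_eq_zero G
  ext n
  rw [Ring.lie_def, HahnSeries.coeff_sub, lmap_coeff, coeff_mul_Icc _ _ a b,
    coeff_mul_Icc (lmap β G) _ b a, coeff_mul_Icc (lmap i F) _ a b, map_sum]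
  · rw [← Finset.sum_nbij' (s := Finset.Icc a (n - b)) (t := Finset.Icc b (n - a))
      (fun k => n - k) (fun k => n - k)
      (f := fun k => (lmap β G).coeff (n - k) * (lmap α F).coeff k)
      (g := fun k => (lmap β G).coeff k * (lmap α F).coeff (n - k))]
    · rw [← Finset.sum_sub_distrib]
      refine Finset.sum_congr rfl fun k _ => ?_
      rw [← Ring.lie_def]
      exact h _ _
    · intro k hk; simp only [Finset.mem_Icc] at *; omega
    · intro k hk; simp only [Finset.mem_Icc] at *; omega
    · intro k _; ring
    · intro k _; ring
    · intro k _; simp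
  all_goals intro k hk; simp [ha, hb, hk]

theorem lmap_lie_lmap_eq_zero {α : V →ₗ[ℂ] S} {β : V' →ₗ[ℂ] S} (h : ∀ a b, ⁅α a, β b⁆ = 0)
    (F : LaurentSeries V) (G : LaurentSeries V') : ⁅lmap α F, lmap β G⁆ = 0 := by
  have := lmap_lie_lmap (U := ℂ) (α := α) (β := β) (μ := 0) (i := 0) (j := 0)
    (fun a b => by rw [h, LinearMap.zero_apply]) F G
  rw [this]
  ext; simp

theorem single_lie_lmap {s : S} {β γ : U →ₗ[ℂ] S} (h : ∀ a, ⁅s, β a⁆ = γ a) (n : ℤ)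
    (G : LaurentSeries U) :
    ⁅(HahnSeries.single n s : LaurentSeries S), lmap β G⁆
      = lmap γ (HahnSeries.single n 1 * G) := by
  ext k
  rw [Ring.lie_def, HahnSeries.coeff_sub, lmap_coeff, HahnSeries.coeff_single_mul,
    HahnSeries.coeff_mul_single, HahnSeries.coeff_single_mul, one_mul, lmap_coeff, ← h,
    Ring.lie_def]

theorem C_lie_lmap {s : S} {β : V →ₗ[ℂ] S} {γ : V →ₗ[ℂ] S} (h : ∀ a, ⁅s, β a⁆ = γ a)
    (G : LaurentSeries V) : ⁅(HahnSeries.C s : LaurentSeries S), lmap β G⁆ = lmap γ G := by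
  ext k
  rw [Ring.lie_def, HahnSeries.coeff_sub, lmap_coeff, HahnSeries.C_apply,
    HahnSeries.coeff_single_zero_mul, HahnSeries.coeff_mul_single_zero, lmap_coeff, ← h,
    Ring.lie_def]

end mul

section ring

variable {R S : Type*} [Ring R] [Algebra ℂ R] [Ring S] [Algebra ℂ S]

/-- An algebra homomorphism applied to the coefficients of Laurent series. -/
def lmapHom (φ : R →ₐ[ℂ] S) : LaurentSeries R →ₐ[ℂ] LaurentSeries S :=
  AlgHom.ofLinearMap (lmap φ.toLinearMap)
    (by rw [← HahnSeries.single_zero_one, lmap_single]; simp)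
    (fun F G => by
      obtain ⟨a, ha⟩ := exists_coeff_eq_zero F
      obtain ⟨b, hb⟩ := exists_coeff_eq_zero G
      ext n
      rw [lmap_coeff, coeff_mul_Icc _ _ a b, coeff_mul_Icc _ _ a b, map_sum]
      · exact Finset.sum_congr rfl fun k _ => by simp
      all_goals intro k hk; simp [ha, hb, hk])

@[simp]
theorem lmapHom_coeff (φ : R →ₐ[ℂ] S) (F : LaurentSeries R) (n : ℤ) :
    (lmapHom φ F).coeff n = φ (F.coeff n) := rfl

theorem lmapHom_single (φ : R →ₐ[ℂ] S) (n : ℤ) (r : R) :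
    lmapHom φ (HahnSeries.single n r) = HahnSeries.single n (φ r) := lmap_single _ _ _

end ring

section der

variable {R : Type*} [CommRing R] [Algebra ℂ R]

/-- The coefficientwise structure; for commutative `R` there is also one through power series, which
is equal to it, but not by definition. -/
local instance laurentAlgebra : Algebra ℂ (LaurentSeries R) := HahnSeries.instAlgebra

/-- A derivation applied to the coefficients of Laurent series. -/
def lder (δ : Derivation ℂ R R) : Derivation ℂ (LaurentSeries R) (LaurentSeries R) :=
  Derivation.mk'
    (lmap (δ : R →ₗ[ℂ] R)) (fun F G => by
    obtain ⟨a, ha⟩ := exists_coeff_eq_zero F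
    obtain ⟨b, hb⟩ := exists_coeff_eq_zero G
    ext n
    rw [smul_eq_mul, smul_eq_mul, mul_comm G, HahnSeries.coeff_add, lmap_coeff,
      coeff_mul_Icc _ _ a b, coeff_mul_Icc _ _ a b, coeff_mul_Icc _ _ a b, map_sum,
      ← Finset.sum_add_distrib]
    · refine Finset.sum_congr rfl fun k _ => ?_
      simp only [lmap_coeff, Derivation.coeFn_coe, Derivation.leibniz, smul_eq_mul]
      ring
    all_goals intro k hk; simp [ha, hb, hk])

@[simp]
theorem lder_coeff (δ : Derivation ℂ R R) (F : LaurentSeries R) (n : ℤ) :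
    (lder δ F).coeff n = δ (F.coeff n) := rfl

theorem lder_single (δ : Derivation ℂ R R) (n : ℤ) (r : R) :
    lder δ (HahnSeries.single n r) = HahnSeries.single n (δ r) := lmap_single _ _ _

end der

section inv

variable {R : Type*} [CommRing R]

/-- The expansion `∑ (k + 1) z ^ k w ^ (-k - 2)` of `(w - z) ^ (-2)`. -/
def invSq (z : R) : LaurentSeries R :=
  HahnSeries.single 2 1 * HahnSeries.ofPowerSeries ℤ R
    (PowerSeries.mk fun k => ((k : R) + 1) * z ^ k)

theorem single_mul_ofPowerSeries_coeff {R : Type*} [Ring R] (m : ℤ) (f : PowerSeries R) (n : ℤ) :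
    (HahnSeries.single m (1 : R) * HahnSeries.ofPowerSeries ℤ R f : LaurentSeries R).coeff n
      = if m ≤ n then PowerSeries.coeff (n - m).toNat f else 0 := by
  rw [HahnSeries.coeff_single_mul, one_mul]
  split_ifs with h
  · obtain ⟨k, hk⟩ := Int.eq_ofNat_of_zero_le (sub_nonneg.2 h)
    rw [hk]
    exact HahnSeries.ofPowerSeries_apply_coeff _ _
  · rw [HahnSeries.ofPowerSeries_apply]
    refine HahnSeries.embDomain_of_notMem_range ?_
    rintro ⟨k, hk⟩
    simp at hk
    omega

theorem invSq_coeff (z : R) (n : ℤ) : (invSq z).coeff n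
    = if 2 ≤ n then (((n - 2).toNat : R) + 1) * z ^ (n - 2).toNat else 0 := by
  rw [invSq, single_mul_ofPowerSeries_coeff, PowerSeries.coeff_mk]

theorem invSq_mul (z : R) :
    invSq z * (HahnSeries.single (-1) 1 - HahnSeries.C z) ^ 2 = 1 := by
  have e : (HahnSeries.single (-1) 1 - HahnSeries.C z : LaurentSeries R) ^ 2
      = HahnSeries.single (-2) 1 - HahnSeries.single (-1) (2 * z)
        + HahnSeries.single 0 (z ^ 2) := by
    rw [sub_sq, HahnSeries.single_pow, HahnSeries.C_apply, HahnSeries.single_pow, mul_assoc,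
      HahnSeries.single_mul_single, two_mul, two_mul, HahnSeries.single_add]
    norm_num
  rw [e, mul_add, mul_sub]
  ext n
  simp only [HahnSeries.coeff_add, HahnSeries.coeff_sub, HahnSeries.coeff_mul_single, invSq_coeff,
    HahnSeries.coeff_one]
  rcases lt_trichotomy n 0 with h | rfl | h
  · rw [if_neg (by omega), if_neg (by omega), if_neg (by omega), if_neg (by omega)]
    simp
  · norm_num
  · obtain ⟨k, rfl⟩ : ∃ k : ℕ, n = k + 1 := ⟨(n - 1).toNat, by omega⟩
    rw [if_pos (by omega), if_pos (by omega), if_neg (by omega : ¬ ((k : ℤ) + 1 = 0))]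
    rw [show ((k : ℤ) + 1 - -2 - 2).toNat = k + 1 by omega,
      show ((k : ℤ) + 1 - -1 - 2).toNat = k by omega]
    split_ifs with h2
    · obtain ⟨k, rfl⟩ : ∃ j : ℕ, k = j + 1 := ⟨k - 1, by omega⟩
      rw [show ((k + 1 : ℕ) + 1 - 0 - 2 : ℤ).toNat = k by omega]
      push_cast
      ring
    · obtain rfl : k = 0 := by omega
      simp
      ring

end inv

end LaurentSeries

/-! ### A family of symmetric polynomials -/

namespace M2Brane

section kpoly

/-- The polynomial `∑ (i + 1) (j + 1) x ^ i y ^ j` over `i + j = d - 3`, which is `0` for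
`d < 3`. It encodes the quadratic part of `[t_{3,0}, t_{0,d}]`. -/
def kpoly {R : Type*} [CommRing R] (d : ℕ) (x y : R) : R :=
  ∑ m ∈ Finset.range (d - 2),
    ((m : R) + 1) * (((d - 3 - m : ℕ) : R) + 1) * (x ^ m * y ^ (d - 3 - m))

variable {R : Type*} [CommRing R]

theorem kpoly_of_lt {d : ℕ} (hd : d < 3) (x y : R) : kpoly d x y = 0 := by
  rw [kpoly, show d - 2 = 0 by omega]
  simp

theorem kpoly_add_three (l : ℕ) (x y : R) : kpoly (l + 3) x y
    = ∑ m ∈ Finset.range (l + 1), ((m : R) + 1) * (((l - m : ℕ) : R) + 1) * (x ^ m * y ^ (l - m)) :=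
  rfl

theorem map_kpoly {S F : Type*} [CommRing S] [FunLike F R S] [RingHomClass F R S] (φ : F) (d : ℕ)
    (x y : R) : φ (kpoly d x y) = kpoly d (φ x) (φ y) := by
  simp [kpoly]

theorem kpoly_comm (d : ℕ) (x y : R) : kpoly d x y = kpoly d y x := by
  rcases Nat.lt_or_ge d 3 with hd | hd
  · rw [kpoly_of_lt hd, kpoly_of_lt hd]
  obtain ⟨l, rfl⟩ := Nat.exists_eq_add_of_le' hd
  rw [kpoly_add_three, kpoly_add_three, ← Finset.sum_range_reflect]
  refine Finset.sum_congr rfl fun m hm => ?_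
  have hm' : m ≤ l := by simpa [Nat.lt_succ_iff] using hm
  rw [show l + 1 - 1 - m = l - m by omega, show l - (l - m) = m by omega]
  ring

theorem sq_mul_sum (l : ℕ) (x y : R) :
    (x - y) ^ 2 * ∑ m ∈ Finset.range (l + 1), ((m : R) + 1) * (x ^ m * y ^ (l - m))
      = ((l : R) + 2) * x ^ (l + 1) * (x - y) - (x ^ (l + 2) - y ^ (l + 2)) := by
  induction l with
  | zero => simp; ring
  | succ l ih =>
    rw [Finset.sum_range_succ, Nat.sub_self]
    have h : ∑ m ∈ Finset.range (l + 1), ((m : R) + 1) * (x ^ m * y ^ (l + 1 - m))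
        = y * ∑ m ∈ Finset.range (l + 1), ((m : R) + 1) * (x ^ m * y ^ (l - m)) := by
      rw [Finset.mul_sum]
      refine Finset.sum_congr rfl fun m hm => ?_
      have hm' : m ≤ l := by simpa [Nat.lt_succ_iff] using hm
      rw [show l + 1 - m = l - m + 1 by omega]
      ring
    rw [h, mul_add, mul_left_comm, ih]
    push_cast
    ring

/-- The closed form of `kpoly`, after clearing the denominator `(x - y) ^ 3`. -/
theorem cube_mul_kpoly (d : ℕ) (x y : R) : (x - y) ^ 3 * kpoly d x y
    = d * (x ^ (d - 1) + y ^ (d - 1)) * (x - y) - 2 * (x ^ d - y ^ d) := by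
  rcases Nat.lt_or_ge d 3 with hd | hd
  · rw [kpoly_of_lt hd]
    interval_cases d <;> norm_num
    ring
  obtain ⟨l, rfl⟩ := Nat.exists_eq_add_of_le' hd
  rw [kpoly_add_three, Nat.add_sub_assoc (by norm_num)]
  induction l with
  | zero => norm_num; ring
  | succ l ih =>
    rw [Finset.sum_range_succ, Nat.sub_self]
    have h : ∑ m ∈ Finset.range (l + 1),
          ((m : R) + 1) * (((l + 1 - m : ℕ) : R) + 1) * (x ^ m * y ^ (l + 1 - m))
        = y * ∑ m ∈ Finset.range (l + 1),
            ((m : R) + 1) * (((l - m : ℕ) : R) + 1) * (x ^ m * y ^ (l - m))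
          + y * ∑ m ∈ Finset.range (l + 1), ((m : R) + 1) * (x ^ m * y ^ (l - m)) := by
      rw [Finset.mul_sum, Finset.mul_sum, ← Finset.sum_add_distrib]
      refine Finset.sum_congr rfl fun m hm => ?_
      have hm' : m ≤ l := by simpa [Nat.lt_succ_iff] using hm
      rw [show l + 1 - m = l - m + 1 by omega]
      push_cast
      ring
    have h2 := sq_mul_sum l x y
    have h1 := ih (by omega)
    norm_num at h1 ⊢
    rw [h]
    linear_combination y * h1 + y * (x - y) * h2

theorem sum_choose_mul_deriv (d : ℕ) (s x : R) :
    ∑ m ∈ Finset.range (d + 1), (d.choose m : R) * s ^ (d - m) * (m * x ^ (m - 1))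
      = d * (x + s) ^ (d - 1) := by
  rcases d with _ | d
  · simp
  rw [Finset.sum_range_succ', Nat.add_sub_cancel, add_pow, Finset.mul_sum]
  simp only [Nat.cast_zero, zero_mul, mul_zero, add_zero]
  refine Finset.sum_congr rfl fun m hm => ?_
  have h := Nat.add_one_mul_choose_eq d m
  rw [Nat.add_sub_cancel, Nat.add_sub_add_right]
  have h' : ((d : R) + 1) * (d.choose m : R) = ((d + 1).choose (m + 1) : R) * (m + 1) := by
    simpa using congrArg (Nat.cast : ℕ → R) h
  push_cast
  linear_combination (-(x ^ m * s ^ (d - m))) * h'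

/-- Translation of both variables. By `cube_mul_kpoly` this is clear after multiplication by
`(x - y) ^ 3`, which can be cancelled in the polynomial ring in `x`, `y`, `s`. -/
theorem kpoly_add (d : ℕ) (x y s : R) : kpoly d (x + s) (y + s)
    = ∑ m ∈ Finset.range (d + 1), (d.choose m : R) * s ^ (d - m) * kpoly m x y := by
  suffices h : kpoly d (MvPolynomial.X 0 + MvPolynomial.X 2 : MvPolynomial (Fin 3) ℤ)
      (MvPolynomial.X 1 + MvPolynomial.X 2) = ∑ m ∈ Finset.range (d + 1),
      (d.choose m : MvPolynomial (Fin 3) ℤ) * (MvPolynomial.X 2) ^ (d - m)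
        * kpoly m (MvPolynomial.X 0) (MvPolynomial.X 1) by
    have h' := congrArg (MvPolynomial.aeval (![x, y, s] : Fin 3 → R)) h
    simpa only [map_kpoly, map_sum, map_add, map_mul, map_pow, map_natCast, MvPolynomial.aeval_X,
      Matrix.cons_val] using h'
  have hne : (MvPolynomial.X 0 - MvPolynomial.X 1 : MvPolynomial (Fin 3) ℤ) ^ 3 ≠ 0 := by
    refine pow_ne_zero _ (sub_ne_zero.2 fun h => ?_)
    exact absurd (MvPolynomial.X_injective h) (by decide)
  refine mul_left_cancel₀ hne ?_
  generalize (MvPolynomial.X 0 : MvPolynomial (Fin 3) ℤ) = x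
  generalize (MvPolynomial.X 1 : MvPolynomial (Fin 3) ℤ) = y
  generalize (MvPolynomial.X 2 : MvPolynomial (Fin 3) ℤ) = s
  have h1 := cube_mul_kpoly d (x + s) (y + s)
  rw [add_sub_add_right_eq_sub] at h1
  have h2 : ∀ m, (x - y) ^ 3 * ((d.choose m : MvPolynomial (Fin 3) ℤ) * s ^ (d - m) * kpoly m x y)
      = (d.choose m * s ^ (d - m) * (m * x ^ (m - 1))
            + d.choose m * s ^ (d - m) * (m * y ^ (m - 1)))
          * (x - y)
        - 2 * (x ^ m * s ^ (d - m) * d.choose m - y ^ m * s ^ (d - m) * d.choose m) := by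
    intro m
    linear_combination ((d.choose m : MvPolynomial (Fin 3) ℤ) * s ^ (d - m)) * cube_mul_kpoly m x y
  rw [h1, Finset.mul_sum, Finset.sum_congr rfl fun m _ => h2 m, Finset.sum_sub_distrib,
    ← Finset.sum_mul, ← Finset.mul_sum, Finset.sum_add_distrib, Finset.sum_sub_distrib,
    sum_choose_mul_deriv, sum_choose_mul_deriv, ← add_pow, ← add_pow]
  ring

end kpoly

end M2Brane

-- Fixes the coefficientwise algebra structure also outside its section.
attribute [local instance] LaurentSeries.laurentAlgebra

/-! ### Polynomial currents -/

namespace M2Brane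

open Polynomial LaurentSeries

variable (ε₁ ε₂ : ℂ)

/-- The current `t_a`, that is, the linear map `x ^ n ↦ t_{a,n}`. -/
def cur (a : ℕ) : ℂ[X] →ₗ[ℂ] M2Algebra ε₁ ε₂ :=
  (Polynomial.basisMonomials ℂ).constr ℂ (t ε₁ ε₂ a)

theorem cur_monomial (a n : ℕ) (c : ℂ) : cur ε₁ ε₂ a (monomial n c) = c • t ε₁ ε₂ a n := by
  have h : monomial n c = c • Polynomial.basisMonomials ℂ n := by
    simp [smul_monomial]
  rw [h, map_smul, cur, Module.Basis.constr_basis]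

theorem cur_X_pow (a n : ℕ) : cur ε₁ ε₂ a (X ^ n) = t ε₁ ε₂ a n := by
  rw [X_pow_eq_monomial, cur_monomial, one_smul]

theorem cur_one (a : ℕ) : cur ε₁ ε₂ a 1 = t ε₁ ε₂ a 0 := cur_X_pow ε₁ ε₂ a 0

theorem cur_X (a : ℕ) : cur ε₁ ε₂ a X = t ε₁ ε₂ a 1 := by
  simpa using cur_X_pow ε₁ ε₂ a 1

/-- The quadratic part of `ad t_{3,0}` on the currents `t_{0,n}`. -/
def curQuad : ℂ[X] →ₗ[ℂ] M2Algebra ε₁ ε₂ :=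
  (Polynomial.basisMonomials ℂ).constr ℂ (quadZero (t ε₁ ε₂ 0))

theorem curQuad_monomial (n : ℕ) (c : ℂ) :
    curQuad ε₁ ε₂ (monomial n c) = c • quadZero (t ε₁ ε₂ 0) n := by
  have h : monomial n c = c • Polynomial.basisMonomials ℂ n := by
    simp [smul_monomial]
  rw [h, map_smul, curQuad, Module.Basis.constr_basis]

theorem lie_t20_cur (a : ℕ) (φ : ℂ[X]) :
    ⁅t ε₁ ε₂ 2 0, cur ε₁ ε₂ a φ⁆ = (2 : ℂ) • cur ε₁ ε₂ (a + 1) (derivative φ) := by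
  induction φ using Polynomial.induction_on' with
  | add p q hp hq => simp only [map_add, lie_add, hp, hq, smul_add]
  | monomial n c =>
    rw [derivative_monomial, cur_monomial, cur_monomial, lie_smul, lie_t20, smul_smul, smul_smul]
    congr 1
    ring

theorem cur_lie_cur (φ ψ : ℂ[X]) : ⁅cur ε₁ ε₂ 0 φ, cur ε₁ ε₂ 0 ψ⁆ = 0 := by
  induction φ using Polynomial.induction_on' with
  | add p q hp hq => simp only [map_add, add_lie, hp, hq, add_zero]
  | monomial n c =>
    induction ψ using Polynomial.induction_on' with
    | add p q hp hq => simp only [map_add, lie_add, hp, hq, add_zero]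
    | monomial m e => simp only [cur_monomial, lie_smul, smul_lie, lie_t0_t0, smul_zero]

theorem cur_mul_comm (φ ψ : ℂ[X]) :
    cur ε₁ ε₂ 0 φ * cur ε₁ ε₂ 0 ψ = cur ε₁ ε₂ 0 ψ * cur ε₁ ε₂ 0 φ :=
  sub_eq_zero.1 (cur_lie_cur ε₁ ε₂ φ ψ)

theorem cur_one_lie_cur (φ ψ : ℂ[X]) :
    ⁅cur ε₁ ε₂ 1 φ, cur ε₁ ε₂ 0 ψ⁆ = cur ε₁ ε₂ 0 (φ * derivative ψ) := by
  induction φ using Polynomial.induction_on' with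
  | add p q hp hq => simp only [map_add, add_lie, hp, hq, add_mul]
  | monomial n c =>
    induction ψ using Polynomial.induction_on' with
    | add p q hp hq => simp only [map_add, lie_add, hp, hq, mul_add]
    | monomial m e =>
      rw [derivative_monomial, monomial_mul_monomial, cur_monomial, cur_monomial, cur_monomial,
        lie_smul, smul_lie, lie_t1_t0, smul_smul, smul_smul]
      rcases m with _ | m
      · simp
      · rw [Nat.add_sub_cancel, ← add_assoc, Nat.add_sub_cancel]
        congr 1
        ring

theorem lie_t21_cur (φ : ℂ[X]) :
    ⁅t ε₁ ε₂ 2 1, cur ε₁ ε₂ 0 φ⁆ = (2 : ℂ) • cur ε₁ ε₂ 1 (X * derivative φ) := by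
  induction φ using Polynomial.induction_on' with
  | add p q hp hq => simp only [map_add, lie_add, hp, hq, smul_add, mul_add]
  | monomial n c =>
    rw [derivative_monomial, X_mul_monomial, cur_monomial, cur_monomial, lie_smul, lie_t21_t0,
      smul_smul, smul_smul]
    rcases n with _ | n
    · simp
    · rw [Nat.add_sub_cancel]
      congr 1
      ring

theorem lie_t30_cur (φ : ℂ[X]) : ⁅t ε₁ ε₂ 3 0, cur ε₁ ε₂ 0 φ⁆
    = (3 : ℂ) • cur ε₁ ε₂ 2 (derivative φ)
      + (σ₂ ε₁ ε₂ / 4) • cur ε₁ ε₂ 0 (derivative (derivative (derivative φ)))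
      + (3 / 2 * σ₃ ε₁ ε₂) • curQuad ε₁ ε₂ φ := by
  induction φ using Polynomial.induction_on' with
  | add p q hp hq =>
    simp only [map_add, lie_add, hp, hq, smul_add]
    abel
  | monomial n c =>
    simp only [derivative_monomial, cur_monomial, curQuad_monomial, lie_smul, lie_t30_t0, smul_add,
      smul_smul]
    congr 1
    · congr 1
      · congr 1
        ring
      · rw [show n - 1 - 1 - 1 = n - 3 by omega]
        congr 1
        rcases n with _ | _ | n
        · simp
        · simp
        · push_cast
          ring
    · congr 1
      ring

/-! ### Two variables -/

/-- The polynomial ring in two variables, as a tensor square. -/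
abbrev Poly₂ : Type := ℂ[X] ⊗[ℂ] ℂ[X]

/-- A derivation of the first tensor factor. -/
def derLeft (R S : Type*) [CommRing R] [Algebra ℂ R] [CommRing S] [Algebra ℂ S]
    (δ : Derivation ℂ R R) : Derivation ℂ (R ⊗[ℂ] S) (R ⊗[ℂ] S) :=
  Derivation.mk' ((δ : R →ₗ[ℂ] R).rTensor S) (fun x y => by
    induction x with
    | zero => simp
    | add x x' hx hx' => simp only [add_mul, map_add, hx, hx', add_smul, smul_add]; abel
    | tmul a b =>
      induction y with
      | zero => simp
      | add x x' hx hx' => simp only [mul_add, map_add, hx, hx', add_smul, smul_add]; abel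
      | tmul a' b' =>
        simp [TensorProduct.add_tmul, mul_comm b b'])

/-- A derivation of the second tensor factor. -/
def derRight (R S : Type*) [CommRing R] [Algebra ℂ R] [CommRing S] [Algebra ℂ S]
    (δ : Derivation ℂ S S) : Derivation ℂ (R ⊗[ℂ] S) (R ⊗[ℂ] S) :=
  Derivation.mk' ((δ : S →ₗ[ℂ] S).lTensor R) (fun x y => by
    induction x with
    | zero => simp
    | add x x' hx hx' => simp only [add_mul, map_add, hx, hx', add_smul, smul_add]; abel
    | tmul a b =>
      induction y with
      | zero => simp
      | add x x' hx hx' => simp only [mul_add, map_add, hx, hx', add_smul, smul_add]; abel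
      | tmul a' b' =>
        simp [TensorProduct.tmul_add, mul_comm a a'])

theorem derLeft_tmul {R S : Type*} [CommRing R] [Algebra ℂ R] [CommRing S] [Algebra ℂ S]
    (δ : Derivation ℂ R R) (a : R) (b : S) : derLeft R S δ (a ⊗ₜ b) = δ a ⊗ₜ b := rfl

theorem derRight_tmul {R S : Type*} [CommRing R] [Algebra ℂ R] [CommRing S] [Algebra ℂ S]
    (δ : Derivation ℂ S S) (a : R) (b : S) : derRight R S δ (a ⊗ₜ b) = a ⊗ₜ δ b := rfl

/-- The linear map `x ^ d ↦ kpoly d x y`. -/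
def kmap : ℂ[X] →ₗ[ℂ] Poly₂ :=
  (Polynomial.basisMonomials ℂ).constr ℂ (fun d => kpoly d ((X : ℂ[X]) ⊗ₜ 1) (1 ⊗ₜ (X : ℂ[X])))

theorem kmap_X_pow (n : ℕ) : kmap (X ^ n) = kpoly n ((X : ℂ[X]) ⊗ₜ 1) (1 ⊗ₜ (X : ℂ[X])) := by
  have h : X ^ n = Polynomial.basisMonomials ℂ n := by simp [X_pow_eq_monomial]
  rw [h, kmap, Module.Basis.constr_basis]

/-- The product of two currents. -/
def curMul : Poly₂ →ₗ[ℂ] M2Algebra ε₁ ε₂ :=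
  LinearMap.mul' ℂ (M2Algebra ε₁ ε₂) ∘ₗ TensorProduct.map (cur ε₁ ε₂ 0) (cur ε₁ ε₂ 0)

theorem curMul_tmul (φ ψ : ℂ[X]) : curMul ε₁ ε₂ (φ ⊗ₜ ψ) = cur ε₁ ε₂ 0 φ * cur ε₁ ε₂ 0 ψ := rfl

theorem curMul_kmap (φ : ℂ[X]) : curMul ε₁ ε₂ (kmap φ) = curQuad ε₁ ε₂ φ := by
  induction φ using Polynomial.induction_on' with
  | add p q hp hq => simp only [map_add, hp, hq]
  | monomial n c =>
    rw [← mul_one c, ← smul_eq_mul, ← smul_monomial, map_smul, map_smul, map_smul,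
      ← X_pow_eq_monomial, kmap_X_pow, X_pow_eq_monomial, curQuad_monomial, one_smul]
    congr 1
    rw [kpoly, quadZero, map_sum]
    refine Finset.sum_congr rfl fun m _ => ?_
    have e : ∀ (k : ℕ) (z : Poly₂), ((k : Poly₂) + 1) * z = ((k : ℂ) + 1) • z := fun k z => by
      rw [add_mul, one_mul, ← nsmul_eq_mul, add_smul, one_smul, Nat.cast_smul_eq_nsmul]
    have h : (((m : Poly₂) + 1) * (((n - 3 - m : ℕ) : Poly₂) + 1)
        * (((X : ℂ[X]) ⊗ₜ[ℂ] (1 : ℂ[X])) ^ m * ((1 : ℂ[X]) ⊗ₜ[ℂ] (X : ℂ[X])) ^ (n - 3 - m)))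
        = (((m : ℂ) + 1) * (((n - 3 - m : ℕ) : ℂ) + 1))
          • ((X ^ m : ℂ[X]) ⊗ₜ[ℂ] (X ^ (n - 3 - m) : ℂ[X])) := by
      rw [Algebra.TensorProduct.tmul_pow, Algebra.TensorProduct.tmul_pow,
        Algebra.TensorProduct.tmul_mul_tmul, one_pow, one_pow, one_mul, mul_one, mul_assoc,
        mul_smul, e, e]
    rw [h, map_smul, curMul_tmul, cur_X_pow, cur_X_pow]

end M2Brane

namespace M2Brane

open Polynomial LaurentSeries

variable (ε₁ ε₂ : ℂ)

/-! ### Shifted currents -/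

/-- The coordinate `x + c w`, for a constant `c`; the variable of the Laurent series is `w⁻¹`. -/
def shift (c : ℂ) : LaurentSeries ℂ[X] :=
  HahnSeries.C X + HahnSeries.single (-1) (Polynomial.C c)

theorem shift_zero : shift 0 = HahnSeries.C X := by simp [shift]

theorem lder_shift (c : ℂ) : lder Polynomial.derivative' (shift c) = 1 := by
  rw [shift, map_add, HahnSeries.C_apply, lder_single, lder_single]
  simp

section side

variable {S : Type*} [Ring S] [Algebra ℂ S] (ι : M2Algebra ε₁ ε₂ →ₐ[ℂ] S)

/-- The current `t_a`, applied to the coefficients of Laurent series and followed by `ι`. -/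
def lcur (a : ℕ) : LaurentSeries ℂ[X] →ₗ[ℂ] LaurentSeries S :=
  lmap (ι.toLinearMap ∘ₗ cur ε₁ ε₂ a)

theorem algHom_lie {R : Type*} [Ring R] [Algebra ℂ R] (φ : R →ₐ[ℂ] S) (x y : R) :
    φ ⁅x, y⁆ = ⁅φ x, φ y⁆ := by
  simp [Ring.lie_def]

theorem t20_lie_lcur (a : ℕ) (F : LaurentSeries ℂ[X]) :
    ⁅(HahnSeries.C (ι (t ε₁ ε₂ 2 0)) : LaurentSeries S), lcur ε₁ ε₂ ι a F⁆
      = (2 : ℂ) • lcur ε₁ ε₂ ι (a + 1) (lder Polynomial.derivative' F) := by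
  rw [lcur, C_lie_lmap (γ := (2 : ℂ) • (ι.toLinearMap ∘ₗ cur ε₁ ε₂ (a + 1)
    ∘ₗ (Polynomial.derivative : ℂ[X] →ₗ[ℂ] ℂ[X])))]
  · rw [lmap_smul_map]
    rfl
  · intro φ
    have := congrArg ι (lie_t20_cur ε₁ ε₂ a φ)
    rw [algHom_lie, map_smul] at this
    exact this

theorem lcur_lie_lcur (F G : LaurentSeries ℂ[X]) :
    ⁅lcur ε₁ ε₂ ι 0 F, lcur ε₁ ε₂ ι 0 G⁆ = 0 := by
  refine lmap_lie_lmap_eq_zero (fun a b => ?_) F G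
  have := congrArg ι (cur_lie_cur ε₁ ε₂ a b)
  rwa [algHom_lie, map_zero] at this

theorem lcur_one_lie_lcur (F G : LaurentSeries ℂ[X]) :
    ⁅lcur ε₁ ε₂ ι 1 F, lcur ε₁ ε₂ ι 0 G⁆
      = lcur ε₁ ε₂ ι 0 (F * lder Polynomial.derivative' G) := by
  rw [lcur, lcur, lmap_lie_lmap (μ := ι.toLinearMap ∘ₗ cur ε₁ ε₂ 0) (i := LinearMap.id)
    (j := (Polynomial.derivative : ℂ[X] →ₗ[ℂ] ℂ[X]))]
  · rfl
  · intro φ ψ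
    have := congrArg ι (cur_one_lie_cur ε₁ ε₂ φ ψ)
    rwa [algHom_lie] at this

theorem t30_lie_lcur (F : LaurentSeries ℂ[X]) :
    ⁅(HahnSeries.C (ι (t ε₁ ε₂ 3 0)) : LaurentSeries S), lcur ε₁ ε₂ ι 0 F⁆
      = (3 : ℂ) • lcur ε₁ ε₂ ι 2 (lder Polynomial.derivative' F)
        + (σ₂ ε₁ ε₂ / 4) • lcur ε₁ ε₂ ι 0 (lder Polynomial.derivative'
          (lder Polynomial.derivative' (lder Polynomial.derivative' F)))
        + (3 / 2 * σ₃ ε₁ ε₂) • lmap (ι.toLinearMap ∘ₗ curQuad ε₁ ε₂) F := by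
  have h := C_lie_lmap (s := ι (t ε₁ ε₂ 3 0)) (β := ι.toLinearMap ∘ₗ cur ε₁ ε₂ 0)
    (γ := (3 : ℂ) • (ι.toLinearMap ∘ₗ cur ε₁ ε₂ 2 ∘ₗ (Polynomial.derivative : ℂ[X] →ₗ[ℂ] ℂ[X]))
      + (σ₂ ε₁ ε₂ / 4) • (ι.toLinearMap ∘ₗ cur ε₁ ε₂ 0
        ∘ₗ (Polynomial.derivative : ℂ[X] →ₗ[ℂ] ℂ[X]) ∘ₗ (Polynomial.derivative : ℂ[X] →ₗ[ℂ] ℂ[X])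
        ∘ₗ (Polynomial.derivative : ℂ[X] →ₗ[ℂ] ℂ[X]))
      + (3 / 2 * σ₃ ε₁ ε₂) • (ι.toLinearMap ∘ₗ curQuad ε₁ ε₂)) (fun φ => by
        have := congrArg ι (lie_t30_cur ε₁ ε₂ φ)
        rw [algHom_lie, map_add, map_add, map_smul, map_smul, map_smul] at this
        exact this) F
  rw [lcur, h, lmap_add_map, lmap_add_map, lmap_smul_map, lmap_smul_map, lmap_smul_map]
  rfl

/-- The inclusion of the polynomials in the first variable. -/
abbrev inl : ℂ[X] →ₐ[ℂ] Poly₂ := Algebra.TensorProduct.includeLeft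

/-- The inclusion of the polynomials in the second variable. -/
abbrev inr : ℂ[X] →ₐ[ℂ] Poly₂ := Algebra.TensorProduct.includeRight

theorem lmapHom_shift_pow {R : Type*} [CommRing R] [Algebra ℂ R] (φ : ℂ[X] →ₐ[ℂ] R) (c : ℂ)
    (n : ℕ) : lmapHom φ (shift c ^ n)
      = (HahnSeries.C (φ X) + HahnSeries.single (-1) (algebraMap ℂ R c)) ^ n := by
  rw [map_pow, shift, map_add, HahnSeries.C_apply, lmapHom_single, lmapHom_single,
    HahnSeries.C_apply]
  rw [← Polynomial.algebraMap_eq, φ.commutes]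

theorem shift_pow (c : ℂ) (n : ℕ) : shift c ^ n = ∑ m ∈ Finset.range (n + 1),
    HahnSeries.single (-((n : ℤ) - m)) (((n.choose m : ℂ) * c ^ (n - m)) • (X ^ m : ℂ[X])) := by
  rw [shift, add_pow]
  refine Finset.sum_congr rfl fun m hm => ?_
  have hm' : m ≤ n := by simpa [Nat.lt_succ_iff] using hm
  rw [← map_pow, HahnSeries.single_pow, HahnSeries.C_apply, HahnSeries.single_mul_single,
    ← HahnSeries.single_zero_natCast, HahnSeries.single_mul_single, ← Polynomial.C_pow, zero_add,
    add_zero]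
  congr 1
  · simp [Nat.cast_sub hm']
  · rw [smul_eq_C_mul, Polynomial.C_mul]
    simp
    ring

theorem lmap_kmap_shift_pow (c : ℂ) (n : ℕ) : lmap kmap (shift c ^ n)
    = kpoly n (lmapHom inl (shift c)) (lmapHom inr (shift c)) := by
  have h1 := lmapHom_shift_pow inl c 1
  have h2 := lmapHom_shift_pow inr c 1
  rw [pow_one, pow_one] at h1 h2
  rw [shift_pow, map_sum, h1, h2, kpoly_add]
  refine Finset.sum_congr rfl fun m hm => ?_
  have hm' : m ≤ n := by simpa [Nat.lt_succ_iff] using hm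
  rw [lmap_single, map_smul, kmap_X_pow, ← map_kpoly, HahnSeries.single_pow, HahnSeries.C_apply,
    ← HahnSeries.single_zero_natCast, HahnSeries.single_mul_single, HahnSeries.single_mul_single,
    ← map_pow, zero_add, add_zero]
  congr 1
  · simp [Nat.cast_sub hm']
  · refine (Algebra.smul_def (A := Poly₂) _ _).trans ?_
    rw [map_mul, map_natCast]
    rfl

theorem natCast_succ_mul {R : Type*} [Ring R] [Algebra ℂ R] (k : ℕ) (z : LaurentSeries R) :
    ((k : LaurentSeries R) + 1) * z = ((k : ℂ) + 1) • z := by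
  rw [add_mul, one_mul, ← nsmul_eq_mul, add_smul, one_smul, Nat.cast_smul_eq_nsmul]

/-- The quadratic part of `ad t_{3,0}` is compatible with translations, by `kpoly_add`. -/
theorem lmap_curQuad_shift_pow (c : ℂ) (d : ℕ) :
    lmap (ι.toLinearMap ∘ₗ curQuad ε₁ ε₂) (shift c ^ d)
      = quadZero (fun n => lcur ε₁ ε₂ ι 0 (shift c ^ n)) d := by
  have h : lmap (ι.toLinearMap ∘ₗ curQuad ε₁ ε₂) (shift c ^ d)
      = lmap (ι.toLinearMap ∘ₗ curMul ε₁ ε₂) (lmap kmap (shift c ^ d)) := by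
    rw [← lmap_comp]
    refine lmap_congr (fun φ => ?_) _
    simp [curMul_kmap]
  rw [h, lmap_kmap_shift_pow, kpoly, quadZero, map_sum]
  refine Finset.sum_congr rfl fun m _ => ?_
  rw [mul_assoc, natCast_succ_mul, natCast_succ_mul, map_smul, map_smul, ← smul_smul,
    ← map_pow, ← map_pow]
  congr 2
  symm
  exact lmap_mul_lmap (i := inl.toLinearMap) (j := inr.toLinearMap) (fun φ ψ => by
    simp [curMul_tmul]) _ _

end side

end M2Brane

namespace M2Brane

open Polynomial LaurentSeries

variable (ε₁ ε₂ : ℂ)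

/-! ### Currents in two variables -/

/-- The inclusion of the first tensor factor. -/
abbrev inA : M2Algebra ε₁ ε₂ →ₐ[ℂ] M2Algebra ε₁ ε₂ ⊗[ℂ] M2Algebra ε₁ ε₂ :=
  Algebra.TensorProduct.includeLeft

/-- The inclusion of the second tensor factor. -/
abbrev inB : M2Algebra ε₁ ε₂ →ₐ[ℂ] M2Algebra ε₁ ε₂ ⊗[ℂ] M2Algebra ε₁ ε₂ :=
  Algebra.TensorProduct.includeRight

/-- The ring `(𝒜 ⊗ 𝒜)((w⁻¹))`. -/
abbrev Target : Type := LaurentSeries (M2Algebra ε₁ ε₂ ⊗[ℂ] M2Algebra ε₁ ε₂)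

/-- The constant series `a ⊗ 1`. -/
abbrev constLeft (a : M2Algebra ε₁ ε₂) : Target ε₁ ε₂ := HahnSeries.C (inA ε₁ ε₂ a)

/-- The constant series `1 ⊗ a`. -/
abbrev constRight (a : M2Algebra ε₁ ε₂) : Target ε₁ ε₂ := HahnSeries.C (inB ε₁ ε₂ a)

/-- The linear map `x ^ n y ^ m ↦ t_{a,n} ⊗ t_{b,m}`. -/
def rho (a b : ℕ) : Poly₂ →ₗ[ℂ] M2Algebra ε₁ ε₂ ⊗[ℂ] M2Algebra ε₁ ε₂ :=
  TensorProduct.map (cur ε₁ ε₂ a) (cur ε₁ ε₂ b)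

theorem rho_tmul (a b : ℕ) (φ ψ : ℂ[X]) :
    rho ε₁ ε₂ a b (φ ⊗ₜ ψ) = cur ε₁ ε₂ a φ ⊗ₜ cur ε₁ ε₂ b ψ := rfl

/-- The map `rho`, applied to the coefficients of Laurent series. -/
def lrho (a b : ℕ) : LaurentSeries Poly₂ →ₗ[ℂ] Target ε₁ ε₂ :=
  lmap (rho ε₁ ε₂ a b)

/-- The partial derivative in the first variable. -/
abbrev dx : Derivation ℂ Poly₂ Poly₂ := derLeft ℂ[X] ℂ[X] Polynomial.derivative'

/-- The partial derivative in the second variable. -/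
abbrev dy : Derivation ℂ Poly₂ Poly₂ := derRight ℂ[X] ℂ[X] Polynomial.derivative'

section lie
variable {R R' : Type*} [Ring R] [Algebra ℂ R] [Ring R'] [Algebra ℂ R']

theorem left_lie_tmul (a b : R) (c : R') : ⁅a ⊗ₜ[ℂ] (1 : R'), b ⊗ₜ[ℂ] c⁆ = ⁅a, b⁆ ⊗ₜ[ℂ] c := by
  simp [Ring.lie_def, TensorProduct.sub_tmul]

theorem right_lie_tmul (a b : R') (c : R) : ⁅(1 : R) ⊗ₜ[ℂ] a, c ⊗ₜ[ℂ] b⁆ = c ⊗ₜ[ℂ] ⁅a, b⁆ := by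
  simp [Ring.lie_def, TensorProduct.tmul_sub]

end lie

theorem t20_left_lie_lrho (a b : ℕ) (G : LaurentSeries Poly₂) :
    ⁅constLeft ε₁ ε₂ (t ε₁ ε₂ 2 0), lrho ε₁ ε₂ a b G⁆
      = (2 : ℂ) • lrho ε₁ ε₂ (a + 1) b (lder dx G) := by
  rw [lrho, constLeft,
    C_lie_lmap (γ := (2 : ℂ) • (rho ε₁ ε₂ (a + 1) b ∘ₗ (dx : Poly₂ →ₗ[ℂ] Poly₂)))]
  · rw [lmap_smul_map]; rfl
  · intro g
    induction g using TensorProduct.induction_on with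
    | zero => simp
    | add g g' hg hg' => simp only [map_add, lie_add, hg, hg']
    | tmul φ ψ =>
      rw [rho_tmul, Algebra.TensorProduct.includeLeft_apply, left_lie_tmul, lie_t20_cur]
      rfl

theorem t20_right_lie_lrho (a b : ℕ) (G : LaurentSeries Poly₂) :
    ⁅constRight ε₁ ε₂ (t ε₁ ε₂ 2 0), lrho ε₁ ε₂ a b G⁆
      = (2 : ℂ) • lrho ε₁ ε₂ a (b + 1) (lder dy G) := by
  rw [lrho, constRight,
    C_lie_lmap (γ := (2 : ℂ) • (rho ε₁ ε₂ a (b + 1) ∘ₗ (dy : Poly₂ →ₗ[ℂ] Poly₂)))]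
  · rw [lmap_smul_map]; rfl
  · intro g
    induction g using TensorProduct.induction_on with
    | zero => simp
    | add g g' hg hg' => simp only [map_add, lie_add, hg, hg']
    | tmul φ ψ =>
      rw [rho_tmul, Algebra.TensorProduct.includeRight_apply, right_lie_tmul, lie_t20_cur,
        TensorProduct.tmul_smul]
      rfl

theorem lcur_left_lie_lrho (F : LaurentSeries ℂ[X]) (G : LaurentSeries Poly₂) :
    ⁅lcur ε₁ ε₂ (inA ε₁ ε₂) 0 F, lrho ε₁ ε₂ 0 0 G⁆ = 0 := by
  refine lmap_lie_lmap_eq_zero (fun φ g => ?_) F G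
  induction g using TensorProduct.induction_on with
  | zero => simp
  | add g g' hg hg' => simp only [map_add, lie_add, hg, hg', add_zero]
  | tmul φ' ψ =>
    simp only [LinearMap.comp_apply, AlgHom.toLinearMap_apply,
      Algebra.TensorProduct.includeLeft_apply, rho_tmul, left_lie_tmul, cur_lie_cur,
      TensorProduct.zero_tmul]

theorem lcur_right_lie_lrho (F : LaurentSeries ℂ[X]) (G : LaurentSeries Poly₂) :
    ⁅lcur ε₁ ε₂ (inB ε₁ ε₂) 0 F, lrho ε₁ ε₂ 0 0 G⁆ = 0 := by
  refine lmap_lie_lmap_eq_zero (fun φ g => ?_) F G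
  induction g using TensorProduct.induction_on with
  | zero => simp
  | add g g' hg hg' => simp only [map_add, lie_add, hg, hg', add_zero]
  | tmul φ' ψ =>
    simp only [LinearMap.comp_apply, AlgHom.toLinearMap_apply,
      Algebra.TensorProduct.includeRight_apply, rho_tmul, right_lie_tmul, cur_lie_cur,
      TensorProduct.tmul_zero]

theorem lcur_one_left_lie_lrho (F : LaurentSeries ℂ[X]) (G : LaurentSeries Poly₂) :
    ⁅lcur ε₁ ε₂ (inA ε₁ ε₂) 1 F, lrho ε₁ ε₂ 0 0 G⁆
      = lrho ε₁ ε₂ 0 0 (lmapHom inl F * lder dx G) := by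
  refine lmap_lie_lmap (i := inl.toLinearMap) (j := (dx : Poly₂ →ₗ[ℂ] Poly₂)) (fun φ g => ?_) F G
  induction g using TensorProduct.induction_on with
  | zero => simp
  | add g g' hg hg' => simp only [map_add, lie_add, hg, hg', mul_add]
  | tmul φ' ψ =>
    simp only [LinearMap.comp_apply, AlgHom.toLinearMap_apply, Derivation.coeFn_coe, derLeft_tmul,
      Algebra.TensorProduct.includeLeft_apply, rho_tmul, left_lie_tmul, cur_one_lie_cur,
      Algebra.TensorProduct.tmul_mul_tmul, one_mul]
    rfl

theorem lcur_one_right_lie_lrho (F : LaurentSeries ℂ[X]) (G : LaurentSeries Poly₂) :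
    ⁅lcur ε₁ ε₂ (inB ε₁ ε₂) 1 F, lrho ε₁ ε₂ 0 0 G⁆
      = lrho ε₁ ε₂ 0 0 (lmapHom inr F * lder dy G) := by
  refine lmap_lie_lmap (i := inr.toLinearMap) (j := (dy : Poly₂ →ₗ[ℂ] Poly₂)) (fun φ g => ?_) F G
  induction g using TensorProduct.induction_on with
  | zero => simp
  | add g g' hg hg' => simp only [map_add, lie_add, hg, hg', mul_add]
  | tmul φ' ψ =>
    simp only [LinearMap.comp_apply, AlgHom.toLinearMap_apply, Derivation.coeFn_coe, derRight_tmul,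
      Algebra.TensorProduct.includeRight_apply, rho_tmul, right_lie_tmul, cur_one_lie_cur,
      Algebra.TensorProduct.tmul_mul_tmul, one_mul]
    rfl

theorem lrho_one_zero_lie_lcur_left (G : LaurentSeries Poly₂) (F : LaurentSeries ℂ[X]) :
    ⁅lrho ε₁ ε₂ 1 0 G, lcur ε₁ ε₂ (inA ε₁ ε₂) 0 F⁆
      = lrho ε₁ ε₂ 0 0 (G * lmapHom inl (lder Polynomial.derivative' F)) := by
  refine lmap_lie_lmap (i := LinearMap.id)
    (j := inl.toLinearMap ∘ₗ (Polynomial.derivative : ℂ[X] →ₗ[ℂ] ℂ[X])) (fun g φ => ?_) G F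
  induction g using TensorProduct.induction_on with
  | zero => simp
  | add g g' hg hg' => simp only [map_add, add_lie, hg, hg', add_mul]
  | tmul φ' ψ =>
    simp only [LinearMap.comp_apply, AlgHom.toLinearMap_apply, LinearMap.id_apply,
      Algebra.TensorProduct.includeLeft_apply, rho_tmul, Algebra.TensorProduct.tmul_mul_tmul,
      mul_one]
    rw [← lie_skew, left_lie_tmul, ← TensorProduct.neg_tmul, lie_skew, cur_one_lie_cur]

theorem lrho_zero_one_lie_lcur_right (G : LaurentSeries Poly₂) (F : LaurentSeries ℂ[X]) :
    ⁅lrho ε₁ ε₂ 0 1 G, lcur ε₁ ε₂ (inB ε₁ ε₂) 0 F⁆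
      = lrho ε₁ ε₂ 0 0 (G * lmapHom inr (lder Polynomial.derivative' F)) := by
  refine lmap_lie_lmap (i := LinearMap.id)
    (j := inr.toLinearMap ∘ₗ (Polynomial.derivative : ℂ[X] →ₗ[ℂ] ℂ[X])) (fun g φ => ?_) G F
  induction g using TensorProduct.induction_on with
  | zero => simp
  | add g g' hg hg' => simp only [map_add, add_lie, hg, hg', add_mul]
  | tmul φ' ψ =>
    simp only [LinearMap.comp_apply, AlgHom.toLinearMap_apply, LinearMap.id_apply,
      Algebra.TensorProduct.includeRight_apply, rho_tmul, Algebra.TensorProduct.tmul_mul_tmul,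
      mul_one]
    rw [← lie_skew, right_lie_tmul, ← TensorProduct.tmul_neg, lie_skew, cur_one_lie_cur]

theorem lrho_lie_lcur_left (b : ℕ) (G : LaurentSeries Poly₂) (F : LaurentSeries ℂ[X]) :
    ⁅lrho ε₁ ε₂ 0 b G, lcur ε₁ ε₂ (inA ε₁ ε₂) 0 F⁆ = 0 := by
  refine lmap_lie_lmap_eq_zero (fun g φ => ?_) G F
  induction g using TensorProduct.induction_on with
  | zero => simp
  | add g g' hg hg' => simp only [map_add, add_lie, hg, hg', add_zero]
  | tmul φ' ψ =>
    simp only [LinearMap.comp_apply, AlgHom.toLinearMap_apply,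
      Algebra.TensorProduct.includeLeft_apply, rho_tmul]
    rw [← lie_skew, left_lie_tmul, cur_lie_cur, TensorProduct.zero_tmul, neg_zero]

theorem lrho_lie_lcur_right (a : ℕ) (G : LaurentSeries Poly₂) (F : LaurentSeries ℂ[X]) :
    ⁅lrho ε₁ ε₂ a 0 G, lcur ε₁ ε₂ (inB ε₁ ε₂) 0 F⁆ = 0 := by
  refine lmap_lie_lmap_eq_zero (fun g φ => ?_) G F
  induction g using TensorProduct.induction_on with
  | zero => simp
  | add g g' hg hg' => simp only [map_add, add_lie, hg, hg', add_zero]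
  | tmul φ' ψ =>
    simp only [LinearMap.comp_apply, AlgHom.toLinearMap_apply,
      Algebra.TensorProduct.includeRight_apply, rho_tmul]
    rw [← lie_skew, right_lie_tmul, cur_lie_cur, TensorProduct.tmul_zero, neg_zero]

theorem lcur_left_lie_lcur_right (a b : ℕ) (F G : LaurentSeries ℂ[X]) :
    ⁅lcur ε₁ ε₂ (inA ε₁ ε₂) a F, lcur ε₁ ε₂ (inB ε₁ ε₂) b G⁆ = 0 :=
  lmap_lie_lmap_eq_zero (fun φ ψ => by simp [Ring.lie_def]) F G

theorem lcur_left_mul_lcur_right (F G : LaurentSeries ℂ[X]) :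
    lcur ε₁ ε₂ (inA ε₁ ε₂) 0 F * lcur ε₁ ε₂ (inB ε₁ ε₂) 0 G
      = lrho ε₁ ε₂ 0 0 (lmapHom inl F * lmapHom inr G) :=
  lmap_mul_lmap (i := inl.toLinearMap) (j := inr.toLinearMap)
    (fun φ ψ => by simp [rho_tmul]) F G

/-- The series `lcur 2 (shift 1)` is `t_{2,1} + w t_{2,0}` in the first factor. -/
theorem t21_left_lie_lrho (G : LaurentSeries Poly₂) :
    ⁅lcur ε₁ ε₂ (inA ε₁ ε₂) 2 (shift 1), lrho ε₁ ε₂ 0 0 G⁆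
      = (2 : ℂ) • lrho ε₁ ε₂ 1 0 (lmapHom inl (shift 1) * lder dx G) := by
  have h1 : ⁅(HahnSeries.single 0 (inA ε₁ ε₂ (t ε₁ ε₂ 2 1)) :
      Target ε₁ ε₂), lrho ε₁ ε₂ 0 0 G⁆
      = lmap ((2 : ℂ) • (rho ε₁ ε₂ 1 0 ∘ₗ LinearMap.mulLeft ℂ (inl X)
          ∘ₗ (dx : Poly₂ →ₗ[ℂ] Poly₂))) (HahnSeries.single 0 1 * G) := by
    refine single_lie_lmap (fun g => ?_) 0 G
    induction g using TensorProduct.induction_on with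
    | zero => simp
    | add g g' hg hg' => simp only [map_add, lie_add, hg, hg']
    | tmul φ ψ =>
      rw [rho_tmul, Algebra.TensorProduct.includeLeft_apply, left_lie_tmul, lie_t21_cur]
      simp only [LinearMap.smul_apply, LinearMap.comp_apply, Derivation.coeFn_coe, derLeft_tmul,
        LinearMap.mulLeft_apply, Algebra.TensorProduct.includeLeft_apply,
        Algebra.TensorProduct.tmul_mul_tmul, one_mul, rho_tmul]
      rfl
  have h2 : ⁅(HahnSeries.single (-1) (inA ε₁ ε₂ (t ε₁ ε₂ 2 0)) :
      Target ε₁ ε₂), lrho ε₁ ε₂ 0 0 G⁆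
      = lmap ((2 : ℂ) • (rho ε₁ ε₂ 1 0 ∘ₗ (dx : Poly₂ →ₗ[ℂ] Poly₂)))
          (HahnSeries.single (-1) 1 * G) := by
    refine single_lie_lmap (fun g => ?_) (-1) G
    induction g using TensorProduct.induction_on with
    | zero => simp
    | add g g' hg hg' => simp only [map_add, lie_add, hg, hg']
    | tmul φ ψ =>
      rw [rho_tmul, Algebra.TensorProduct.includeLeft_apply, left_lie_tmul, lie_t20_cur]
      rfl
  have h3 : lcur ε₁ ε₂ (inA ε₁ ε₂) 2 (shift 1)
      = HahnSeries.single 0 (inA ε₁ ε₂ (t ε₁ ε₂ 2 1))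
        + HahnSeries.single (-1) (inA ε₁ ε₂ (t ε₁ ε₂ 2 0)) := by
    rw [shift, map_add, HahnSeries.C_apply, lcur, lmap_single, lmap_single, map_one,
      LinearMap.comp_apply, LinearMap.comp_apply, cur_X, cur_one]
    rfl
  have h4 : lmapHom inl (shift 1) = HahnSeries.single 0 (inl X) + HahnSeries.single (-1) 1 := by
    rw [shift, map_add, HahnSeries.C_apply, lmapHom_single, lmapHom_single, map_one, map_one]
  rw [h3, add_lie, h1, h2, h4, lmap_smul_map, lmap_smul_map, lrho, add_mul, map_add]
  refine (smul_add (2 : ℂ) _ _).symm.trans ?_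
  congr 2
  · ext n
    simp only [lmap_coeff, HahnSeries.coeff_single_mul, one_mul, LinearMap.comp_apply,
      Derivation.coeFn_coe, LinearMap.mulLeft_apply, lder_coeff]
  · ext n
    simp only [lmap_coeff, HahnSeries.coeff_single_mul, one_mul, LinearMap.comp_apply,
      Derivation.coeFn_coe, lder_coeff]

theorem t21_right_lie_lrho (G : LaurentSeries Poly₂) :
    ⁅lcur ε₁ ε₂ (inB ε₁ ε₂) 2 (shift 0), lrho ε₁ ε₂ 0 0 G⁆
      = (2 : ℂ) • lrho ε₁ ε₂ 0 1 (lmapHom inr (shift 0) * lder dy G) := by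
  have h1 : ⁅(HahnSeries.single 0 (inB ε₁ ε₂ (t ε₁ ε₂ 2 1)) :
      Target ε₁ ε₂), lrho ε₁ ε₂ 0 0 G⁆
      = lmap ((2 : ℂ) • (rho ε₁ ε₂ 0 1 ∘ₗ LinearMap.mulLeft ℂ (inr X)
          ∘ₗ (dy : Poly₂ →ₗ[ℂ] Poly₂))) (HahnSeries.single 0 1 * G) := by
    refine single_lie_lmap (fun g => ?_) 0 G
    induction g using TensorProduct.induction_on with
    | zero => simp
    | add g g' hg hg' => simp only [map_add, lie_add, hg, hg']
    | tmul φ ψ =>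
      rw [rho_tmul, Algebra.TensorProduct.includeRight_apply, right_lie_tmul, lie_t21_cur,
        TensorProduct.tmul_smul]
      simp only [LinearMap.smul_apply, LinearMap.comp_apply, Derivation.coeFn_coe, derRight_tmul,
        LinearMap.mulLeft_apply, Algebra.TensorProduct.includeRight_apply,
        Algebra.TensorProduct.tmul_mul_tmul, one_mul, rho_tmul]
      rfl
  have h3 : lcur ε₁ ε₂ (inB ε₁ ε₂) 2 (shift 0)
      = HahnSeries.single 0 (inB ε₁ ε₂ (t ε₁ ε₂ 2 1)) := by
    rw [shift_zero, HahnSeries.C_apply, lcur, lmap_single, LinearMap.comp_apply, cur_X]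
    rfl
  rw [h3, h1, lmap_smul_map, lrho, shift_zero, HahnSeries.C_apply, lmapHom_single]
  congr 1
  ext n
  simp only [lmap_coeff, HahnSeries.coeff_single_mul, one_mul, LinearMap.comp_apply,
    Derivation.coeFn_coe, LinearMap.mulLeft_apply, lder_coeff]

/-- The linear map `x ^ n y ^ m ↦ t_{0,n} ⊗ q_m`, where `q_m` is the quadratic part of
`[t_{3,0}, t_{0,m}]`. -/
def rhoQuadRight : Poly₂ →ₗ[ℂ] M2Algebra ε₁ ε₂ ⊗[ℂ] M2Algebra ε₁ ε₂ :=
  TensorProduct.map (cur ε₁ ε₂ 0) (curQuad ε₁ ε₂)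

/-- The linear map `x ^ n y ^ m ↦ q_n ⊗ t_{0,m}`, with `q_n` as in `rhoQuadRight`. -/
def rhoQuadLeft : Poly₂ →ₗ[ℂ] M2Algebra ε₁ ε₂ ⊗[ℂ] M2Algebra ε₁ ε₂ :=
  TensorProduct.map (curQuad ε₁ ε₂) (cur ε₁ ε₂ 0)

theorem t30_left_lie_lrho (G : LaurentSeries Poly₂) :
    ⁅constLeft ε₁ ε₂ (t ε₁ ε₂ 3 0), lrho ε₁ ε₂ 0 0 G⁆
      = (3 : ℂ) • lrho ε₁ ε₂ 2 0 (lder dx G)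
        + (σ₂ ε₁ ε₂ / 4) • lrho ε₁ ε₂ 0 0 (lder dx (lder dx (lder dx G)))
        + (3 / 2 * σ₃ ε₁ ε₂) • lmap (rhoQuadLeft ε₁ ε₂) G := by
  rw [lrho, constLeft, C_lie_lmap (γ := (3 : ℂ) • (rho ε₁ ε₂ 2 0 ∘ₗ (dx : Poly₂ →ₗ[ℂ] Poly₂))
    + (σ₂ ε₁ ε₂ / 4) • (rho ε₁ ε₂ 0 0 ∘ₗ (dx : Poly₂ →ₗ[ℂ] Poly₂) ∘ₗ (dx : Poly₂ →ₗ[ℂ] Poly₂)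
      ∘ₗ (dx : Poly₂ →ₗ[ℂ] Poly₂))
    + (3 / 2 * σ₃ ε₁ ε₂) • rhoQuadLeft ε₁ ε₂)]
  · rw [lmap_add_map, lmap_add_map, lmap_smul_map, lmap_smul_map, lmap_smul_map]; rfl
  · intro g
    induction g using TensorProduct.induction_on with
    | zero => simp
    | add g g' hg hg' => simp only [map_add, lie_add, hg, hg']
    | tmul φ ψ =>
      rw [rho_tmul, Algebra.TensorProduct.includeLeft_apply, left_lie_tmul, lie_t30_cur,
        TensorProduct.add_tmul, TensorProduct.add_tmul]
      rfl

theorem t30_right_lie_lrho (G : LaurentSeries Poly₂) :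
    ⁅constRight ε₁ ε₂ (t ε₁ ε₂ 3 0), lrho ε₁ ε₂ 0 0 G⁆
      = (3 : ℂ) • lrho ε₁ ε₂ 0 2 (lder dy G)
        + (σ₂ ε₁ ε₂ / 4) • lrho ε₁ ε₂ 0 0 (lder dy (lder dy (lder dy G)))
        + (3 / 2 * σ₃ ε₁ ε₂) • lmap (rhoQuadRight ε₁ ε₂) G := by
  rw [lrho, constRight, C_lie_lmap (γ := (3 : ℂ) • (rho ε₁ ε₂ 0 2 ∘ₗ (dy : Poly₂ →ₗ[ℂ] Poly₂))
    + (σ₂ ε₁ ε₂ / 4) • (rho ε₁ ε₂ 0 0 ∘ₗ (dy : Poly₂ →ₗ[ℂ] Poly₂) ∘ₗ (dy : Poly₂ →ₗ[ℂ] Poly₂)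
      ∘ₗ (dy : Poly₂ →ₗ[ℂ] Poly₂))
    + (3 / 2 * σ₃ ε₁ ε₂) • rhoQuadRight ε₁ ε₂)]
  · rw [lmap_add_map, lmap_add_map, lmap_smul_map, lmap_smul_map, lmap_smul_map]; rfl
  · intro g
    induction g using TensorProduct.induction_on with
    | zero => simp
    | add g g' hg hg' => simp only [map_add, lie_add, hg, hg']
    | tmul φ ψ =>
      rw [rho_tmul, Algebra.TensorProduct.includeRight_apply, right_lie_tmul, lie_t30_cur,
        TensorProduct.tmul_add, TensorProduct.tmul_add, TensorProduct.tmul_smul,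
        TensorProduct.tmul_smul, TensorProduct.tmul_smul]
      rfl

end M2Brane

/-! ### Two interacting systems of currents -/

namespace M2Brane

/-- Two commuting systems of currents `x a`, `y a` in an algebra `B`, with arguments in a
commutative ring `V`, the products `ρ a b` of the currents `x a` and `y b`, with arguments in a
commutative ring `U`, and the interaction `f = (X - Y) ^ (-2)`. The two systems are evaluated at
powers of the coordinates `X` and `Y`. Only the brackets needed to verify the relations of `𝒜` are
recorded. The identities `ρ10_ρ` and `ρ01_ρ` are the ones which involve three currents. -/
structure CrossData (ε₁ ε₂ : ℂ) (B V U : Type*) [Ring B] [Algebra ℂ B] [CommRing V] [Algebra ℂ V]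
    [CommRing U] [Algebra ℂ U] where
  /-- The currents of the first system. -/
  x : ℕ → V →ₗ[ℂ] B
  /-- The currents of the second system. -/
  y : ℕ → V →ₗ[ℂ] B
  /-- The products of a current of the first system and one of the second system. -/
  ρ : ℕ → ℕ → U →ₗ[ℂ] B
  /-- The derivative in one variable. -/
  d : Derivation ℂ V V
  /-- The partial derivative in the first variable. -/
  dx : Derivation ℂ U U
  /-- The partial derivative in the second variable. -/
  dy : Derivation ℂ U U
  /-- The inclusion of the functions of the first variable. -/
  il : V →ₐ[ℂ] U
  /-- The inclusion of the functions of the second variable. -/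
  ir : V →ₐ[ℂ] U
  /-- The coordinate of the first system. -/
  X : V
  /-- The coordinate of the second system. -/
  Y : V
  /-- The interaction. -/
  f : U
  /-- The quadratic part of `[x 3 1, ρ 0 0 f]`. -/
  QL : B
  /-- The quadratic part of `[y 3 1, ρ 0 0 f]`. -/
  QR : B
  d_X : d X = 1
  d_Y : d Y = 1
  dx_X : dx (il X) = 1
  dx_Y : dx (ir Y) = 0
  dy_X : dy (il X) = 0
  dy_Y : dy (ir Y) = 1
  dx_dy : ∀ G, dx (dy G) = dy (dx G)
  f_q : f * (il X - ir Y) ^ 2 = 1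
  Dx_x : ∀ a F, ⁅x 2 1, x a F⁆ = (2 : ℂ) • x (a + 1) (d F)
  Dy_y : ∀ a F, ⁅y 2 1, y a F⁆ = (2 : ℂ) • y (a + 1) (d F)
  x_y : ∀ a b F G, ⁅x a F, y b G⁆ = 0
  x_x : ∀ F G, ⁅x 0 F, x 0 G⁆ = 0
  y_y : ∀ F G, ⁅y 0 F, y 0 G⁆ = 0
  x1_x : ∀ F G, ⁅x 1 F, x 0 G⁆ = x 0 (F * d G)
  y1_y : ∀ F G, ⁅y 1 F, y 0 G⁆ = y 0 (F * d G)
  ex_x : ∀ n, ⁅x 3 1, x 0 (X ^ n)⁆ = (3 : ℂ) • x 2 (d (X ^ n))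
    + (σ₂ ε₁ ε₂ / 4) • x 0 (d (d (d (X ^ n))))
    + (3 / 2 * σ₃ ε₁ ε₂) • quadZero (fun n => x 0 (X ^ n)) n
  ey_y : ∀ n, ⁅y 3 1, y 0 (Y ^ n)⁆ = (3 : ℂ) • y 2 (d (Y ^ n))
    + (σ₂ ε₁ ε₂ / 4) • y 0 (d (d (d (Y ^ n))))
    + (3 / 2 * σ₃ ε₁ ε₂) • quadZero (fun n => y 0 (Y ^ n)) n
  Dx_ρ : ∀ a b G, ⁅x 2 1, ρ a b G⁆ = (2 : ℂ) • ρ (a + 1) b (dx G)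
  Dy_ρ : ∀ a b G, ⁅y 2 1, ρ a b G⁆ = (2 : ℂ) • ρ a (b + 1) (dy G)
  x_ρ : ∀ F G, ⁅x 0 F, ρ 0 0 G⁆ = 0
  y_ρ : ∀ F G, ⁅y 0 F, ρ 0 0 G⁆ = 0
  x1_ρ : ∀ F G, ⁅x 1 F, ρ 0 0 G⁆ = ρ 0 0 (il F * dx G)
  y1_ρ : ∀ F G, ⁅y 1 F, ρ 0 0 G⁆ = ρ 0 0 (ir F * dy G)
  x2_ρ : ∀ G, ⁅x 2 X, ρ 0 0 G⁆ = (2 : ℂ) • ρ 1 0 (il X * dx G)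
  y2_ρ : ∀ G, ⁅y 2 Y, ρ 0 0 G⁆ = (2 : ℂ) • ρ 0 1 (ir Y * dy G)
  ex_ρ : ⁅x 3 1, ρ 0 0 f⁆ = (3 : ℂ) • ρ 2 0 (dx f)
    + (σ₂ ε₁ ε₂ / 4) • ρ 0 0 (dx (dx (dx f))) + (3 / 2 * σ₃ ε₁ ε₂) • QL
  ey_ρ : ⁅y 3 1, ρ 0 0 f⁆ = (3 : ℂ) • ρ 0 2 (dy f)
    + (σ₂ ε₁ ε₂ / 4) • ρ 0 0 (dy (dy (dy f))) + (3 / 2 * σ₃ ε₁ ε₂) • QR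
  ρ_ρ : ∀ G H, ⁅ρ 0 0 G, ρ 0 0 H⁆ = 0
  ρ10_x : ∀ G F, ⁅ρ 1 0 G, x 0 F⁆ = ρ 0 0 (G * il (d F))
  ρ01_y : ∀ G F, ⁅ρ 0 1 G, y 0 F⁆ = ρ 0 0 (G * ir (d F))
  ρ01_x : ∀ G F, ⁅ρ 0 1 G, x 0 F⁆ = 0
  ρ10_y : ∀ G F, ⁅ρ 1 0 G, y 0 F⁆ = 0
  x_mul_y : ∀ F G, x 0 F * y 0 G = ρ 0 0 (il F * ir G)
  ρ10_ρ : (2 : ℂ) • ⁅ρ 1 0 f, ρ 0 0 f⁆ = -QR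
  ρ01_ρ : (2 : ℂ) • ⁅ρ 0 1 f, ρ 0 0 f⁆ = -QL

namespace CrossData

variable {ε₁ ε₂ : ℂ} {B V U : Type*} [Ring B] [Algebra ℂ B] [CommRing V] [Algebra ℂ V]
    [CommRing U] [Algebra ℂ U] (Γ : CrossData ε₁ ε₂ B V U)

/-- The element `X - Y` is invertible. -/
theorem cancel {a b : U} (h : a * (Γ.il Γ.X - Γ.ir Γ.Y) = b * (Γ.il Γ.X - Γ.ir Γ.Y)) : a = b := by
  linear_combination (Γ.f * (Γ.il Γ.X - Γ.ir Γ.Y)) * h - (a - b) * Γ.f_q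

theorem dx_f : Γ.dx Γ.f * (Γ.il Γ.X - Γ.ir Γ.Y) = -2 * Γ.f := by
  have h := congrArg Γ.dx Γ.f_q
  rw [Derivation.leibniz, Derivation.leibniz_pow, map_sub, dx_X, dx_Y,
    Derivation.map_one_eq_zero] at h
  simp only [smul_eq_mul, nsmul_eq_mul] at h
  push_cast at h
  norm_num at h
  refine Γ.cancel ?_
  linear_combination h

theorem dy_f : Γ.dy Γ.f * (Γ.il Γ.X - Γ.ir Γ.Y) = 2 * Γ.f := by
  have h := congrArg Γ.dy Γ.f_q
  rw [Derivation.leibniz, Derivation.leibniz_pow, map_sub, dy_X, dy_Y,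
    Derivation.map_one_eq_zero] at h
  simp only [smul_eq_mul, nsmul_eq_mul] at h
  push_cast at h
  norm_num at h
  refine Γ.cancel ?_
  linear_combination h

theorem dy_f_eq : Γ.dy Γ.f = -Γ.dx Γ.f := by
  refine Γ.cancel ?_
  linear_combination Γ.dy_f + Γ.dx_f

theorem dy_three_f : Γ.dy (Γ.dy (Γ.dy Γ.f)) = -Γ.dx (Γ.dx (Γ.dx Γ.f)) := by
  rw [dy_f_eq, map_neg, map_neg, ← dx_dy, ← dx_dy, dy_f_eq, map_neg, map_neg, ← dx_dy, dy_f_eq]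
  simp

/-- `X ^ n ∂ₓ f + Y ^ n ∂ᵧ f`, the effect on `f` of the vector field `z ^ n ∂_z` in both
variables. -/
def g (n : ℕ) : U := Γ.il Γ.X ^ n * Γ.dx Γ.f + Γ.ir Γ.Y ^ n * Γ.dy Γ.f

theorem g_zero : Γ.g 0 = 0 := by
  simp [g, dy_f_eq]

theorem g_one : Γ.g 1 = -2 * Γ.f := by
  refine Γ.cancel ?_
  rw [g]
  linear_combination Γ.il Γ.X * Γ.dx_f + Γ.ir Γ.Y * Γ.dy_f

theorem g_two : Γ.g 2 = -2 * ((Γ.il Γ.X + Γ.ir Γ.Y) * Γ.f) := by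
  refine Γ.cancel ?_
  rw [g]
  linear_combination Γ.il Γ.X ^ 2 * Γ.dx_f + Γ.ir Γ.Y ^ 2 * Γ.dy_f

theorem dx_g_two : Γ.dx (Γ.g 2) + 4 * (Γ.il Γ.X * Γ.dx Γ.f) = -6 * Γ.f := by
  have h : Γ.dx (Γ.g 2) = -2 * ((Γ.il Γ.X + Γ.ir Γ.Y) * Γ.dx Γ.f + Γ.f) := by
    rw [g_two, neg_mul, map_neg, two_mul, map_add, Derivation.leibniz, map_add, dx_X, dx_Y]
    simp only [smul_eq_mul]
    ring
  rw [h]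
  linear_combination 2 * Γ.dx_f

theorem dy_g_two : Γ.dy (Γ.g 2) + 4 * (Γ.ir Γ.Y * Γ.dy Γ.f) = -6 * Γ.f := by
  have h : Γ.dy (Γ.g 2) = -2 * ((Γ.il Γ.X + Γ.ir Γ.Y) * Γ.dy Γ.f + Γ.f) := by
    rw [g_two, neg_mul, map_neg, two_mul, map_add, Derivation.leibniz, map_add, dy_X, dy_Y]
    simp only [smul_eq_mul]
    ring
  rw [h]
  linear_combination (-2) * Γ.dy_f

/-- The identity which matches the quadratic part of `[t_{3,0}, t_{0,n}]` with the interaction: both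
sides are computed after multiplication by `(X - Y) ^ 3`. -/
theorem mul_f_eq (n : ℕ) : (n : U) * (Γ.il Γ.X ^ (n - 1) + Γ.ir Γ.Y ^ (n - 1)) * Γ.f
    = -Γ.g n + kpoly n (Γ.il Γ.X) (Γ.ir Γ.Y) := by
  refine Γ.cancel (Γ.cancel (Γ.cancel ?_))
  have h := cube_mul_kpoly n (Γ.il Γ.X) (Γ.ir Γ.Y)
  rw [g]
  linear_combination -h
    + (n * (Γ.il Γ.X ^ (n - 1) + Γ.ir Γ.Y ^ (n - 1)) * (Γ.il Γ.X - Γ.ir Γ.Y)) * Γ.f_q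
    + (Γ.il Γ.X ^ n * (Γ.il Γ.X - Γ.ir Γ.Y) ^ 2) * Γ.dx_f
    + (Γ.ir Γ.Y ^ n * (Γ.il Γ.X - Γ.ir Γ.Y) ^ 2) * Γ.dy_f
    - 2 * (Γ.il Γ.X ^ n - Γ.ir Γ.Y ^ n) * Γ.f_q

/-- The image of `t_{0,n}` under the coproduct. -/
def p (n : ℕ) : B := Γ.x 0 (Γ.X ^ n) + Γ.y 0 (Γ.Y ^ n)

/-- The image of `t_{1,n}` under the coproduct. -/
def q (n : ℕ) : B := Γ.x 1 (Γ.X ^ n) + Γ.y 1 (Γ.Y ^ n)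

/-- The image of `t_{2,n}` under the coproduct. -/
def r (n : ℕ) : B := Γ.x 2 (Γ.X ^ n) + Γ.y 2 (Γ.Y ^ n)
  - (σ₃ ε₁ ε₂ / (n + 1)) • Γ.ρ 0 0 (Γ.g (n + 1))

/-- The image of `t_{2,0}` under the coproduct. -/
def D : B := Γ.x 2 1 + Γ.y 2 1 + (2 * σ₃ ε₁ ε₂) • Γ.ρ 0 0 Γ.f

/-- The image of `t_{3,0}` under the coproduct. -/
def e : B := Γ.x 3 1 + Γ.y 3 1 + (3 * σ₃ ε₁ ε₂) • (Γ.ρ 1 0 Γ.f + Γ.ρ 0 1 Γ.f)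

theorem y_x (a b : ℕ) (F G : V) : ⁅Γ.y a F, Γ.x b G⁆ = 0 := by
  rw [← lie_skew, x_y, neg_zero]

theorem d_X_pow (n : ℕ) : Γ.d (Γ.X ^ n) = (n : ℂ) • Γ.X ^ (n - 1) := by
  rw [Derivation.leibniz_pow, d_X, smul_eq_mul, mul_one, Nat.cast_smul_eq_nsmul]

theorem d_Y_pow (n : ℕ) : Γ.d (Γ.Y ^ n) = (n : ℂ) • Γ.Y ^ (n - 1) := by
  rw [Derivation.leibniz_pow, d_Y, smul_eq_mul, mul_one, Nat.cast_smul_eq_nsmul]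

theorem p_p (m n : ℕ) : ⁅Γ.p m, Γ.p n⁆ = 0 := by
  simp only [p, add_lie, lie_add, x_x, y_y, x_y, y_x, add_zero]

theorem D_p (n : ℕ) : ⁅Γ.D, Γ.p n⁆ = (2 * n : ℂ) • Γ.q (n - 1) := by
  have h1 : ⁅Γ.ρ 0 0 Γ.f, Γ.x 0 (Γ.X ^ n)⁆ = 0 := by rw [← lie_skew, x_ρ, neg_zero]
  have h2 : ⁅Γ.ρ 0 0 Γ.f, Γ.y 0 (Γ.Y ^ n)⁆ = 0 := by rw [← lie_skew, y_ρ, neg_zero]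
  simp only [D, p, q, add_lie, lie_add, smul_lie, h1, h2, Dx_x, Dy_y, x_y, y_x, d_X_pow, d_Y_pow,
    map_smul, zero_add]
  module

theorem D_q (n : ℕ) : ⁅Γ.D, Γ.q n⁆ = (2 * n : ℂ) • Γ.r (n - 1) := by
  have h1 : ⁅Γ.ρ 0 0 Γ.f, Γ.x 1 (Γ.X ^ n)⁆ = -Γ.ρ 0 0 (Γ.il Γ.X ^ n * Γ.dx Γ.f) := by
    rw [← lie_skew, x1_ρ, map_pow]
  have h2 : ⁅Γ.ρ 0 0 Γ.f, Γ.y 1 (Γ.Y ^ n)⁆ = -Γ.ρ 0 0 (Γ.ir Γ.Y ^ n * Γ.dy Γ.f) := by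
    rw [← lie_skew, y1_ρ, map_pow]
  have h3 : ⁅Γ.D, Γ.q n⁆ = (2 * n : ℂ) • (Γ.x 2 (Γ.X ^ (n - 1)) + Γ.y 2 (Γ.Y ^ (n - 1)))
      - (2 * σ₃ ε₁ ε₂) • Γ.ρ 0 0 (Γ.g n) := by
    simp only [D, q, g, add_lie, lie_add, smul_lie, h1, h2, Dx_x, Dy_y, x_y, y_x, d_X_pow, d_Y_pow,
      map_smul, map_add, zero_add]
    module
  rw [h3]
  rcases n with _ | n
  · simp [g_zero]
  · have h4 : ((n : ℂ) + 1) ≠ 0 := Nat.cast_add_one_ne_zero n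
    rw [r, Nat.add_sub_cancel, smul_sub _ _ ((σ₃ ε₁ ε₂ / (n + 1)) • _), smul_smul]
    congr 2
    push_cast
    field_simp

theorem r_zero : Γ.r 0 = Γ.D := by
  rw [r, D, zero_add, g_one, pow_zero, pow_zero, neg_mul, map_neg, two_mul, map_add]
  push_cast
  module

theorem D_r_one : ⁅Γ.D, Γ.r 1⁆ = (2 : ℂ) • Γ.e := by
  have h1 : ⁅Γ.ρ 0 0 Γ.f, Γ.x 2 Γ.X⁆ = -((2 : ℂ) • Γ.ρ 1 0 (Γ.il Γ.X * Γ.dx Γ.f)) := by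
    rw [← lie_skew, x2_ρ]
  have h2 : ⁅Γ.ρ 0 0 Γ.f, Γ.y 2 Γ.Y⁆ = -((2 : ℂ) • Γ.ρ 0 1 (Γ.ir Γ.Y * Γ.dy Γ.f)) := by
    rw [← lie_skew, y2_ρ]
  have h3 : Γ.ρ 1 0 (Γ.dx (Γ.g 2))
      = -((4 : ℂ) • Γ.ρ 1 0 (Γ.il Γ.X * Γ.dx Γ.f)) - (6 : ℂ) • Γ.ρ 1 0 Γ.f := by
    rw [eq_sub_of_add_eq Γ.dx_g_two, ← map_smul, ← map_smul, ← map_neg, ← map_sub]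
    congr 1
    rw [Algebra.smul_def, Algebra.smul_def, map_ofNat, map_ofNat]
    ring
  have h4 : Γ.ρ 0 1 (Γ.dy (Γ.g 2))
      = -((4 : ℂ) • Γ.ρ 0 1 (Γ.ir Γ.Y * Γ.dy Γ.f)) - (6 : ℂ) • Γ.ρ 0 1 Γ.f := by
    rw [eq_sub_of_add_eq Γ.dy_g_two, ← map_smul, ← map_smul, ← map_neg, ← map_sub]
    congr 1
    rw [Algebra.smul_def, Algebra.smul_def, map_ofNat, map_ofNat]
    ring
  simp only [D, r, e, pow_one, add_lie, lie_add, smul_lie, lie_sub, lie_smul, h1, h2, Dx_x, Dy_y,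
    x_y, y_x, d_X, d_Y, Dx_ρ, Dy_ρ, ρ_ρ, zero_add, one_add_one_eq_two, h3, h4]
  push_cast
  module

/-- The cubic derivatives of `f` cancel by `dy_three_f`, and the quadratic terms `QL` and `QR`
cancel against the brackets of `ρ 1 0 f` and `ρ 0 1 f` with `ρ 0 0 f`. -/
theorem D_e : ⁅Γ.D, Γ.e⁆ = 0 := by
  have h1 : ⁅Γ.ρ 0 0 Γ.f, Γ.x 3 1⁆ = -((3 : ℂ) • Γ.ρ 2 0 (Γ.dx Γ.f)
      + (σ₂ ε₁ ε₂ / 4) • Γ.ρ 0 0 (Γ.dx (Γ.dx (Γ.dx Γ.f))) + (3 / 2 * σ₃ ε₁ ε₂) • Γ.QL) := by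
    rw [← lie_skew, ex_ρ]
  have h2 : ⁅Γ.ρ 0 0 Γ.f, Γ.y 3 1⁆ = -(-((3 : ℂ) • Γ.ρ 0 2 (Γ.dx Γ.f))
      - (σ₂ ε₁ ε₂ / 4) • Γ.ρ 0 0 (Γ.dx (Γ.dx (Γ.dx Γ.f))) + (3 / 2 * σ₃ ε₁ ε₂) • Γ.QR) := by
    rw [← lie_skew, ey_ρ, dy_three_f, dy_f_eq, map_neg, map_neg]
    module
  have h3 : ⁅Γ.ρ 0 0 Γ.f, Γ.ρ 1 0 Γ.f⁆ = (1 / 2 : ℂ) • Γ.QR := by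
    rw [← lie_skew, ← neg_eq_iff_eq_neg.2 Γ.ρ10_ρ]
    module
  have h4 : ⁅Γ.ρ 0 0 Γ.f, Γ.ρ 0 1 Γ.f⁆ = (1 / 2 : ℂ) • Γ.QL := by
    rw [← lie_skew, ← neg_eq_iff_eq_neg.2 Γ.ρ01_ρ]
    module
  simp only [D, e, add_lie, lie_add, smul_lie, lie_smul, h1, h2, h3, h4, Dx_x, Dy_y,
    x_y, y_x, Derivation.map_one_eq_zero, map_zero, smul_zero, Dx_ρ, Dy_ρ, dy_f_eq, map_neg,
    zero_add]
  module

theorem q_p (n m : ℕ) : ⁅Γ.q n, Γ.p m⁆ = (m : ℂ) • Γ.p (n + m - 1) := by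
  simp only [q, p, add_lie, lie_add, x_y, y_x, x1_x, y1_y, d_X_pow, d_Y_pow, mul_smul_comm,
    map_smul, ← pow_add, zero_add, add_zero]
  rcases m with _ | m
  · simp
  · rw [Nat.add_sub_cancel, ← add_assoc, Nat.add_sub_cancel, smul_add]

theorem natCast_mul_eq_smul {R : Type*} [Ring R] [Algebra ℂ R] (k : ℕ) (z : R) :
    (k : R) * z = (k : ℂ) • z := by
  rw [Nat.cast_smul_eq_nsmul, nsmul_eq_mul]

/-- The quadratic part of `[t_{3,0}, t_{0,n}]` for the sum of two commuting systems: the mixed terms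
assemble to `kpoly`. -/
theorem quadZero_p (n : ℕ) : quadZero Γ.p n = quadZero (fun n => Γ.x 0 (Γ.X ^ n)) n
    + quadZero (fun n => Γ.y 0 (Γ.Y ^ n)) n
    + (2 : ℂ) • Γ.ρ 0 0 (kpoly n (Γ.il Γ.X) (Γ.ir Γ.Y)) := by
  have h1 : ∀ F G, Γ.y 0 G * Γ.x 0 F = Γ.ρ 0 0 (Γ.il F * Γ.ir G) := by
    intro F G
    rw [← x_mul_y]
    exact (sub_eq_zero.1 (Γ.x_y 0 0 F G)).symm
  have h2 : Γ.ρ 0 0 (kpoly n (Γ.il Γ.X) (Γ.ir Γ.Y)) = ∑ m ∈ Finset.range (n - 2),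
      (((m : ℂ) + 1) * (((n - 3 - m : ℕ) : ℂ) + 1))
        • Γ.ρ 0 0 (Γ.il Γ.X ^ m * Γ.ir Γ.Y ^ (n - 3 - m)) := by
    rw [kpoly, map_sum]
    refine Finset.sum_congr rfl fun m _ => ?_
    rw [← map_smul, Algebra.smul_def]
    simp
  have h3 : Γ.ρ 0 0 (kpoly n (Γ.il Γ.X) (Γ.ir Γ.Y)) = ∑ m ∈ Finset.range (n - 2),
      (((m : ℂ) + 1) * (((n - 3 - m : ℕ) : ℂ) + 1))
        • Γ.ρ 0 0 (Γ.il Γ.X ^ (n - 3 - m) * Γ.ir Γ.Y ^ m) := by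
    rw [kpoly_comm, kpoly, map_sum]
    refine Finset.sum_congr rfl fun m _ => ?_
    rw [← map_smul, Algebra.smul_def, mul_comm (Γ.il Γ.X ^ _)]
    simp
  rw [two_smul]
  nth_rewrite 1 [h2]
  rw [h3]
  simp only [quadZero, p, ← Finset.sum_add_distrib, ← smul_add]
  refine Finset.sum_congr rfl fun m _ => ?_
  congr 1
  rw [add_mul, mul_add, mul_add, x_mul_y, h1]
  simp only [map_pow Γ.il, map_pow Γ.ir]
  abel

theorem e_p (n : ℕ) : ⁅Γ.e, Γ.p n⁆ = (3 * n : ℂ) • Γ.r (n - 1)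
    + (σ₂ ε₁ ε₂ * ((n : ℂ) * (n - 1) * (n - 2) / 4)) • Γ.p (n - 3)
    + (3 / 2 * σ₃ ε₁ ε₂) • quadZero Γ.p n := by
  have hd : ∀ Z : V, (∀ n : ℕ, Γ.d (Z ^ n) = (n : ℂ) • Z ^ (n - 1)) →
      Γ.d (Γ.d (Γ.d (Z ^ n))) = ((n : ℂ) * (n - 1) * (n - 2)) • Z ^ (n - 3) := by
    intro Z hZ
    rw [hZ, Derivation.map_smul, hZ, Derivation.map_smul, Derivation.map_smul, hZ, smul_smul,
      smul_smul, show n - 1 - 1 - 1 = n - 3 by omega]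
    congr 1
    rcases n with _ | _ | n
    · simp
    · simp
    · push_cast
      ring
  have hr : (3 * n : ℂ) • Γ.r (n - 1)
      = (3 * n : ℂ) • (Γ.x 2 (Γ.X ^ (n - 1)) + Γ.y 2 (Γ.Y ^ (n - 1)))
      - (3 * σ₃ ε₁ ε₂) • Γ.ρ 0 0 (Γ.g n) := by
    rcases n with _ | n
    · simp [g_zero]
    · have h4 : ((n : ℂ) + 1) ≠ 0 := Nat.cast_add_one_ne_zero n
      rw [r, Nat.add_sub_cancel, smul_sub _ _ ((σ₃ ε₁ ε₂ / (n + 1)) • _), smul_smul]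
      congr 2
      push_cast
      field_simp
  have hk : Γ.ρ 0 0 (kpoly n (Γ.il Γ.X) (Γ.ir Γ.Y))
      = Γ.ρ 0 0 (Γ.f * Γ.il (Γ.d (Γ.X ^ n))) + Γ.ρ 0 0 (Γ.f * Γ.ir (Γ.d (Γ.Y ^ n)))
        + Γ.ρ 0 0 (Γ.g n) := by
    rw [eq_neg_add_iff_add_eq.1 (Γ.mul_f_eq n) |>.symm, ← map_add, ← map_add, d_X_pow, d_Y_pow,
      map_smul, map_smul, map_pow, map_pow, ← natCast_mul_eq_smul, ← natCast_mul_eq_smul]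
    congr 1
    ring
  have hx : ⁅Γ.y 3 1, Γ.x 0 (Γ.X ^ n)⁆ = 0 := Γ.y_x _ _ _ _
  have hy : ⁅Γ.x 3 1, Γ.y 0 (Γ.Y ^ n)⁆ = 0 := Γ.x_y _ _ _ _
  rw [hr, quadZero_p, hk, e, p, p]
  simp only [add_lie, lie_add, smul_lie, ex_x, ey_y, hx, hy, ρ10_x, ρ01_y, ρ01_x, ρ10_y,
    hd _ Γ.d_X_pow, hd _ Γ.d_Y_pow, map_smul]
  rw [d_X_pow, d_Y_pow]
  simp only [map_smul]
  module

/-- The sum of two interacting systems of currents satisfies the relations of `𝒜`. -/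
def currentData : CurrentData ε₁ ε₂ B where
  p := Γ.p
  q := Γ.q
  r := Γ.r
  D := Γ.D
  e := Γ.e
  p_p := Γ.p_p
  D_p := Γ.D_p
  D_q := Γ.D_q
  r_zero := Γ.r_zero
  D_r_one := Γ.D_r_one
  D_e := Γ.D_e
  q_p := Γ.q_p
  e_p := Γ.e_p

end CrossData

end M2Brane

namespace M2Brane

open Polynomial LaurentSeries

variable (ε₁ ε₂ : ℂ)

/-! ### The three-current identity for the interaction -/

theorem lmapHom_invSq {R S : Type*} [CommRing R] [Algebra ℂ R] [CommRing S] [Algebra ℂ S]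
    (φ : R →ₐ[ℂ] S) (z : R) : lmapHom φ (invSq z) = invSq (φ z) := by
  ext n
  rw [lmapHom_coeff, invSq_coeff, invSq_coeff]
  split_ifs <;> simp

section kpoly

variable {R : Type*} [CommRing R]

theorem kpoly_mul (d : ℕ) (c x y : R) :
    c ^ 3 * kpoly d (c * x) (c * y) = c ^ d * kpoly d x y := by
  rcases Nat.lt_or_ge d 3 with hd | hd
  · rw [kpoly_of_lt hd, kpoly_of_lt hd, mul_zero, mul_zero]
  obtain ⟨l, rfl⟩ := Nat.exists_eq_add_of_le' hd
  rw [kpoly_add_three, kpoly_add_three, Finset.mul_sum, Finset.mul_sum]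
  refine Finset.sum_congr rfl fun m hm => ?_
  have hm' : m ≤ l := by simpa [Nat.lt_succ_iff] using hm
  obtain ⟨j, rfl⟩ := Nat.exists_eq_add_of_le hm'
  rw [Nat.add_sub_cancel_left]
  ring

theorem derivation_kpoly [Algebra ℂ R] (δ : Derivation ℂ R R) {x y c : R} (hx : δ x = c)
    (hy : δ y = c) (d : ℕ) : δ (kpoly d x y) = c * (d * kpoly (d - 1) x y) := by
  rcases Nat.lt_or_ge d 3 with hd | hd
  · rw [kpoly_of_lt hd, kpoly_of_lt (by omega)]
    simp
  obtain ⟨l, rfl⟩ := Nat.exists_eq_add_of_le' hd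
  have hs : ∀ m : ℕ, δ (((m : R) + 1) * (((l - m : ℕ) : R) + 1) * (x ^ m * y ^ (l - m)))
      = c * (((m : R) + 1) * (((l - m : ℕ) : R) + 1) * (m * (x ^ (m - 1) * y ^ (l - m))))
        + c * (((m : R) + 1) * (((l - m : ℕ) : R) + 1)
          * ((l - m : ℕ) * (x ^ m * y ^ (l - m - 1)))) := by
    intro m
    rw [Derivation.leibniz, Derivation.leibniz, Derivation.leibniz, Derivation.leibniz_pow,
      Derivation.leibniz_pow, hx, hy, map_add, map_add]
    simp only [Derivation.map_natCast, Derivation.map_one_eq_zero, smul_eq_mul, nsmul_eq_mul]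
    ring
  rw [kpoly_add_three, map_sum, Finset.sum_congr rfl fun m _ => hs m, Finset.sum_add_distrib,
    ← Finset.mul_sum, ← Finset.mul_sum, ← mul_add]
  congr 1
  rw [Finset.sum_range_succ', Finset.sum_range_succ, Nat.sub_self]
  simp only [Nat.cast_zero, zero_mul, mul_zero, add_zero]
  rcases l with _ | l
  · simp [kpoly_of_lt]
  rw [show l + 1 + 3 - 1 = l + 3 by omega, kpoly_add_three, ← Finset.sum_add_distrib,
    Finset.mul_sum]
  refine Finset.sum_congr rfl fun m hm => ?_
  have hm' : m ≤ l := by simpa [Nat.lt_succ_iff] using hm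
  obtain ⟨j, rfl⟩ := Nat.exists_eq_add_of_le hm'
  rw [show m + j + 1 - (m + 1) = j by omega, show m + j + 1 - m = j + 1 by omega,
    show m + j - m = j by omega]
  simp only [Nat.add_sub_cancel]
  push_cast
  ring

theorem natCast_add_one_mul_smul_pow [Algebra ℂ R] (c : ℂ) (x : R) (k : ℕ) :
    ((k : R) + 1) * (c • x) ^ k = (((k : ℂ) + 1) * c ^ k) • x ^ k := by
  rw [_root_.smul_pow, Algebra.smul_def, Algebra.smul_def, map_mul, map_add, map_natCast, map_one,
    map_pow]
  ring

/-- The generating series of `kpoly`. -/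
theorem invSq_mul_invSq_coeff (x y : R) (n : ℤ) : (invSq x * invSq y).coeff n
    = if 4 ≤ n then kpoly (n - 1).toNat x y else 0 := by
  have h : ∀ (z : R) (i : ℤ), i < 2 → (invSq z).coeff i = 0 := fun z i hi => by
    rw [invSq_coeff, if_neg (by omega)]
  rw [coeff_mul_Icc _ _ 2 2 n (h x) (h y)]
  split_ifs with hn
  · obtain ⟨l, rfl⟩ : ∃ l : ℕ, n = l + 4 := ⟨(n - 4).toNat, by omega⟩
    rw [show ((l : ℤ) + 4 - 1).toNat = l + 3 by omega, kpoly_add_three]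
    symm
    refine Finset.sum_nbij' (fun m => (m : ℤ) + 2) (fun i => (i - 2).toNat) ?_ ?_ ?_ ?_ ?_
    · intro m hm; simp only [Finset.mem_range, Finset.mem_Icc] at *; omega
    · intro i hi; simp only [Finset.mem_range, Finset.mem_Icc] at *; omega
    · intro m _; simp
    · intro i hi; simp only [Finset.mem_Icc] at hi; omega
    · intro m hm
      simp only [Finset.mem_range] at hm
      rw [invSq_coeff, invSq_coeff, if_pos (by omega), if_pos (by omega),
        show ((m : ℤ) + 2 - 2).toNat = m by omega,
        show ((l : ℤ) + 4 - (m + 2) - 2).toNat = l - m by omega]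
      ring
  · rw [Finset.Icc_eq_empty (by omega), Finset.sum_empty]

end kpoly

/-- The polynomial ring in `x`, `y₁`, `y₂`, as a definition of its own, so that instances are found
without unfolding the tensor products. -/
def Poly₃ : Type := ℂ[X] ⊗[ℂ] Poly₂

instance : CommRing Poly₃ := inferInstanceAs (CommRing (ℂ[X] ⊗[ℂ] Poly₂))

instance : Algebra ℂ Poly₃ := inferInstanceAs (Algebra ℂ (ℂ[X] ⊗[ℂ] Poly₂))

/-- The product of a polynomial in `x` and one in `y₁`, `y₂`. -/
def mk₃ (φ : ℂ[X]) (g : Poly₂) : Poly₃ := φ ⊗ₜ[ℂ] g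

theorem mk₃_mul (φ φ' : ℂ[X]) (g g' : Poly₂) :
    mk₃ φ g * mk₃ φ' g' = mk₃ (φ * φ') (g * g') :=
  Algebra.TensorProduct.tmul_mul_tmul φ φ' g g'

/-- The substitution `y = y₁`. -/
def in₁ : Poly₂ →ₐ[ℂ] Poly₃ := Algebra.TensorProduct.map (AlgHom.id ℂ ℂ[X]) inl

/-- The substitution `y = y₂`. -/
def in₂ : Poly₂ →ₐ[ℂ] Poly₃ := Algebra.TensorProduct.map (AlgHom.id ℂ ℂ[X]) inr

theorem in₁_tmul (φ ψ : ℂ[X]) : in₁ (φ ⊗ₜ ψ) = mk₃ φ (ψ ⊗ₜ 1) := rfl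

theorem in₂_tmul (φ ψ : ℂ[X]) : in₂ (φ ⊗ₜ ψ) = mk₃ φ (1 ⊗ₜ ψ) := rfl

/-- The exchange of `y₁` and `y₂`. -/
def swap₁₂ : Poly₃ →ₐ[ℂ] Poly₃ :=
  Algebra.TensorProduct.map (AlgHom.id ℂ ℂ[X]) (Algebra.TensorProduct.comm ℂ ℂ[X] ℂ[X]).toAlgHom

theorem swap₁₂_in₁ (g : Poly₂) : swap₁₂ (in₁ g) = in₂ g := by
  induction g using TensorProduct.induction_on with
  | zero => simp
  | add g g' hg hg' => simp only [map_add, hg, hg']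
  | tmul φ ψ => rfl

theorem swap₁₂_in₂ (g : Poly₂) : swap₁₂ (in₂ g) = in₁ g := by
  induction g using TensorProduct.induction_on with
  | zero => simp
  | add g g' hg hg' => simp only [map_add, hg, hg']
  | tmul φ ψ => rfl

/-- The partial derivative in `x`. -/
def dx₃ : Derivation ℂ Poly₃ Poly₃ := derLeft ℂ[X] Poly₂ Polynomial.derivative'

theorem in₁_dx (g : Poly₂) : in₁ (dx g) = dx₃ (in₁ g) := by
  induction g using TensorProduct.induction_on with
  | zero => simp
  | add g g' hg hg' => simp only [map_add, hg, hg']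
  | tmul φ ψ => rfl

theorem in₂_dx (g : Poly₂) : in₂ (dx g) = dx₃ (in₂ g) := by
  induction g using TensorProduct.induction_on with
  | zero => simp
  | add g g' hg hg' => simp only [map_add, hg, hg']
  | tmul φ ψ => rfl

/-- The linear map `x ^ n y₁ ^ i y₂ ^ j ↦ t_{0,n} ⊗ t_{0,i} t_{0,j}`. -/
def rho₃ : Poly₃ →ₗ[ℂ] M2Algebra ε₁ ε₂ ⊗[ℂ] M2Algebra ε₁ ε₂ :=
  TensorProduct.map (cur ε₁ ε₂ 0) (curMul ε₁ ε₂)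

theorem rho₃_mk₃ (φ ψ ψ' : ℂ[X]) : rho₃ ε₁ ε₂ (mk₃ φ (ψ ⊗ₜ ψ'))
    = cur ε₁ ε₂ 0 φ ⊗ₜ (cur ε₁ ε₂ 0 ψ * cur ε₁ ε₂ 0 ψ') := rfl

theorem Poly₃.induction {P : Poly₃ → Prop} (h0 : P 0) (hadd : ∀ g g', P g → P g' → P (g + g'))
    (h : ∀ φ ψ ψ', P (mk₃ φ (ψ ⊗ₜ ψ'))) (g : Poly₃) : P g := by
  refine TensorProduct.induction_on (motive := P) g h0 (fun φ g => ?_) hadd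
  induction g using TensorProduct.induction_on with
  | zero =>
    have : (φ ⊗ₜ[ℂ] (0 : Poly₂)) = 0 := TensorProduct.tmul_zero _ _
    rw [this]
    exact h0
  | add g g' hg hg' =>
    rw [TensorProduct.tmul_add]
    exact hadd _ _ hg hg'
  | tmul ψ ψ' => exact h φ ψ ψ'

theorem rho₃_swap (g : Poly₃) : rho₃ ε₁ ε₂ (swap₁₂ g) = rho₃ ε₁ ε₂ g := by
  refine Poly₃.induction (P := fun g => rho₃ ε₁ ε₂ (swap₁₂ g) = rho₃ ε₁ ε₂ g) ?_ ?_ ?_ g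
  · simp
  · intro g g' hg hg'
    simp only [map_add, hg, hg']
  · intro φ ψ ψ'
    rw [rho₃_mk₃, cur_mul_comm]
    rfl

/-- The bracket of `t_1(x) t_0(y₁)` and `t_0(x) t_0(y₂)` has the single contraction in `x`. -/
theorem rho_one_zero_lie_rho (g h : Poly₂) :
    ⁅rho ε₁ ε₂ 1 0 g, rho ε₁ ε₂ 0 0 h⁆ = rho₃ ε₁ ε₂ (in₁ g * in₂ (dx h)) := by
  induction g using TensorProduct.induction_on with
  | zero => simp
  | add g g' hg hg' => simp only [map_add, add_lie, hg, hg', add_mul]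
  | tmul φ ψ =>
    induction h using TensorProduct.induction_on with
    | zero => simp
    | add h h' hh hh' => simp only [map_add, lie_add, hh, hh', mul_add]
    | tmul φ' ψ' =>
      rw [rho_tmul, rho_tmul, derLeft_tmul, in₁_tmul, in₂_tmul, mk₃_mul,
        Algebra.TensorProduct.tmul_mul_tmul, one_mul, mul_one, rho₃_mk₃,
        show derivative' φ' = derivative φ' from rfl, ← cur_one_lie_cur, Ring.lie_def,
        Ring.lie_def, Algebra.TensorProduct.tmul_mul_tmul, Algebra.TensorProduct.tmul_mul_tmul,
        TensorProduct.sub_tmul, cur_mul_comm ε₁ ε₂ ψ']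

theorem lrho_one_zero_lie_lrho (G H : LaurentSeries Poly₂) :
    ⁅lrho ε₁ ε₂ 1 0 G, lrho ε₁ ε₂ 0 0 H⁆
      = lmap (rho₃ ε₁ ε₂) (lmapHom in₁ G * lder dx₃ (lmapHom in₂ H)) := by
  refine (lmap_lie_lmap (i := in₁.toLinearMap) (j := in₂.toLinearMap ∘ₗ (dx : Poly₂ →ₗ[ℂ] Poly₂))
    (fun g h => rho_one_zero_lie_rho ε₁ ε₂ g h) G H).trans ?_
  congr 2
  ext n
  exact in₂_dx _

theorem lmap_rho₃_swap (G : LaurentSeries Poly₃) :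
    lmap (rho₃ ε₁ ε₂) (lmapHom swap₁₂ G) = lmap (rho₃ ε₁ ε₂) G := by
  ext n
  exact rho₃_swap ε₁ ε₂ _

/-- The currents `t_0` commute, so `y₁` and `y₂` may be exchanged; symmetrizing turns the derivative
of one factor into the derivative of the product. -/
theorem two_smul_lrho_one_zero_lie_lrho (G : LaurentSeries Poly₂) :
    (2 : ℂ) • ⁅lrho ε₁ ε₂ 1 0 G, lrho ε₁ ε₂ 0 0 G⁆
      = lmap (rho₃ ε₁ ε₂) (lder dx₃ (lmapHom in₁ G * lmapHom in₂ G)) := by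
  have h1 : lmapHom swap₁₂ (lmapHom in₁ G * lder dx₃ (lmapHom in₂ G))
      = lmapHom in₂ G * lder dx₃ (lmapHom in₁ G) := by
    rw [map_mul]
    congr 1
    · ext n
      exact swap₁₂_in₁ _
    · ext n
      change swap₁₂ (dx₃ (in₂ (G.coeff n))) = dx₃ (in₁ (G.coeff n))
      rw [← in₂_dx, swap₁₂_in₂, in₁_dx]
  rw [lrho_one_zero_lie_lrho, Derivation.leibniz, smul_eq_mul, smul_eq_mul, map_add, ← h1,
    lmap_rho₃_swap]
  exact two_smul ℂ (lmap (rho₃ ε₁ ε₂) (lmapHom in₁ G * lder dx₃ (lmapHom in₂ G)))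

/-- The linear map `x ^ n y ^ m ↦ x ^ n kpoly m y₁ y₂`. -/
def kmap₃ : Poly₂ →ₗ[ℂ] Poly₃ := kmap.lTensor ℂ[X]

theorem kmap₃_tmul (φ ψ : ℂ[X]) : kmap₃ (φ ⊗ₜ ψ) = mk₃ φ (kmap ψ) := rfl

theorem rho₃_kmap₃ (g : Poly₂) : rho₃ ε₁ ε₂ (kmap₃ g) = rhoQuadRight ε₁ ε₂ g := by
  induction g using TensorProduct.induction_on with
  | zero => simp
  | add g g' hg hg' => simp only [map_add, hg, hg']
  | tmul φ ψ =>
    change cur ε₁ ε₂ 0 φ ⊗ₜ[ℂ] curMul ε₁ ε₂ (kmap ψ) = cur ε₁ ε₂ 0 φ ⊗ₜ[ℂ] curQuad ε₁ ε₂ ψ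
    rw [curMul_kmap]

/-- The inclusion of the polynomials in `x`. -/
def inX : ℂ[X] →ₐ[ℂ] Poly₃ := Algebra.TensorProduct.includeLeft

/-- The inclusion of the polynomials in `y₁` and `y₂`. -/
def inY : Poly₂ →ₐ[ℂ] Poly₃ := Algebra.TensorProduct.includeRight

theorem in₁_inl (φ : ℂ[X]) : in₁ (inl φ) = inX φ := rfl

theorem in₂_inl (φ : ℂ[X]) : in₂ (inl φ) = inX φ := rfl

theorem in₁_inr (φ : ℂ[X]) : in₁ (inr φ) = inY (inl φ) := rfl

theorem in₂_inr (φ : ℂ[X]) : in₂ (inr φ) = inY (inr φ) := rfl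

theorem kmap₃_mul (φ ψ : ℂ[X]) : kmap₃ (inl φ * inr ψ) = inX φ * inY (kmap ψ) := by
  have h : inl φ * inr ψ = φ ⊗ₜ ψ := by simp
  have h' : inX φ * inY (kmap ψ) = mk₃ (φ * 1) (1 * kmap ψ) := mk₃_mul _ _ _ _
  rw [h, h', kmap₃_tmul, mul_one, one_mul]

theorem kmap₃_sub_pow (k : ℕ) : kmap₃ ((inr X - inl X) ^ k)
    = kpoly k (in₁ (inr X - inl X)) (in₂ (inr X - inl X)) := by
  rw [map_sub, map_sub, in₁_inl, in₂_inl, in₁_inr, in₂_inr, sub_eq_add_neg (inY _),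
    sub_eq_add_neg (inY _), kpoly_add, sub_eq_add_neg, add_pow, map_sum]
  refine Finset.sum_congr rfl fun m _ => ?_
  have h3 : (inr X : Poly₂) ^ m * (-inl X) ^ (k - m) * (k.choose m : Poly₂)
      = inl ((k.choose m : ℂ[X]) * (-X) ^ (k - m)) * inr (X ^ m) := by
    rw [map_mul, map_natCast, map_pow, map_neg, map_pow]
    ring
  rw [h3, kmap₃_mul, map_mul, map_natCast, map_pow, map_neg, kmap_X_pow, ← map_kpoly]
  rfl

theorem dx₃_in (c : ℂ) : dx₃ (in₁ (c • (inr X - inl X))) = algebraMap ℂ Poly₃ (-c)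
    ∧ dx₃ (in₂ (c • (inr X - inl X))) = algebraMap ℂ Poly₃ (-c) := by
  have h : dx (c • (inr X - inl X)) = algebraMap ℂ Poly₂ (-c) := by
    rw [Derivation.map_smul, map_sub, Algebra.TensorProduct.includeLeft_apply,
      Algebra.TensorProduct.includeRight_apply, derLeft_tmul, derLeft_tmul]
    simp only [derivative'_apply, derivative_X, derivative_one, TensorProduct.zero_tmul, zero_sub,
      map_neg, Algebra.algebraMap_eq_smul_one, Algebra.TensorProduct.one_def, smul_neg]
  rw [← in₁_dx, ← in₂_dx, h, AlgHom.commutes, AlgHom.commutes]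
  exact ⟨rfl, rfl⟩

/-- For `f(x, y) = (w + x - y) ^ (-2)`, which is the case `c = 1`, this reads
`∂ₓ (f(x, y₁) f(x, y₂)) = -(kmap₃ f)(x, y₁, y₂)`. In degree `n`, the product on the left has the
coefficient `kpoly (n - 1)`, and both sides are multiples of `kpoly (n - 2) (y₁ - x) (y₂ - x)`. The
case `c = -1` is the one with exchanged variables. -/
theorem lmap_kmap₃_invSq {c : ℂ} (hc : c ^ 2 = 1) :
    lder dx₃ (lmapHom in₁ (invSq (c • (inr X - inl X))) * lmapHom in₂ (invSq (c • (inr X - inl X))))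
      = -lmap kmap₃ (invSq (c • (inr X - inl X))) := by
  obtain ⟨h1, h2⟩ := dx₃_in c
  have hc3 : c ^ 3 = c := by rw [pow_succ, hc, one_mul]
  rw [lmapHom_invSq, lmapHom_invSq]
  ext n
  rw [lder_coeff, invSq_mul_invSq_coeff, HahnSeries.coeff_neg, lmap_coeff, invSq_coeff]
  by_cases h4 : 4 ≤ n
  · obtain ⟨l, rfl⟩ : ∃ l : ℕ, n = l + 4 := ⟨(n - 4).toNat, by omega⟩
    have h5 : ((l + 2 : ℕ) + 1 : Poly₂) * (c • (inr X - inl X)) ^ (l + 2)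
        = (((l + 2 : ℕ) + 1 : ℂ) * c ^ (l + 2)) • (inr X - inl X) ^ (l + 2) := by
      exact natCast_add_one_mul_smul_pow c _ _
    have h6 : ∀ z : Poly₃, c • z = algebraMap ℂ Poly₃ c * z := fun z => Algebra.smul_def _ _
    have h7 := kpoly_mul (l + 2) (algebraMap ℂ Poly₃ c) (in₁ (inr X - inl X)) (in₂ (inr X - inl X))
    rw [← map_pow, hc3] at h7
    rw [if_pos h4, if_pos (by omega), derivation_kpoly dx₃ h1 h2,
      show ((l : ℤ) + 4 - 1).toNat = l + 3 by omega, show ((l : ℤ) + 4 - 2).toNat = l + 2 by omega,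
      show l + 3 - 1 = l + 2 by omega, map_smul in₁, map_smul in₂, h5, map_smul, kmap₃_sub_pow, h6,
      h6, Algebra.smul_def, map_mul, map_add, map_natCast, map_one, map_pow, map_neg]
    push_cast
    linear_combination (-(l : Poly₃) - 3) * h7
  · rw [if_neg h4, map_zero]
    split_ifs with h2
    · have h5 : (n - 2).toNat < 2 := by omega
      generalize (n - 2).toNat = k at h5
      have h6 : ((k : Poly₂) + 1) * (c • (inr X - inl X)) ^ k
          = (((k : ℂ) + 1) * c ^ k) • (inr X - inl X) ^ k := by
        exact natCast_add_one_mul_smul_pow c _ _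
      rw [h6, map_smul, kmap₃_sub_pow, kpoly_of_lt (by omega), smul_zero, neg_zero]
    · rw [map_zero, neg_zero]

theorem lrho_one_zero_lie_invSq {c : ℂ} (hc : c ^ 2 = 1) :
    (2 : ℂ) • ⁅lrho ε₁ ε₂ 1 0 (invSq (c • (inr X - inl X))),
        lrho ε₁ ε₂ 0 0 (invSq (c • (inr X - inl X)))⁆
      = -lmap (rhoQuadRight ε₁ ε₂) (invSq (c • (inr X - inl X))) := by
  rw [two_smul_lrho_one_zero_lie_lrho, lmap_kmap₃_invSq hc, map_neg]
  congr 1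
  ext n
  exact rho₃_kmap₃ ε₁ ε₂ _

/-! ### Exchange of the tensor factors -/

theorem neg_smul_sub {R : Type*} [Ring R] [Algebra ℂ R] (c : ℂ) (x y : R) :
    -c • (x - y) = c • (y - x) := by
  rw [neg_smul, ← smul_neg, neg_sub]

/-- The exchange of the two variables. -/
def swap : Poly₂ →ₐ[ℂ] Poly₂ := (Algebra.TensorProduct.comm ℂ ℂ[X] ℂ[X]).toAlgHom

/-- The exchange of the two tensor factors. -/
def swapTensor : M2Algebra ε₁ ε₂ ⊗[ℂ] M2Algebra ε₁ ε₂ →ₐ[ℂ] M2Algebra ε₁ ε₂ ⊗[ℂ] M2Algebra ε₁ ε₂ :=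
  (Algebra.TensorProduct.comm ℂ (M2Algebra ε₁ ε₂) (M2Algebra ε₁ ε₂)).toAlgHom

theorem swapTensor_rho (a b : ℕ) (g : Poly₂) :
    swapTensor ε₁ ε₂ (rho ε₁ ε₂ a b g) = rho ε₁ ε₂ b a (swap g) := by
  induction g using TensorProduct.induction_on with
  | zero => simp
  | add g g' hg hg' => simp only [map_add, hg, hg']
  | tmul φ ψ => rfl

theorem swapTensor_rhoQuadRight (g : Poly₂) :
    swapTensor ε₁ ε₂ (rhoQuadRight ε₁ ε₂ g) = rhoQuadLeft ε₁ ε₂ (swap g) := by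
  induction g using TensorProduct.induction_on with
  | zero => simp
  | add g g' hg hg' => simp only [map_add, hg, hg']
  | tmul φ ψ => rfl

theorem lmapHom_swapTensor_lrho (a b : ℕ) (G : LaurentSeries Poly₂) :
    lmapHom (swapTensor ε₁ ε₂) (lrho ε₁ ε₂ a b G) = lrho ε₁ ε₂ b a (lmapHom swap G) := by
  ext n
  exact swapTensor_rho ε₁ ε₂ a b _

theorem lrho_zero_one_lie_invSq {c : ℂ} (hc : c ^ 2 = 1) :
    (2 : ℂ) • ⁅lrho ε₁ ε₂ 0 1 (invSq (c • (inr X - inl X))),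
        lrho ε₁ ε₂ 0 0 (invSq (c • (inr X - inl X)))⁆
      = -lmap (rhoQuadLeft ε₁ ε₂) (invSq (c • (inr X - inl X))) := by
  have h := congrArg (lmapHom (swapTensor ε₁ ε₂))
    (lrho_one_zero_lie_invSq ε₁ ε₂ (c := -c) (by rw [neg_sq, hc]))
  have hs : lmapHom swap (invSq (-c • (inr X - inl X))) = invSq (c • (inr X - inl X)) := by
    rw [lmapHom_invSq, map_smul, map_sub]
    congr 1
    change -c • (inl X - inr X) = _
    exact neg_smul_sub c _ _
  have hq : lmapHom (swapTensor ε₁ ε₂) (lmap (rhoQuadRight ε₁ ε₂) (invSq (-c • (inr X - inl X))))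
      = lmap (rhoQuadLeft ε₁ ε₂) (lmapHom swap (invSq (-c • (inr X - inl X)))) := by
    ext n
    exact swapTensor_rhoQuadRight ε₁ ε₂ _
  rw [map_neg, hq, map_smul, algHom_lie, lmapHom_swapTensor_lrho, lmapHom_swapTensor_lrho, hs] at h
  exact h

end M2Brane

namespace M2Brane

open Polynomial LaurentSeries

variable (ε₁ ε₂ : ℂ)

/-! ### The coproduct -/

/-- The expansion of `(w + x - y) ^ (-2)`. -/
def interaction : LaurentSeries Poly₂ := invSq (inr X - inl X)

theorem interaction_eq : interaction = invSq ((1 : ℂ) • (inr X - inl X)) :=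
  congrArg invSq (one_smul ℂ _).symm

theorem lmapHom_shift_one {R : Type*} [CommRing R] [Algebra ℂ R] (φ : ℂ[X] →ₐ[ℂ] R) :
    lmapHom φ (shift 1) = HahnSeries.C (φ X) + HahnSeries.single (-1) 1 := by
  have := lmapHom_shift_pow φ 1 1
  rwa [pow_one, pow_one, map_one] at this

theorem lmapHom_shift_zero {R : Type*} [CommRing R] [Algebra ℂ R] (φ : ℂ[X] →ₐ[ℂ] R) :
    lmapHom φ (shift 0) = HahnSeries.C (φ X) := by
  rw [shift_zero, HahnSeries.C_apply, lmapHom_single, HahnSeries.C_apply]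

theorem lcur_one (ι : M2Algebra ε₁ ε₂ →ₐ[ℂ] M2Algebra ε₁ ε₂ ⊗[ℂ] M2Algebra ε₁ ε₂) (a : ℕ) :
    lcur ε₁ ε₂ ι a 1 = HahnSeries.C (ι (t ε₁ ε₂ a 0)) := by
  rw [← HahnSeries.single_zero_one, lcur, lmap_single, LinearMap.comp_apply, cur_one]
  rfl

theorem invSq_sub_mul {R : Type*} [CommRing R] (x y : R) :
    invSq (y - x) * (HahnSeries.C x + HahnSeries.single (-1) 1 - HahnSeries.C y) ^ 2 = 1 := by
  rw [← invSq_mul (y - x), map_sub]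
  congr 2
  ring

theorem lder_C_add_single {R : Type*} [CommRing R] [Algebra ℂ R] (δ : Derivation ℂ R R) (x : R) :
    lder δ (HahnSeries.C x + HahnSeries.single (-1) 1) = HahnSeries.C (δ x) := by
  rw [map_add, HahnSeries.C_apply, lder_single, lder_single, Derivation.map_one_eq_zero, map_zero,
    add_zero, HahnSeries.C_apply]

theorem dx_inl_X : dx (inl X) = 1 := by
  rw [Algebra.TensorProduct.includeLeft_apply, derLeft_tmul]
  simp [Algebra.TensorProduct.one_def]

theorem dy_inl_X : dy (inl X) = 0 := by
  rw [Algebra.TensorProduct.includeLeft_apply, derRight_tmul]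
  simp

theorem dx_inr_X : dx (inr X) = 0 := by
  rw [Algebra.TensorProduct.includeRight_apply, derLeft_tmul]
  simp

theorem dy_inr_X : dy (inr X) = 1 := by
  rw [Algebra.TensorProduct.includeRight_apply, derRight_tmul]
  simp [Algebra.TensorProduct.one_def]

theorem dx_dy (g : Poly₂) : dx (dy g) = dy (dx g) := by
  induction g using TensorProduct.induction_on with
  | zero => simp
  | add g g' hg hg' => simp only [map_add, hg, hg']
  | tmul φ ψ => rfl

theorem rho_lie_rho (g h : Poly₂) : ⁅rho ε₁ ε₂ 0 0 g, rho ε₁ ε₂ 0 0 h⁆ = 0 := by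
  induction g using TensorProduct.induction_on with
  | zero => simp
  | add g g' hg hg' => simp only [map_add, add_lie, hg, hg', add_zero]
  | tmul φ ψ =>
    induction h using TensorProduct.induction_on with
    | zero => simp
    | add h h' hh hh' => simp only [map_add, lie_add, hh, hh', add_zero]
    | tmul φ' ψ' =>
      rw [rho_tmul, rho_tmul, Ring.lie_def, Algebra.TensorProduct.tmul_mul_tmul,
        Algebra.TensorProduct.tmul_mul_tmul, cur_mul_comm, cur_mul_comm ε₁ ε₂ ψ, sub_self]

/-- The two systems of currents `x a F` in the first tensor factor, with argument translated by
`w`, and `y a F` in the second one. -/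
def crossData : CrossData ε₁ ε₂ (Target ε₁ ε₂) (LaurentSeries ℂ[X]) (LaurentSeries Poly₂) where
  x := lcur ε₁ ε₂ (inA ε₁ ε₂)
  y := lcur ε₁ ε₂ (inB ε₁ ε₂)
  ρ := lrho ε₁ ε₂
  d := lder Polynomial.derivative'
  dx := lder dx
  dy := lder dy
  il := lmapHom inl
  ir := lmapHom inr
  X := shift 1
  Y := shift 0
  f := interaction
  QL := lmap (rhoQuadLeft ε₁ ε₂) interaction
  QR := lmap (rhoQuadRight ε₁ ε₂) interaction
  d_X := lder_shift 1
  d_Y := lder_shift 0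
  dx_X := by
    rw [lmapHom_shift_one, lder_C_add_single, dx_inl_X, map_one]
  dx_Y := by
    rw [lmapHom_shift_zero, HahnSeries.C_apply, lder_single, dx_inr_X, map_zero]
  dy_X := by
    rw [lmapHom_shift_one, lder_C_add_single, dy_inl_X, map_zero]
  dy_Y := by
    rw [lmapHom_shift_zero, HahnSeries.C_apply, lder_single, dy_inr_X,
      HahnSeries.single_zero_one]
  dx_dy G := by
    ext n
    exact dx_dy _
  f_q := by
    rw [lmapHom_shift_one, lmapHom_shift_zero]
    exact invSq_sub_mul _ _
  Dx_x a F := by rw [lcur_one]; exact t20_lie_lcur ε₁ ε₂ _ a F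
  Dy_y a F := by rw [lcur_one]; exact t20_lie_lcur ε₁ ε₂ _ a F
  x_y := lcur_left_lie_lcur_right ε₁ ε₂
  x_x := lcur_lie_lcur ε₁ ε₂ _
  y_y := lcur_lie_lcur ε₁ ε₂ _
  x1_x := lcur_one_lie_lcur ε₁ ε₂ _
  y1_y := lcur_one_lie_lcur ε₁ ε₂ _
  ex_x n := by rw [lcur_one, ← lmap_curQuad_shift_pow]; exact t30_lie_lcur ε₁ ε₂ _ _
  ey_y n := by rw [lcur_one, ← lmap_curQuad_shift_pow]; exact t30_lie_lcur ε₁ ε₂ _ _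
  Dx_ρ a b G := by rw [lcur_one]; exact t20_left_lie_lrho ε₁ ε₂ a b G
  Dy_ρ a b G := by rw [lcur_one]; exact t20_right_lie_lrho ε₁ ε₂ a b G
  x_ρ := lcur_left_lie_lrho ε₁ ε₂
  y_ρ := lcur_right_lie_lrho ε₁ ε₂
  x1_ρ := lcur_one_left_lie_lrho ε₁ ε₂
  y1_ρ := lcur_one_right_lie_lrho ε₁ ε₂
  x2_ρ := t21_left_lie_lrho ε₁ ε₂
  y2_ρ := t21_right_lie_lrho ε₁ ε₂
  ex_ρ := by rw [lcur_one]; exact t30_left_lie_lrho ε₁ ε₂ _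
  ey_ρ := by rw [lcur_one]; exact t30_right_lie_lrho ε₁ ε₂ _
  ρ_ρ := lmap_lie_lmap_eq_zero (rho_lie_rho ε₁ ε₂)
  ρ10_x := lrho_one_zero_lie_lcur_left ε₁ ε₂
  ρ01_y := lrho_zero_one_lie_lcur_right ε₁ ε₂
  ρ01_x := lrho_lie_lcur_left ε₁ ε₂ 1
  ρ10_y := lrho_lie_lcur_right ε₁ ε₂ 1
  x_mul_y := lcur_left_mul_lcur_right ε₁ ε₂
  ρ10_ρ := by
    rw [interaction_eq]
    exact lrho_one_zero_lie_invSq ε₁ ε₂ (one_pow 2)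
  ρ01_ρ := by
    rw [interaction_eq]
    exact lrho_zero_one_lie_invSq ε₁ ε₂ (one_pow 2)

/-- The meromorphic coproduct, with the variable `w⁻¹` for the Laurent series. -/
def coproduct : M2Algebra ε₁ ε₂ →ₐ[ℂ] Target ε₁ ε₂ := (crossData ε₁ ε₂).currentData.hom

theorem coproduct_t0 (n : ℕ) : coproduct ε₁ ε₂ (t ε₁ ε₂ 0 n)
    = lcur ε₁ ε₂ (inA ε₁ ε₂) 0 (shift 1 ^ n) + HahnSeries.C (1 ⊗ₜ t ε₁ ε₂ 0 n) := by
  refine ((crossData ε₁ ε₂).currentData.hom_t 0 n).trans ?_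
  refine congrArg (lcur ε₁ ε₂ (inA ε₁ ε₂) 0 (shift 1 ^ n) + ·) ?_
  change lcur ε₁ ε₂ (inB ε₁ ε₂) 0 (shift 0 ^ n) = _
  rw [shift_zero, ← map_pow, HahnSeries.C_apply, HahnSeries.C_apply, lcur, lmap_single,
    LinearMap.comp_apply, cur_X_pow]
  rfl

theorem rho_sub_pow (k : ℕ) : rho ε₁ ε₂ 0 0 ((((k : ℂ) + 1)) • (inr X - inl X) ^ k)
    = ∑ p ∈ Finset.HasAntidiagonal.antidiagonal k,
      (((p.1 + p.2 + 1).factorial : ℂ) / ((p.2.factorial : ℂ) * (p.1.factorial : ℂ)) * (-1) ^ p.1)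
        • (t ε₁ ε₂ 0 p.1 ⊗ₜ[ℂ] t ε₁ ε₂ 0 p.2) := by
  have h : (inr X - inl X : Poly₂) ^ k = ∑ p ∈ Finset.HasAntidiagonal.antidiagonal k,
      ((k.choose p.1 : ℂ) * (-1) ^ p.1) • ((X ^ p.1 : ℂ[X]) ⊗ₜ[ℂ] (X ^ p.2 : ℂ[X])) := by
    rw [sub_eq_neg_add, (Commute.all _ _).add_pow']
    refine Finset.sum_congr rfl fun p _ => ?_
    have h1 : (inl X : Poly₂) ^ p.1 * inr X ^ p.2 = (X ^ p.1 : ℂ[X]) ⊗ₜ[ℂ] (X ^ p.2 : ℂ[X]) := by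
      rw [← map_pow, ← map_pow]
      simp
    rw [← h1]
    have h2 : ∀ {R : Type} [CommRing R] [Algebra ℂ R] (x y : R),
        k.choose p.1 • ((-x) ^ p.1 * y ^ p.2)
          = ((k.choose p.1 : ℂ) * (-1) ^ p.1) • (x ^ p.1 * y ^ p.2) := by
      intro R _ _ x y
      rw [neg_pow, nsmul_eq_mul, Algebra.smul_def, map_mul, map_natCast, map_pow, map_neg, map_one]
      ring
    exact h2 _ _
  rw [h, map_smul, map_sum, Finset.smul_sum]
  refine Finset.sum_congr rfl fun p hp => ?_
  rw [Finset.HasAntidiagonal.mem_antidiagonal] at hp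
  subst hp
  rw [map_smul, rho_tmul, cur_X_pow, cur_X_pow, smul_smul]
  congr 1
  have h1 : ((p.1.factorial : ℂ)) ≠ 0 := Nat.cast_ne_zero.2 (Nat.factorial_ne_zero _)
  have h2 : ((p.2.factorial : ℂ)) ≠ 0 := Nat.cast_ne_zero.2 (Nat.factorial_ne_zero _)
  have h3 := congrArg (Nat.cast : ℕ → ℂ) (Nat.add_choose_mul_factorial_mul_factorial p.1 p.2)
  rw [Nat.factorial_succ, Nat.choose_symm_add]
  push_cast at h3 ⊢
  field_simp
  linear_combination (p.1 + p.2 + 1 : ℂ) * h3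

theorem lrho_interaction : lrho ε₁ ε₂ 0 0 interaction = crossTerm ε₁ ε₂ := by
  ext n
  rw [lrho, lmap_coeff, interaction, invSq_coeff, crossTerm, single_mul_ofPowerSeries_coeff,
    PowerSeries.coeff_mk]
  split_ifs with h
  · rw [← rho_sub_pow]
    congr 1
    have h2 : ∀ {R : Type} [CommRing R] [Algebra ℂ R] (k : ℕ) (x : R),
        ((k : R) + 1) * x = ((k : ℂ) + 1) • x := by
      intro R _ _ k x
      rw [Algebra.smul_def, map_add, map_natCast, map_one]
    exact h2 _ _
  · exact map_zero _

theorem coproduct_t20 : coproduct ε₁ ε₂ (t ε₁ ε₂ 2 0)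
    = HahnSeries.C (t ε₁ ε₂ 2 0 ⊗ₜ 1) + HahnSeries.C (1 ⊗ₜ t ε₁ ε₂ 2 0)
      + (2 * σ₃ ε₁ ε₂) • crossTerm ε₁ ε₂ := by
  refine ((crossData ε₁ ε₂).currentData.hom_t 2 0).trans ?_
  rw [CurrentData.T_two, CurrentData.r_zero, ← lrho_interaction]
  change lcur ε₁ ε₂ (inA ε₁ ε₂) 2 1 + lcur ε₁ ε₂ (inB ε₁ ε₂) 2 1 + _ = _
  rw [lcur_one, lcur_one]
  rfl

theorem isMeromorphicCoproduct_coproduct : IsMeromorphicCoproduct ε₁ ε₂ (coproduct ε₁ ε₂) where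
  map_t0 n := by
    rw [coproduct_t0, add_comm, shift_pow, map_sum]
    congr 1
    refine Finset.sum_congr rfl fun m _ => ?_
    rw [one_pow, mul_one, lcur, lmap_single, map_smul, LinearMap.comp_apply, cur_X_pow]
    rfl
  map_t20 := by rw [coproduct_t20, add_comm (HahnSeries.C _)]

theorem IsMeromorphicCoproduct.eq_coproduct {Δ : M2Algebra ε₁ ε₂ →ₐ[ℂ] Target ε₁ ε₂}
    (h : IsMeromorphicCoproduct ε₁ ε₂ Δ) : Δ = coproduct ε₁ ε₂ := by
  have h' := isMeromorphicCoproduct_coproduct ε₁ ε₂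
  refine algHom_ext (fun n => ?_) ?_
  · rw [h.map_t0, h'.map_t0]
  · rw [h.map_t20, h'.map_t20]

end M2Brane

namespace M2Brane

open LaurentSeries

variable (ε₁ ε₂ : ℂ)

/-! ### Counit and cocreation -/

/-- The map `c ⊗ Id`. -/
def counitLeft : M2Algebra ε₁ ε₂ ⊗[ℂ] M2Algebra ε₁ ε₂ →ₐ[ℂ] M2Algebra ε₁ ε₂ :=
  (Algebra.TensorProduct.lid ℂ (M2Algebra ε₁ ε₂)).toAlgHom.comp
    (Algebra.TensorProduct.map (augmentation ε₁ ε₂) (AlgHom.id ℂ _))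

/-- The map `Id ⊗ c`. -/
def counitRight : M2Algebra ε₁ ε₂ ⊗[ℂ] M2Algebra ε₁ ε₂ →ₐ[ℂ] M2Algebra ε₁ ε₂ :=
  (Algebra.TensorProduct.rid ℂ ℂ (M2Algebra ε₁ ε₂)).toAlgHom.comp
    (Algebra.TensorProduct.map (AlgHom.id ℂ _) (augmentation ε₁ ε₂))

theorem counitLeft_tmul (a b : M2Algebra ε₁ ε₂) :
    counitLeft ε₁ ε₂ (a ⊗ₜ b) = augmentation ε₁ ε₂ a • b := rfl

theorem counitRight_tmul (a b : M2Algebra ε₁ ε₂) :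
    counitRight ε₁ ε₂ (a ⊗ₜ b) = augmentation ε₁ ε₂ b • a := rfl

theorem lmapHom_crossTerm_eq_zero
    (φ : M2Algebra ε₁ ε₂ ⊗[ℂ] M2Algebra ε₁ ε₂ →ₐ[ℂ] M2Algebra ε₁ ε₂)
    (h : ∀ m n, φ (t ε₁ ε₂ 0 m ⊗ₜ t ε₁ ε₂ 0 n) = 0) : lmapHom φ (crossTerm ε₁ ε₂) = 0 := by
  ext n
  rw [lmapHom_coeff, crossTerm, single_mul_ofPowerSeries_coeff, PowerSeries.coeff_mk]
  split_ifs
  · rw [map_sum, HahnSeries.coeff_zero]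
    refine Finset.sum_eq_zero fun p _ => ?_
    rw [map_smul, h, smul_zero]
  · rw [map_zero, HahnSeries.coeff_zero]

theorem lmapHom_C {R S : Type*} [Ring R] [Algebra ℂ R] [Ring S] [Algebra ℂ S] (φ : R →ₐ[ℂ] S)
    (r : R) : lmapHom φ (HahnSeries.C r) = HahnSeries.C (φ r) := lmapHom_single φ 0 r

theorem lmapHom_counitLeft_coproduct (v : M2Algebra ε₁ ε₂) :
    lmapHom (counitLeft ε₁ ε₂) (coproduct ε₁ ε₂ v) = HahnSeries.C v := by
  have h := isMeromorphicCoproduct_coproduct ε₁ ε₂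
  induction v using generator_induction with
  | t0 n =>
    rw [h.map_t0, map_add, map_sum, lmapHom_C, counitLeft_tmul, map_one, one_smul,
      Finset.sum_eq_zero, add_zero]
    intro m _
    rw [lmapHom_single, map_smul, counitLeft_tmul, augmentation_t, zero_smul, smul_zero, map_zero]
  | t20 =>
    rw [h.map_t20, map_add, map_add, map_smul, lmapHom_crossTerm_eq_zero, smul_zero, add_zero,
      lmapHom_C, lmapHom_C, counitLeft_tmul, counitLeft_tmul, augmentation_t, zero_smul, map_zero,
      add_zero, map_one, one_smul]
    intro m n
    rw [counitLeft_tmul, augmentation_t, zero_smul]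
  | algebraMap r => rw [AlgHom.commutes, AlgHom.commutes]; rfl
  | add x y hx hy => rw [map_add, map_add, map_add, hx, hy]
  | mul x y hx hy => rw [map_mul, map_mul, map_mul, hx, hy]

/-- `F` is a polynomial in `w` with constant term `v`, for Laurent series in the variable `w⁻¹`. -/
structure IsPolynomialAt {R : Type*} [Ring R] (F : LaurentSeries R) (v : R) : Prop where
  coeff_pos : ∀ i : ℤ, 0 < i → F.coeff i = 0
  coeff_zero : F.coeff 0 = v

theorem IsPolynomialAt.add {R : Type*} [Ring R] {F G : LaurentSeries R} {v u : R}
    (hF : IsPolynomialAt F v) (hG : IsPolynomialAt G u) : IsPolynomialAt (F + G) (v + u) where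
  coeff_pos i hi := by simp [hF.coeff_pos i hi, hG.coeff_pos i hi]
  coeff_zero := by simp [hF.coeff_zero, hG.coeff_zero]

theorem IsPolynomialAt.mul {R : Type*} [Ring R] {F G : LaurentSeries R} {v u : R}
    (hF : IsPolynomialAt F v) (hG : IsPolynomialAt G u) : IsPolynomialAt (F * G) (v * u) := by
  obtain ⟨a, ha⟩ := exists_coeff_eq_zero F
  obtain ⟨b, hb⟩ := exists_coeff_eq_zero G
  refine ⟨fun i hi => ?_, ?_⟩
  · rw [coeff_mul_Icc F G a b i ha hb]
    refine Finset.sum_eq_zero fun j _ => ?_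
    rcases lt_or_ge 0 j with hj | hj
    · rw [hF.coeff_pos j hj, zero_mul]
    · rw [hG.coeff_pos (i - j) (by omega), mul_zero]
  · rw [coeff_mul_Icc F G a b 0 ha hb, Finset.sum_eq_single 0, sub_zero, hF.coeff_zero,
      hG.coeff_zero]
    · intro j _ hj
      rcases lt_or_gt_of_ne hj with hj | hj
      · rw [hG.coeff_pos (0 - j) (by omega), mul_zero]
      · rw [hF.coeff_pos j hj, zero_mul]
    · intro h0
      rw [Finset.mem_Icc, not_and_or] at h0
      rcases h0 with h0 | h0
      · rw [ha 0 (by omega), zero_mul]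
      · rw [hb (0 - 0) (by omega), mul_zero]

theorem isPolynomialAt_single {R : Type*} [Ring R] (n : ℤ) (hn : n < 0) (v : R) :
    IsPolynomialAt (HahnSeries.single n v) 0 where
  coeff_pos i hi := HahnSeries.coeff_single_of_ne (by omega)
  coeff_zero := HahnSeries.coeff_single_of_ne (by omega)

theorem isPolynomialAt_C {R : Type*} [Ring R] (v : R) : IsPolynomialAt (HahnSeries.C v) v where
  coeff_pos i hi := HahnSeries.coeff_single_of_ne (by omega)
  coeff_zero := HahnSeries.coeff_single_same _ _

theorem isPolynomialAt_coproduct (v : M2Algebra ε₁ ε₂) :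
    IsPolynomialAt (lmapHom (counitRight ε₁ ε₂) (coproduct ε₁ ε₂ v)) v := by
  have h := isMeromorphicCoproduct_coproduct ε₁ ε₂
  induction v using generator_induction with
  | t0 n =>
    rw [h.map_t0, map_add, map_sum, lmapHom_C, counitRight_tmul, augmentation_t, zero_smul,
      map_zero, zero_add, Finset.sum_range_succ, lmapHom_single, sub_self, neg_zero,
      Nat.choose_self, Nat.cast_one, one_smul, counitRight_tmul, map_one, one_smul]
    have hs : ∀ s ⊆ Finset.range n, IsPolynomialAt (∑ m ∈ s, lmapHom (counitRight ε₁ ε₂)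
        (HahnSeries.single (-((n : ℤ) - m)) ((n.choose m : ℂ) • (t ε₁ ε₂ 0 m ⊗ₜ[ℂ] 1)))) 0 := by
      intro s
      induction s using Finset.induction_on with
      | empty => intro _; exact ⟨fun _ _ => rfl, rfl⟩
      | insert m s hm ih =>
        intro hs
        rw [Finset.sum_insert hm, ← zero_add (0 : M2Algebra ε₁ ε₂)]
        have hmn := Finset.mem_range.1 (hs (Finset.mem_insert_self _ _))
        refine IsPolynomialAt.add ?_ (ih ((Finset.subset_insert _ _).trans hs))
        rw [lmapHom_single]
        exact isPolynomialAt_single _ (by omega) _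
    rw [← zero_add (t ε₁ ε₂ 0 n)]
    refine (hs _ subset_rfl).add ?_
    rw [zero_add]
    exact isPolynomialAt_C _
  | t20 =>
    rw [h.map_t20, map_add, map_add, map_smul, lmapHom_crossTerm_eq_zero, smul_zero, add_zero,
      lmapHom_C, lmapHom_C, counitRight_tmul, counitRight_tmul, augmentation_t, zero_smul, map_zero,
      zero_add, map_one, one_smul]
    · exact isPolynomialAt_C _
    · intro m n
      rw [counitRight_tmul, augmentation_t, zero_smul]
  | algebraMap r => rw [AlgHom.commutes, AlgHom.commutes]; exact isPolynomialAt_C _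
  | add x y hx hy => rw [map_add, map_add]; exact hx.add hy
  | mul x y hx hy => rw [map_mul, map_mul]; exact hx.mul hy

open VertexCoalg

theorem lid_coeffW (i : ℤ) (v : M2Algebra ε₁ ε₂) :
    TensorProduct.lid ℂ _ ((augmentation ε₁ ε₂).toLinearMap.rTensor _
      (coeffW (coproduct ε₁ ε₂).toLinearMap i v))
      = (lmapHom (counitLeft ε₁ ε₂) (coproduct ε₁ ε₂ v)).coeff (-i) := rfl

theorem rid_coeffW (i : ℤ) (v : M2Algebra ε₁ ε₂) :
    TensorProduct.rid ℂ _ ((augmentation ε₁ ε₂).toLinearMap.lTensor _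
      (coeffW (coproduct ε₁ ε₂).toLinearMap i v))
      = (lmapHom (counitRight ε₁ ε₂) (coproduct ε₁ ε₂ v)).coeff (-i) := rfl

theorem left_counit (v : M2Algebra ε₁ ε₂) (i : ℤ) :
    TensorProduct.lid ℂ _ ((augmentation ε₁ ε₂).toLinearMap.rTensor _
      (coeffW (coproduct ε₁ ε₂).toLinearMap i v)) = if i = 0 then v else 0 := by
  rw [lid_coeffW, lmapHom_counitLeft_coproduct, HahnSeries.C_apply, HahnSeries.coeff_single]
  simp

end M2Brane

open LaurentSeries

namespace VertexCoalg

/-! ### Binomial series -/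

/-- The binomial series `(1 - z) ^ b`. -/
def oneSubPow (b : ℤ) : LaurentSeries ℂ :=
  HahnSeries.ofPowerSeries ℤ ℂ (PowerSeries.mk fun m => deltaCoeff b m)

/-- The binomial series `(1 + z) ^ b`. -/
def oneAddPow (b : ℤ) : LaurentSeries ℂ :=
  HahnSeries.ofPowerSeries ℤ ℂ (PowerSeries.mk fun m => ((Ring.choose b m : ℤ) : ℂ))

theorem oneAddPow_eq (b : ℤ) :
    oneAddPow b = HahnSeries.ofPowerSeries ℤ ℂ (PowerSeries.binomialSeries ℂ b) := by
  rw [oneAddPow]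
  congr 1
  ext m
  simp [PowerSeries.binomialSeries_coeff]

theorem oneSubPow_eq (b : ℤ) : oneSubPow b = HahnSeries.ofPowerSeries ℤ ℂ
    (PowerSeries.rescale (-1) (PowerSeries.binomialSeries ℂ b)) := by
  rw [oneSubPow]
  congr 1
  ext m
  simp [PowerSeries.binomialSeries_coeff, deltaCoeff]

theorem oneAddPow_add (b c : ℤ) : oneAddPow (b + c) = oneAddPow b * oneAddPow c := by
  rw [oneAddPow_eq, oneAddPow_eq, oneAddPow_eq, PowerSeries.binomialSeries_add, map_mul]

theorem oneSubPow_add (b c : ℤ) : oneSubPow (b + c) = oneSubPow b * oneSubPow c := by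
  rw [oneSubPow_eq, oneSubPow_eq, oneSubPow_eq, PowerSeries.binomialSeries_add, map_mul, map_mul]

theorem oneAddPow_zero : oneAddPow 0 = 1 := by
  rw [oneAddPow_eq, PowerSeries.binomialSeries_zero, map_one]

theorem oneSubPow_zero : oneSubPow 0 = 1 := by
  rw [oneSubPow_eq, PowerSeries.binomialSeries_zero, map_one, map_one]

theorem ofPowerSeries_mk_coeff {R : Type*} [Ring R] (f : ℕ → R) (n : ℤ) :
    (HahnSeries.ofPowerSeries ℤ R (PowerSeries.mk f)).coeff n
      = if 0 ≤ n then f n.toNat else 0 := by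
  have := single_mul_ofPowerSeries_coeff 0 (PowerSeries.mk f) n
  rwa [HahnSeries.single_zero_one, one_mul, sub_zero, PowerSeries.coeff_mk] at this

theorem oneSubPow_coeff (b n : ℤ) :
    (oneSubPow b).coeff n = if 0 ≤ n then deltaCoeff b n.toNat else 0 :=
  ofPowerSeries_mk_coeff _ _

theorem oneAddPow_coeff (b n : ℤ) :
    (oneAddPow b).coeff n = if 0 ≤ n then ((Ring.choose b n.toNat : ℤ) : ℂ) else 0 :=
  ofPowerSeries_mk_coeff _ _

variable {S : Type*} [Ring S] [Algebra ℂ S]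

/-- Laurent series with scalar coefficients, as central elements. -/
def scal : LaurentSeries ℂ →ₐ[ℂ] LaurentSeries S := lmapHom (Algebra.ofId ℂ S)

theorem scal_mul_comm (e : LaurentSeries ℂ) (F : LaurentSeries S) : scal e * F = F * scal e := by
  obtain ⟨a, ha⟩ := exists_coeff_eq_zero (scal e : LaurentSeries S)
  obtain ⟨b, hb⟩ := exists_coeff_eq_zero F
  ext n
  rw [coeff_mul_Icc _ _ a b n ha hb, coeff_mul_Icc _ _ b a n hb ha]
  refine Finset.sum_nbij' (fun i => n - i) (fun i => n - i) ?_ ?_ ?_ ?_ ?_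
  · intro k hk; simp only [Finset.mem_Icc] at *; omega
  · intro k hk; simp only [Finset.mem_Icc] at *; omega
  · intro k _; ring
  · intro k _; ring
  · intro k _
    rw [sub_sub_cancel]
    exact Algebra.commutes _ _

theorem scal_mul_C_coeff (e : LaurentSeries ℂ) (s : S) (n : ℤ) :
    (scal e * HahnSeries.C s : LaurentSeries S).coeff n = e.coeff n • s := by
  rw [HahnSeries.C_apply, HahnSeries.coeff_mul_single_zero, Algebra.smul_def]
  rfl

theorem scal_mul_C_mul (e e' : LaurentSeries ℂ) (s s' : S) :
    (scal e * HahnSeries.C s) * (scal e' * HahnSeries.C s')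
      = (scal (e * e') * HahnSeries.C (s * s') : LaurentSeries S) := by
  rw [map_mul, map_mul, mul_assoc, ← mul_assoc (HahnSeries.C s), ← scal_mul_comm e', mul_assoc,
    mul_assoc]

theorem scal_ofPowerSeries_mul_coeff (f : ℕ → ℂ) (F : LaurentSeries S) (n : ℤ) :
    (scal (HahnSeries.ofPowerSeries ℤ ℂ (PowerSeries.mk f)) * F).coeff n
      = ∑ᶠ m : ℕ, f m • F.coeff (n - m) := by
  obtain ⟨b, hb⟩ := exists_coeff_eq_zero F
  have h : ∀ i, (scal (HahnSeries.ofPowerSeries ℤ ℂ (PowerSeries.mk f)) : LaurentSeries S).coeff i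
      = algebraMap ℂ S (if 0 ≤ i then f i.toNat else 0) := fun i =>
    congrArg (algebraMap ℂ S) (ofPowerSeries_mk_coeff f i)
  rw [coeff_mul_Icc _ _ 0 b n (fun i hi => by rw [h, if_neg (by omega), map_zero]) hb,
    finsum_eq_sum_of_support_subset (s := Finset.range (n - b + 1).toNat)]
  · refine Finset.sum_nbij' (fun i => i.toNat) (fun i => (i : ℤ)) ?_ ?_ ?_ ?_ ?_
    · intro k hk; simp only [Finset.mem_Icc, Finset.mem_range] at *; omega
    · intro k hk; simp only [Finset.mem_Icc, Finset.mem_range] at *; omega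
    · intro k hk; simp only [Finset.mem_Icc] at *; omega
    · intro k _; simp
    · intro k hk
      simp only [Finset.mem_Icc] at hk
      rw [h, if_pos hk.1, Algebra.smul_def, Int.toNat_of_nonneg hk.1]
  · intro m hm
    by_contra h0
    simp only [Finset.coe_range, Set.mem_Iio, not_lt] at h0
    exact hm (by simp only [hb (n - m) (by omega), smul_zero])

/-! ### Expansions of rational functions -/

/-- The three expansions of `s * w₁ ^ c * w₂ ^ a * (w₁ - w₂) ^ b`, up to a power of the larger
variable: in `z = w₂ / w₁`, in `z = w₁ / w₂`, and in `z = (w₁ - w₂) / w₂`. -/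
def expansion (a b c : ℤ) (s : S) : LaurentSeries S × LaurentSeries S × LaurentSeries S :=
  (scal (HahnSeries.single a 1 * oneSubPow b) * HahnSeries.C s,
    scal (HahnSeries.single c ((-1) ^ b) * oneSubPow b) * HahnSeries.C s,
    scal (HahnSeries.single b 1 * oneAddPow c) * HahnSeries.C s)

theorem expansion_mul (a b c a' b' c' : ℤ) (s s' : S) :
    expansion a b c s * expansion a' b' c' s' = expansion (a + a') (b + b') (c + c') (s * s') := by
  simp only [expansion, Prod.mk_mul_mk, scal_mul_C_mul]
  have h1 : ∀ (i j : ℤ) (x y : ℂ), (HahnSeries.single (i + j) (x * y) : LaurentSeries ℂ)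
      = HahnSeries.single i x * HahnSeries.single j y := fun i j x y =>
    HahnSeries.single_mul_single.symm
  have h2 : (-1 : ℂ) ^ (b + b') = (-1) ^ b * (-1) ^ b' := zpow_add₀ (by norm_num) _ _
  rw [oneSubPow_add, oneAddPow_add, h2, h1, ← mul_one (1 : ℂ), h1, h1, mul_one]
  congr 3
  · rw [mul_mul_mul_comm]
  · congr 1
    rw [mul_mul_mul_comm]
  · rw [mul_mul_mul_comm]

variable (S) in
/-- The span of the expansions of the homogeneous rational functions of degree `N`. -/
def expansions (N : ℤ) : Submodule ℂ (LaurentSeries S × LaurentSeries S × LaurentSeries S) :=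
  Submodule.span ℂ {x | ∃ (a b c : ℤ) (s : S), a + b + c = N ∧ x = expansion a b c s}

theorem expansion_mem {a b c N : ℤ} (s : S) (h : a + b + c = N) :
    expansion a b c s ∈ expansions S N :=
  Submodule.subset_span ⟨a, b, c, s, h, rfl⟩

theorem mul_mem_expansions {N N' : ℤ} {x y : LaurentSeries S × LaurentSeries S × LaurentSeries S}
    (hx : x ∈ expansions S N) (hy : y ∈ expansions S N') : x * y ∈ expansions S (N + N') := by
  have h := Submodule.mul_mem_mul hx hy
  rw [expansions, expansions, Submodule.span_mul_span] at h
  refine Submodule.span_mono ?_ h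
  rintro _ ⟨_, ⟨a, b, c, s, h, rfl⟩, _, ⟨a', b', c', s', h', rfl⟩, rfl⟩
  exact ⟨a + a', b + b', c + c', s * s', by omega, expansion_mul _ _ _ _ _ _ _ _⟩

theorem expansion_zero (r : ℂ) : expansion 0 0 0 (algebraMap ℂ S r) = algebraMap ℂ _ r := by
  rw [expansion, oneSubPow_zero, oneAddPow_zero, zpow_zero, HahnSeries.single_zero_one, mul_one,
    map_one, one_mul]
  rfl

/-! ### The Jacobi identity for expansions -/

theorem choose_neg_succ (a k : ℕ) :
    ((Ring.choose (-(a : ℤ) - 1) k : ℤ) : ℂ) = (-1) ^ k * ((a + k).choose k : ℂ) := by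
  have h := Ring.choose_neg ((a : ℤ) + 1) k
  have e : (a : ℤ) + 1 + k - 1 = ((a + k : ℕ) : ℤ) := by push_cast; ring
  rw [neg_add, ← sub_eq_add_neg, e, Ring.choose_natCast, Units.smul_def,
    Int.coe_negOnePow_natCast] at h
  rw [h]
  simp

theorem deltaCoeff_neg_succ (a k : ℕ) : deltaCoeff (-(a : ℤ) - 1) k = ((a + k).choose k : ℂ) := by
  rw [deltaCoeff, choose_neg_succ, ← mul_assoc, ← mul_pow]
  norm_num

theorem deltaCoeff_natCast (a k : ℕ) : deltaCoeff a k = (-1) ^ k * (a.choose k : ℂ) := by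
  rw [deltaCoeff, Ring.choose_natCast]
  simp

/-- The coefficients of the delta function identity
`z⁻¹ δ((x - y) / z) - z⁻¹ δ((y - x) / -z) = y⁻¹ δ((x - z) / y)`. -/
theorem delta_identity (p q r : ℤ) (h : p + q + r = -1) :
    (if 0 ≤ p then deltaCoeff (-r - 1) p.toNat else 0)
      - (-1) ^ (-r - 1) * (if 0 ≤ q then deltaCoeff (-r - 1) q.toNat else 0)
      = if 0 ≤ r then ((Ring.choose (-q - 1) r.toNat : ℤ) : ℂ) else 0 := by
  rcases lt_or_ge r 0 with hr | hr
  · obtain ⟨n, hn⟩ := Int.eq_ofNat_of_zero_le (show 0 ≤ -r - 1 by omega)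
    rw [hn, if_neg (not_le.2 hr), zpow_natCast]
    rcases lt_or_ge p 0 with hp | hp
    · obtain ⟨k, rfl⟩ := Int.eq_ofNat_of_zero_le (show 0 ≤ q by omega)
      rw [if_neg (not_le.2 hp), if_pos (by omega), Int.toNat_natCast, deltaCoeff_natCast,
        Nat.choose_eq_zero_of_lt (by omega)]
      simp
    obtain ⟨k, rfl⟩ := Int.eq_ofNat_of_zero_le hp
    rw [if_pos hp, Int.toNat_natCast, deltaCoeff_natCast]
    rcases lt_or_ge q 0 with hq | hq
    · rw [if_neg (not_le.2 hq), Nat.choose_eq_zero_of_lt (by omega)]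
      simp
    · obtain ⟨j, rfl⟩ := Int.eq_ofNat_of_zero_le hq
      obtain rfl : n = k + j := by omega
      rw [if_pos hq, Int.toNat_natCast, deltaCoeff_natCast, Nat.choose_symm_add, ← mul_assoc,
        ← pow_add, show k + j + j = k + 2 * j by ring, pow_add _ k, pow_mul]
      norm_num
  · obtain ⟨a, rfl⟩ := Int.eq_ofNat_of_zero_le hr
    rw [if_pos hr, Int.toNat_natCast]
    rcases lt_or_ge p 0 with hp | hp
    · rw [if_neg (not_le.2 hp)]
      rcases lt_or_ge q 0 with hq | hq
      · obtain ⟨n, hn⟩ := Int.eq_ofNat_of_zero_le (show 0 ≤ -q - 1 by omega)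
        rw [if_neg (not_le.2 hq), hn, Ring.choose_natCast, Nat.choose_eq_zero_of_lt (by omega)]
        simp
      · obtain ⟨j, rfl⟩ := Int.eq_ofNat_of_zero_le hq
        have hs : (-1 : ℂ) ^ (-(a : ℤ) - 1) = -(-1) ^ a := by
          rw [zpow_sub₀ (by norm_num), zpow_neg, zpow_natCast, zpow_one, ← inv_pow]
          norm_num [div_neg]
        rw [if_pos hq, Int.toNat_natCast, deltaCoeff_neg_succ, choose_neg_succ, hs,
          add_comm j a, Nat.choose_symm_add]
        ring
    · obtain ⟨k, rfl⟩ := Int.eq_ofNat_of_zero_le hp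
      rw [if_pos hp, if_neg (by omega), Int.toNat_natCast, deltaCoeff_neg_succ,
        show -q - 1 = ((a + k : ℕ) : ℤ) by push_cast; omega, Ring.choose_natCast,
        ← Nat.choose_symm_add]
      simp

theorem jacobi_expansions {a b d N : ℤ} (hN : a + b + d + 1 = N)
    {x : LaurentSeries S × LaurentSeries S × LaurentSeries S} (hx : x ∈ expansions S N) :
    (scal (oneSubPow (-a - 1)) * x.1).coeff d
      - ((-1 : ℂ) ^ (-a - 1)) • (scal (oneSubPow (-a - 1)) * x.2.1).coeff b
      = (scal (oneAddPow (-b - 1)) * x.2.2).coeff a := by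
  induction hx using Submodule.span_induction with
  | mem x hx =>
    obtain ⟨a', b', c', s, h, rfl⟩ := hx
    have h1 : (oneSubPow (-a - 1) * (HahnSeries.single a' 1 * oneSubPow b')).coeff d
        = if 0 ≤ d - a' then deltaCoeff (-(a - b') - 1) (d - a').toNat else 0 := by
      rw [mul_left_comm, ← oneSubPow_add, HahnSeries.coeff_single_mul, one_mul, oneSubPow_coeff,
        show -a - 1 + b' = -(a - b') - 1 by ring]
    have h2 : (oneSubPow (-a - 1) * (HahnSeries.single c' ((-1) ^ b') * oneSubPow b')).coeff b
        = (-1) ^ b' * if 0 ≤ b - c' then deltaCoeff (-(a - b') - 1) (b - c').toNat else 0 := by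
      rw [mul_left_comm, ← oneSubPow_add, HahnSeries.coeff_single_mul, oneSubPow_coeff,
        show -a - 1 + b' = -(a - b') - 1 by ring]
    have h3 : (oneAddPow (-b - 1) * (HahnSeries.single b' 1 * oneAddPow c')).coeff a
        = if 0 ≤ a - b' then ((Ring.choose (-(b - c') - 1) (a - b').toNat : ℤ) : ℂ) else 0 := by
      rw [mul_left_comm, ← oneAddPow_add, HahnSeries.coeff_single_mul, one_mul, oneAddPow_coeff,
        show -b - 1 + c' = -(b - c') - 1 by ring]
    have h4 : ∀ e e' : LaurentSeries ℂ, scal e * (scal e' * HahnSeries.C s)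
        = (scal (e * e') * HahnSeries.C s : LaurentSeries S) := fun e e' => by
      rw [map_mul, mul_assoc]
    simp only [expansion, h4, scal_mul_C_coeff]
    rw [h1, h2, h3, smul_smul, ← sub_smul,
      ← delta_identity _ _ _ (show d - a' + (b - c') + (a - b') = -1 by omega), ← mul_assoc,
      ← zpow_add₀ (by norm_num), show -a - 1 + b' = -(a - b') - 1 by ring]
  | zero => simp
  | add x y _ _ hx hy =>
    simp only [Prod.fst_add, Prod.snd_add, mul_add, HahnSeries.coeff_add, smul_add, ← hx, ← hy]
    abel
  | smul c x _ hx =>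
    simp only [Prod.smul_fst, Prod.smul_snd, mul_smul_comm, HahnSeries.coeff_smul]
    rw [smul_comm _ c, ← smul_sub, hx]

end VertexCoalg

open LaurentSeries

/-! ### Iterated Laurent series, sorted by total degree -/

namespace LaurentSeries

/-- The coefficients of a product, as sums over any finite set of shifted exponents which contains
all nonzero terms. -/
theorem coeff_mul_sub {R : Type*} [Ring R] (F G : LaurentSeries R) (n c : ℤ) (s : Finset ℤ)
    (h : ∀ i, i ∉ s → F.coeff (i - c) * G.coeff (n - (i - c)) = 0) :
    (F * G).coeff n = ∑ i ∈ s, F.coeff (i - c) * G.coeff (n - (i - c)) := by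
  obtain ⟨a, ha⟩ := exists_coeff_eq_zero F
  obtain ⟨b, hb⟩ := exists_coeff_eq_zero G
  have h1 : (F * G).coeff n = ∑ i ∈ Finset.Icc (a + c) (n - b + c),
      F.coeff (i - c) * G.coeff (n - (i - c)) := by
    rw [coeff_mul_Icc F G a b n ha hb]
    refine Finset.sum_nbij' (fun i => i + c) (fun i => i - c) ?_ ?_ ?_ ?_ ?_
    · intro k hk; simp only [Finset.mem_Icc] at *; omega
    · intro k hk; simp only [Finset.mem_Icc] at *; omega
    · intro k _; ring
    · intro k _; ring
    · intro k _; rw [add_sub_cancel_right]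
  rw [h1]
  have h2 : ∀ i, i ∉ Finset.Icc (a + c) (n - b + c) →
      F.coeff (i - c) * G.coeff (n - (i - c)) = 0 := by
    intro i hi
    rw [Finset.mem_Icc, not_and_or] at hi
    rcases hi with hi | hi
    · rw [ha _ (by omega), zero_mul]
    · rw [hb _ (by omega), mul_zero]
  rw [Finset.sum_subset (Finset.subset_union_left (s₂ := s)) fun i _ hi => h2 i hi,
    ← Finset.sum_subset (Finset.subset_union_right (s₁ := Finset.Icc (a + c) (n - b + c)))
      fun i _ hi => h i hi]

end LaurentSeries

namespace VertexCoalg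

variable {S : Type*} [Ring S]

/-- `H` is the iterated Laurent series in `w⁻¹` (outer) and `v⁻¹` (inner variable), and `Θ` is the
same series, written as a series in `w⁻¹` whose coefficients are series in `v / w`. -/
def Regroups (H Θ : LaurentSeries (LaurentSeries S)) : Prop :=
  ∀ n p : ℤ, (H.coeff n).coeff p = (Θ.coeff (n + p)).coeff (-p)

theorem Regroups.add {H H' Θ Θ' : LaurentSeries (LaurentSeries S)} (h : Regroups H Θ)
    (h' : Regroups H' Θ') : Regroups (H + H') (Θ + Θ') := fun n p => by
  simp only [HahnSeries.coeff_add, h n p, h' n p]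

theorem Regroups.mul {H H' Θ Θ' : LaurentSeries (LaurentSeries S)} (h : Regroups H Θ)
    (h' : Regroups H' Θ') : Regroups (H * H') (Θ * Θ') := fun n p => by
  obtain ⟨a, ha⟩ := exists_coeff_eq_zero H
  obtain ⟨b, hb⟩ := exists_coeff_eq_zero H'
  obtain ⟨α, hα⟩ := exists_coeff_eq_zero Θ
  obtain ⟨β, hβ⟩ := exists_coeff_eq_zero Θ'
  have e : ∀ i j, (H.coeff i).coeff (j - i) * (H'.coeff (n - i)).coeff (p - (j - i))
      = (Θ.coeff j).coeff (i - j) * (Θ'.coeff (n + p - j)).coeff (-p - (i - j)) := by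
    intro i j
    rw [h, h', show i + (j - i) = j by ring, show n - i + (p - (j - i)) = n + p - j by ring,
      show -(j - i) = i - j by ring, show -(p - (j - i)) = -p - (i - j) by ring]
  -- Both sides are sums over the same pairs `(i, j)`, the degree in the outer variable and the total
  -- degree of the first factor.
  rw [coeff_mul_Icc H H' a b n ha hb, coeff_mul_Icc Θ Θ' α β (n + p) hα hβ]
  simp only [HahnSeries.coeff_sum]
  have h1 : ∀ i ∈ Finset.Icc a (n - b), (H.coeff i * H'.coeff (n - i)).coeff p
      = ∑ j ∈ Finset.Icc α (n + p - β),
        (H.coeff i).coeff (j - i) * (H'.coeff (n - i)).coeff (p - (j - i)) := by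
    intro i _
    refine coeff_mul_sub _ _ _ _ _ fun j hj => ?_
    rw [e]
    rw [Finset.mem_Icc, not_and_or] at hj
    rcases hj with hj | hj
    · rw [hα _ (by omega), HahnSeries.coeff_zero, zero_mul]
    · rw [hβ _ (by omega), HahnSeries.coeff_zero, mul_zero]
  have h2 : ∀ j ∈ Finset.Icc α (n + p - β), (Θ.coeff j * Θ'.coeff (n + p - j)).coeff (-p)
      = ∑ i ∈ Finset.Icc a (n - b),
        (Θ.coeff j).coeff (i - j) * (Θ'.coeff (n + p - j)).coeff (-p - (i - j)) := by
    intro j _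
    refine coeff_mul_sub _ _ _ _ _ fun i hi => ?_
    rw [← e]
    rw [Finset.mem_Icc, not_and_or] at hi
    rcases hi with hi | hi
    · rw [ha _ (by omega), HahnSeries.coeff_zero, zero_mul]
    · rw [hb _ (by omega), HahnSeries.coeff_zero, mul_zero]
  rw [Finset.sum_congr rfl h1, Finset.sum_congr rfl h2, Finset.sum_comm]
  exact Finset.sum_congr rfl fun j _ => Finset.sum_congr rfl fun i _ => e i j

variable [Algebra ℂ S]

theorem regroups_algebraMap (r : ℂ) : Regroups (S := S) (algebraMap ℂ _ r) (algebraMap ℂ _ r) := by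
  intro n p
  have h : ∀ n p : ℤ, ((algebraMap ℂ (LaurentSeries (LaurentSeries S)) r).coeff n).coeff p
      = if n = 0 ∧ p = 0 then algebraMap ℂ S r else 0 := by
    intro n p
    change ((HahnSeries.single 0 (HahnSeries.single 0 (algebraMap ℂ S r)) :
      LaurentSeries (LaurentSeries S)).coeff n).coeff p = _
    rw [HahnSeries.coeff_single]
    split_ifs with h1 h2 h2
    · rw [h2.2, HahnSeries.coeff_single_same]
    · rw [HahnSeries.coeff_single_of_ne (by tauto)]
    · exact absurd h2.1 h1
    · rfl
  rw [h, h]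
  congr 1
  exact propext ⟨fun h => by omega, fun h => by omega⟩

/-- The first projection of a triple product. -/
abbrev proj₁ (T : Type*) [Ring T] [Algebra ℂ T] : T × T × T →ₐ[ℂ] T := AlgHom.fst ℂ T (T × T)

/-- The second projection of a triple product. -/
abbrev proj₂ (T : Type*) [Ring T] [Algebra ℂ T] : T × T × T →ₐ[ℂ] T :=
  (AlgHom.fst ℂ T T).comp (AlgHom.snd ℂ T (T × T))

/-- The third projection of a triple product. -/
abbrev proj₃ (T : Type*) [Ring T] [Algebra ℂ T] : T × T × T →ₐ[ℂ] T :=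
  (AlgHom.snd ℂ T T).comp (AlgHom.snd ℂ T (T × T))

variable (S) in
/-- The triples of iterated Laurent series which are the three expansions of one element of
`S ⊗ ℂ[w₁ ^ ±1, w₂ ^ ±1, (w₁ - w₂) ^ ±1]`, completed with respect to the degree: the first one in
`w₂ / w₁` (outer variable `w₁`), the second one in `w₁ / w₂` (outer variable `w₂`), the third one in
`w₀ / w₂` for `w₀ = w₁ - w₂` (outer variable `w₂`). -/
def commonExpansions : Subalgebra ℂ (LaurentSeries (LaurentSeries S)
    × LaurentSeries (LaurentSeries S) × LaurentSeries (LaurentSeries S)) where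
  carrier := {H | ∃ Θ : LaurentSeries (LaurentSeries S × LaurentSeries S × LaurentSeries S),
    (∀ n, Θ.coeff n ∈ expansions S (-n)) ∧ Regroups H.1 (lmapHom (proj₁ _) Θ)
      ∧ Regroups H.2.1 (lmapHom (proj₂ _) Θ) ∧ Regroups H.2.2 (lmapHom (proj₃ _) Θ)}
  algebraMap_mem' r := by
    refine ⟨algebraMap ℂ _ r, fun n => ?_, ?_, ?_, ?_⟩
    · change (HahnSeries.single 0 (algebraMap ℂ _ r) : LaurentSeries
        (LaurentSeries S × LaurentSeries S × LaurentSeries S)).coeff n ∈ _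
      rw [HahnSeries.coeff_single]
      split_ifs with h
      · rw [← expansion_zero]
        exact expansion_mem _ (by omega)
      · exact Submodule.zero_mem _
    all_goals
      rw [AlgHom.commutes]
      exact regroups_algebraMap r
  add_mem' := by
    rintro H H' ⟨Θ, h0, h1, h2, h3⟩ ⟨Θ', h0', h1', h2', h3'⟩
    refine ⟨Θ + Θ', fun n => ?_, ?_, ?_, ?_⟩
    · rw [HahnSeries.coeff_add]
      exact Submodule.add_mem _ (h0 n) (h0' n)
    · rw [map_add]; exact h1.add h1'
    · rw [map_add]; exact h2.add h2'
    · rw [map_add]; exact h3.add h3'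
  mul_mem' := by
    rintro H H' ⟨Θ, h0, h1, h2, h3⟩ ⟨Θ', h0', h1', h2', h3'⟩
    refine ⟨Θ * Θ', fun n => ?_, ?_, ?_, ?_⟩
    · obtain ⟨a, ha⟩ := exists_coeff_eq_zero Θ
      obtain ⟨b, hb⟩ := exists_coeff_eq_zero Θ'
      rw [coeff_mul_Icc Θ Θ' a b n ha hb]
      refine Submodule.sum_mem _ fun i _ => ?_
      rw [show -n = -i + -(n - i) by ring]
      exact mul_mem_expansions (h0 i) (h0' _)
    · rw [map_mul]; exact h1.mul h1'
    · rw [map_mul]; exact h2.mul h2'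
    · rw [map_mul]; exact h3.mul h3'

theorem deltaCoeff_zero_ite (k : ℤ) :
    (if 0 ≤ k then deltaCoeff 0 k.toNat else 0) = if k = 0 then (1 : ℂ) else 0 := by
  rw [← oneSubPow_coeff, oneSubPow_zero, HahnSeries.coeff_one]
  split_ifs <;> rfl

theorem choose_zero_ite (k : ℤ) :
    (if 0 ≤ k then ((Ring.choose (0 : ℤ) k.toNat : ℤ) : ℂ) else 0)
      = if k = 0 then (1 : ℂ) else 0 := by
  rw [← oneAddPow_coeff, oneAddPow_zero, HahnSeries.coeff_one]
  split_ifs <;> rfl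

theorem expansion_fst_coeff (a b c k : ℤ) (s : S) : (expansion a b c s).1.coeff k
    = (if 0 ≤ k - a then deltaCoeff b (k - a).toNat else 0) • s := by
  rw [expansion, scal_mul_C_coeff, HahnSeries.coeff_single_mul, one_mul, oneSubPow_coeff]

theorem expansion_snd_fst_coeff (a b c k : ℤ) (s : S) : (expansion a b c s).2.1.coeff k
    = ((-1) ^ b * if 0 ≤ k - c then deltaCoeff b (k - c).toNat else 0) • s := by
  rw [expansion, scal_mul_C_coeff, HahnSeries.coeff_single_mul, oneSubPow_coeff]

theorem expansion_snd_snd_coeff (a b c k : ℤ) (s : S) : (expansion a b c s).2.2.coeff k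
    = (if 0 ≤ k - b then ((Ring.choose c (k - b).toNat : ℤ) : ℂ) else 0) • s := by
  rw [expansion, scal_mul_C_coeff, HahnSeries.coeff_single_mul, one_mul, oneAddPow_coeff]

/-- The expansions of a sum `μ₁(w₁) + μ₂(w₂) + μ₀(w₁ - w₂)` of Laurent series in the inverses of the
variables. -/
theorem mem_commonExpansions (μ₁ μ₂ μ₀ : LaurentSeries S)
    {H₁ H₂ H₃ : LaurentSeries (LaurentSeries S)}
    (h₁ : ∀ n p : ℤ, (H₁.coeff n).coeff p = (if p = 0 then μ₁.coeff n else 0)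
      + (if n = 0 then μ₂.coeff p else 0)
      + (if 0 ≤ -p then deltaCoeff (-(n + p)) (-p).toNat else 0) • μ₀.coeff (n + p))
    (h₂ : ∀ n p : ℤ, (H₂.coeff n).coeff p = (if n = 0 then μ₁.coeff p else 0)
      + (if p = 0 then μ₂.coeff n else 0)
      + ((-1 : ℂ) ^ (n + p) * if 0 ≤ -p then deltaCoeff (-(n + p)) (-p).toNat else 0)
        • μ₀.coeff (n + p))
    (h₃ : ∀ n p : ℤ, (H₃.coeff n).coeff p
      = (if 0 ≤ -p then ((Ring.choose (-(n + p)) (-p).toNat : ℤ) : ℂ) else 0) • μ₁.coeff (n + p)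
      + (if p = 0 then μ₂.coeff n else 0) + (if n = 0 then μ₀.coeff p else 0)) :
    (H₁, H₂, H₃) ∈ commonExpansions S := by
  obtain ⟨a, ha⟩ := exists_coeff_eq_zero μ₁
  obtain ⟨b, hb⟩ := exists_coeff_eq_zero μ₂
  obtain ⟨c, hc⟩ := exists_coeff_eq_zero μ₀
  let θ : ℤ → LaurentSeries S × LaurentSeries S × LaurentSeries S := fun n =>
    expansion 0 0 (-n) (μ₁.coeff n) + expansion (-n) 0 0 (μ₂.coeff n)
      + expansion 0 (-n) 0 (μ₀.coeff n)
  have hz : ∀ i j k : ℤ, expansion i j k (0 : S) = 0 := fun i j k => by simp [expansion]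
  have hθ : BddBelow (Function.support θ) := ⟨min a (min b c), fun i hi => by
    by_contra hlt
    refine hi ?_
    simp only [θ]
    rw [ha i (by omega), hb i (by omega), hc i (by omega), hz, hz, hz, add_zero, add_zero]⟩
  refine ⟨HahnSeries.ofSuppBddBelow θ hθ, fun n => ?_, ?_, ?_, ?_⟩
  · exact Submodule.add_mem _ (Submodule.add_mem _ (expansion_mem _ (by omega))
      (expansion_mem _ (by omega))) (expansion_mem _ (by omega))
  · intro n p
    rw [h₁]
    change _ = (expansion 0 0 (-(n + p)) (μ₁.coeff (n + p))).1.coeff (-p)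
      + (expansion (-(n + p)) 0 0 (μ₂.coeff (n + p))).1.coeff (-p)
      + (expansion 0 (-(n + p)) 0 (μ₀.coeff (n + p))).1.coeff (-p)
    simp only [expansion_fst_coeff, deltaCoeff_zero_ite, sub_zero, ite_smul, one_smul, zero_smul,
      neg_eq_zero, sub_neg_eq_add, neg_add_cancel_comm_assoc]
    congr 2
    · split_ifs with hp
      · rw [hp, add_zero]
      · rfl
    · split_ifs with hp
      · rw [hp, zero_add]
      · rfl
  · intro n p
    rw [h₂]
    change _ = (expansion 0 0 (-(n + p)) (μ₁.coeff (n + p))).2.1.coeff (-p)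
      + (expansion (-(n + p)) 0 0 (μ₂.coeff (n + p))).2.1.coeff (-p)
      + (expansion 0 (-(n + p)) 0 (μ₀.coeff (n + p))).2.1.coeff (-p)
    have hs : (-1 : ℂ) ^ (-(n + p)) = (-1) ^ (n + p) := by
      rw [zpow_neg, ← inv_zpow]
      norm_num
    simp only [expansion_snd_fst_coeff, deltaCoeff_zero_ite, sub_zero, zpow_zero, one_mul, ite_smul,
      one_smul, zero_smul, neg_eq_zero, sub_neg_eq_add, neg_add_cancel_comm_assoc, hs]
    congr 2
    · split_ifs with hp
      · rw [hp, zero_add]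
      · rfl
    · split_ifs with hp
      · rw [hp, add_zero]
      · rfl
  · intro n p
    rw [h₃]
    change _ = (expansion 0 0 (-(n + p)) (μ₁.coeff (n + p))).2.2.coeff (-p)
      + (expansion (-(n + p)) 0 0 (μ₂.coeff (n + p))).2.2.coeff (-p)
      + (expansion 0 (-(n + p)) 0 (μ₀.coeff (n + p))).2.2.coeff (-p)
    simp only [expansion_snd_snd_coeff, choose_zero_ite, sub_zero, ite_smul,
      one_smul, zero_smul, neg_eq_zero, sub_neg_eq_add, neg_add_cancel_comm_assoc]
    congr 1
    · congr 1
      split_ifs with hp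
      · rw [hp, add_zero]
      · rfl
    · split_ifs with hp
      · rw [hp, zero_add]
      · rfl

/-- The Jacobi identity, written in terms of the coefficients of the iterated series. -/
theorem jacobi_of_mem_commonExpansions {H₁ H₂ H₃ : LaurentSeries (LaurentSeries S)}
    (h : (H₁, H₂, H₃) ∈ commonExpansions S) (a b d : ℤ) :
    (∑ᶠ m : ℕ, deltaCoeff (-a - 1) m • (H₁.coeff (-(b - (-a - 1 - m)))).coeff (-(d - m)))
      - (∑ᶠ m : ℕ, ((-1 : ℂ) ^ (-a - 1) * deltaCoeff (-a - 1) m) •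
          (H₂.coeff (-(d - (-a - 1 - m)))).coeff (-(b - m)))
      = ∑ᶠ m : ℕ, deltaCoeff (b + m) m • (H₃.coeff (-(d + 1 + (b + m)))).coeff (-(a - m)) := by
  obtain ⟨Θ, h0, h1, h2, h3⟩ := h
  have hx := h0 (-(a + b + d + 1))
  rw [neg_neg] at hx
  have hj := jacobi_expansions rfl hx
  rw [oneSubPow, oneAddPow, scal_ofPowerSeries_mul_coeff, scal_ofPowerSeries_mul_coeff,
    scal_ofPowerSeries_mul_coeff, smul_finsum] at hj
  have e1 : ∀ m : ℕ, (H₁.coeff (-(b - (-a - 1 - m)))).coeff (-(d - m))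
      = (Θ.coeff (-(a + b + d + 1))).1.coeff (d - m) := fun m => by
    rw [h1, neg_neg, show -(b - (-a - 1 - (m : ℤ))) + -(d - m) = -(a + b + d + 1) by ring]
    rfl
  have e2 : ∀ m : ℕ, (H₂.coeff (-(d - (-a - 1 - m)))).coeff (-(b - m))
      = (Θ.coeff (-(a + b + d + 1))).2.1.coeff (b - m) := fun m => by
    rw [h2, neg_neg, show -(d - (-a - 1 - (m : ℤ))) + -(b - m) = -(a + b + d + 1) by ring]
    rfl
  have e3 : ∀ m : ℕ, (H₃.coeff (-(d + 1 + (b + m)))).coeff (-(a - m))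
      = (Θ.coeff (-(a + b + d + 1))).2.2.coeff (a - m) := fun m => by
    rw [h3, neg_neg, show -(d + 1 + (b + (m : ℤ))) + -(a - m) = -(a + b + d + 1) by ring]
    rfl
  have e4 : ∀ m : ℕ, deltaCoeff (b + m) m = ((Ring.choose (-b - 1) m : ℤ) : ℂ) := fun m => by
    have := Ring.choose_neg (b + 1) m
    rw [neg_add, ← sub_eq_add_neg, show b + 1 + m - 1 = b + m by ring, Units.smul_def,
      Int.coe_negOnePow_natCast] at this
    rw [this, deltaCoeff]
    simp
  simp only [e1, e2, e3, e4, mul_smul]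
  exact hj

end VertexCoalg

open LaurentSeries

namespace VertexCoalg

/-! ### Multiplicative coproducts -/

section

variable {A : Type*} [Ring A] [Algebra ℂ A]

/-- Constant Laurent series. -/
def constHom (R : Type*) [Ring R] [Algebra ℂ R] : R →ₐ[ℂ] LaurentSeries R :=
  { (HahnSeries.C : R →+* LaurentSeries R) with commutes' := fun _ => rfl }

variable (A) in
/-- The tensor cube of `A`, as a definition of its own, so that instances are found without
unfolding the tensor products. -/
def TensorCube : Type _ := A ⊗[ℂ] (A ⊗[ℂ] A)

instance : Ring (TensorCube A) := inferInstanceAs (Ring (A ⊗[ℂ] (A ⊗[ℂ] A)))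

instance : Algebra ℂ (TensorCube A) := inferInstanceAs (Algebra ℂ (A ⊗[ℂ] (A ⊗[ℂ] A)))

/-- Pure tensors. -/
def tmul₃ (a b c : A) : TensorCube A := a ⊗ₜ[ℂ] (b ⊗ₜ[ℂ] c)

theorem tmul₃_mul (a b c a' b' c' : A) :
    tmul₃ a b c * tmul₃ a' b' c' = tmul₃ (a * a') (b * b') (c * c') := by
  refine (Algebra.TensorProduct.tmul_mul_tmul _ _ _ _).trans ?_
  rw [Algebra.TensorProduct.tmul_mul_tmul]
  rfl

theorem TensorCube.induction {P : TensorCube A → Prop} (h0 : P 0)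
    (hadd : ∀ x y, P x → P y → P (x + y)) (h : ∀ a b c, P (tmul₃ a b c)) (x : TensorCube A) :
    P x := by
  refine TensorProduct.induction_on (motive := P) x h0 (fun a x => ?_) hadd
  induction x using TensorProduct.induction_on with
  | zero =>
    have : (a ⊗ₜ[ℂ] (0 : A ⊗[ℂ] A)) = 0 := TensorProduct.tmul_zero _ _
    rw [this]
    exact h0
  | add x y hx hy =>
    rw [TensorProduct.tmul_add]
    exact hadd _ _ hx hy
  | tmul b c => exact h a b c

/-- The map `a ⊗ b ↦ a ⊗ b ⊗ 1`. -/
def in₁₂ : A ⊗[ℂ] A →ₐ[ℂ] TensorCube A :=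
  Algebra.TensorProduct.map (AlgHom.id ℂ A) Algebra.TensorProduct.includeLeft

/-- The map `a ⊗ b ↦ a ⊗ 1 ⊗ b`. -/
def in₁₃ : A ⊗[ℂ] A →ₐ[ℂ] TensorCube A :=
  Algebra.TensorProduct.map (AlgHom.id ℂ A) Algebra.TensorProduct.includeRight

/-- The map `a ⊗ b ↦ 1 ⊗ a ⊗ b`. -/
def in₂₃ : A ⊗[ℂ] A →ₐ[ℂ] TensorCube A := Algebra.TensorProduct.includeRight

/-- The inclusion of the first factor. -/
def only₁ : A →ₐ[ℂ] TensorCube A := Algebra.TensorProduct.includeLeft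

/-- The inclusion of the second factor. -/
def only₂ : A →ₐ[ℂ] TensorCube A := in₂₃.comp Algebra.TensorProduct.includeLeft

/-- The inclusion of the third factor. -/
def only₃ : A →ₐ[ℂ] TensorCube A := in₂₃.comp Algebra.TensorProduct.includeRight

theorem in₁₂_tmul (a b : A) : in₁₂ (a ⊗ₜ[ℂ] b) = tmul₃ a b 1 := rfl

theorem in₁₃_tmul (a b : A) : in₁₃ (a ⊗ₜ[ℂ] b) = tmul₃ a 1 b := rfl

theorem in₂₃_tmul (a b : A) : in₂₃ (a ⊗ₜ[ℂ] b) = tmul₃ 1 a b := rfl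

theorem only₁_apply (a : A) : only₁ a = tmul₃ a 1 1 := rfl

theorem only₂_apply (a : A) : only₂ a = tmul₃ 1 a 1 := rfl

theorem only₃_apply (a : A) : only₃ a = tmul₃ 1 1 a := rfl

theorem commute_C {R : Type*} [Ring R] {s : R} {F : LaurentSeries R}
    (h : ∀ n, Commute s (F.coeff n)) : Commute (HahnSeries.C s) F := by
  ext n
  rw [HahnSeries.C_apply, HahnSeries.coeff_single_zero_mul, HahnSeries.coeff_mul_single_zero]
  exact h n

theorem commute_only₁ (a : A) (x : A ⊗[ℂ] A) : Commute (only₁ a) (in₂₃ x) := by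
  induction x using TensorProduct.induction_on with
  | zero => rw [map_zero]; exact Commute.zero_right _
  | add x y hx hy => rw [map_add]; exact hx.add_right hy
  | tmul b c => simp [Commute, SemiconjBy, only₁_apply, in₂₃_tmul, tmul₃_mul]

theorem commute_only₃ (a : A) (x : A ⊗[ℂ] A) : Commute (only₃ a) (in₁₂ x) := by
  induction x using TensorProduct.induction_on with
  | zero => rw [map_zero]; exact Commute.zero_right _
  | add x y hx hy => rw [map_add]; exact hx.add_right hy
  | tmul b c => simp [Commute, SemiconjBy, only₃_apply, in₁₂_tmul, tmul₃_mul]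

variable (Y : A →ₐ[ℂ] LaurentSeries (A ⊗[ℂ] A))

/-- The map `Id ⊗ Y`. -/
def idTensor : A ⊗[ℂ] A →ₐ[ℂ] LaurentSeries (TensorCube A) :=
  Algebra.TensorProduct.lift ((constHom _).comp only₁) ((lmapHom in₂₃).comp Y)
    fun a _ => commute_C fun _ => commute_only₁ a _

/-- The map `Y ⊗ Id`. -/
def tensorId : A ⊗[ℂ] A →ₐ[ℂ] LaurentSeries (TensorCube A) :=
  Algebra.TensorProduct.lift ((lmapHom in₁₂).comp Y) ((constHom _).comp only₃)
    fun _ b => (commute_C fun _ => commute_only₃ b _).symm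

theorem idTensor_tmul_coeff (a b : A) (n : ℤ) :
    (idTensor Y (a ⊗ₜ b)).coeff n = only₁ a * in₂₃ ((Y b).coeff n) := by
  have h : idTensor Y (a ⊗ₜ b) = HahnSeries.single 0 (only₁ a) * lmapHom in₂₃ (Y b) :=
    Algebra.TensorProduct.lift_tmul _ _ _ _ _
  rw [h, HahnSeries.coeff_single_zero_mul, lmapHom_coeff]

theorem tensorId_tmul_coeff (a b : A) (n : ℤ) :
    (tensorId Y (a ⊗ₜ b)).coeff n = in₁₂ ((Y a).coeff n) * only₃ b := by
  have h : tensorId Y (a ⊗ₜ b) = lmapHom in₁₂ (Y a) * HahnSeries.single 0 (only₃ b) :=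
    Algebra.TensorProduct.lift_tmul _ _ _ _ _
  rw [h, HahnSeries.coeff_mul_single_zero, lmapHom_coeff]

theorem idTensor_coeff (x : A ⊗[ℂ] A) (n : ℤ) :
    (idTensor Y x).coeff n = (coeffW Y.toLinearMap (-n)).lTensor A x := by
  induction x using TensorProduct.induction_on with
  | zero => rw [map_zero, map_zero]; rfl
  | add x y hx hy => rw [map_add, map_add, HahnSeries.coeff_add, hx, hy]; rfl
  | tmul a b =>
    rw [idTensor_tmul_coeff]
    change _ = (a ⊗ₜ[ℂ] (Y b).coeff (- -n) : A ⊗[ℂ] (A ⊗[ℂ] A))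
    rw [neg_neg]
    generalize (Y b).coeff n = z
    induction z using TensorProduct.induction_on with
    | zero => rw [map_zero, mul_zero, TensorProduct.tmul_zero]; rfl
    | add x y hx hy => rw [map_add, mul_add, hx, hy, TensorProduct.tmul_add]; rfl
    | tmul c d =>
      rw [only₁_apply, in₂₃_tmul, tmul₃_mul, mul_one, one_mul, one_mul]
      rfl

theorem tensorId_coeff (x : A ⊗[ℂ] A) (n : ℤ) :
    (tensorId Y x).coeff n = TensorProduct.assoc ℂ A A A
      ((coeffW Y.toLinearMap (-n)).rTensor A x) := by
  induction x using TensorProduct.induction_on with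
  | zero => rw [map_zero, map_zero, map_zero]; rfl
  | add x y hx hy => rw [map_add, map_add, map_add, HahnSeries.coeff_add, hx, hy]; rfl
  | tmul a b =>
    rw [tensorId_tmul_coeff]
    change _ = TensorProduct.assoc ℂ A A A ((Y a).coeff (- -n) ⊗ₜ b)
    rw [neg_neg]
    generalize (Y a).coeff n = z
    induction z using TensorProduct.induction_on with
    | zero => rw [map_zero, zero_mul, TensorProduct.zero_tmul, map_zero]; rfl
    | add x y hx hy => rw [map_add, add_mul, hx, hy, TensorProduct.add_tmul, map_add]; rfl
    | tmul c d =>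
      rw [only₃_apply, in₁₂_tmul, tmul₃_mul, mul_one, one_mul, mul_one]
      rfl

/-- The exchange of the first two factors. -/
def swapFirst : TensorCube A →ₐ[ℂ] TensorCube A :=
  (Algebra.TensorProduct.leftComm ℂ A A A).toAlgHom

theorem swapFirst_eq (x : TensorCube A) : swapFirst x = TensorProduct.leftComm ℂ A A A x := by
  refine TensorCube.induction (P := fun x => swapFirst x = TensorProduct.leftComm ℂ A A A x)
    ?_ ?_ ?_ x
  · rw [map_zero]
    exact (map_zero (TensorProduct.leftComm ℂ A A A)).symm
  · intro x y hx hy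
    rw [map_add, hx, hy]
    exact (map_add (TensorProduct.leftComm ℂ A A A) x y).symm
  · intro a b c
    rfl

/-- The three iterated coproducts in the Jacobi identity. For a multiplicative coproduct they are
algebra homomorphisms. The outer variable is the one of the coproduct which is applied first. -/
def iterated : A →ₐ[ℂ] LaurentSeries (LaurentSeries (TensorCube A))
    × LaurentSeries (LaurentSeries (TensorCube A))
    × LaurentSeries (LaurentSeries (TensorCube A)) :=
  AlgHom.prod ((lmapHom (idTensor Y)).comp Y)
    (AlgHom.prod ((lmapHom ((lmapHom swapFirst).comp (idTensor Y))).comp Y)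
      ((lmapHom (tensorId Y)).comp Y))

theorem jacobi_of_iterated_mem {v : A} (h : iterated Y v ∈ commonExpansions (TensorCube A))
    (a b d : ℤ) : jacobiTerm₁ Y.toLinearMap a b d v - jacobiTerm₂ Y.toLinearMap a b d v
      = jacobiTerm₃ Y.toLinearMap a b d v := by
  have e1 : ∀ i j : ℤ, idY Y.toLinearMap i j v
      = ((idTensor Y) ((Y v).coeff (-i))).coeff (-j) := fun i j => by
    rw [idTensor_coeff, neg_neg]
    rfl
  have e2 : ∀ i j : ℤ, swapIdY Y.toLinearMap i j v
      = swapFirst (((idTensor Y) ((Y v).coeff (-j))).coeff (-i)) := fun i j => by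
    rw [swapFirst_eq, idTensor_coeff, neg_neg]
    rfl
  have e3 : ∀ i j : ℤ, yId Y.toLinearMap i j v
      = ((tensorId Y) ((Y v).coeff (-j))).coeff (-i) := fun i j => by
    rw [tensorId_coeff, neg_neg]
    rfl
  simp only [jacobiTerm₁, jacobiTerm₂, jacobiTerm₃, e1, e2, e3]
  exact jacobi_of_mem_commonExpansions h a b d

end

end VertexCoalg

namespace M2Brane

open Polynomial LaurentSeries VertexCoalg

/-! ### Translations -/

/-- The coefficient of `w ^ k` in `φ(x + w)`. -/
def taylorCoeff (k : ℤ) : ℂ[X] →ₗ[ℂ] ℂ[X] := if 0 ≤ k then hasseDeriv k.toNat else 0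

theorem taylorCoeff_natCast (k : ℕ) : taylorCoeff k = hasseDeriv k := by
  rw [taylorCoeff, if_pos (Int.natCast_nonneg k), Int.toNat_natCast]

theorem taylorCoeff_of_neg {k : ℤ} (hk : k < 0) : taylorCoeff k = 0 := by
  rw [taylorCoeff, if_neg (not_le.2 hk)]

theorem shift_one_pow_coeff (n : ℕ) (j : ℤ) :
    (shift 1 ^ n).coeff j = taylorCoeff (-j) (X ^ n) := by
  rw [shift_pow, HahnSeries.coeff_sum]
  rcases lt_or_ge 0 j with hj | hj
  · rw [taylorCoeff_of_neg (by omega), LinearMap.zero_apply]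
    refine Finset.sum_eq_zero fun m hm => HahnSeries.coeff_single_of_ne ?_
    have := Finset.mem_range.1 hm
    omega
  obtain ⟨k, rfl⟩ : ∃ k : ℕ, j = -k := ⟨(-j).toNat, by omega⟩
  rw [neg_neg, taylorCoeff_natCast, X_pow_eq_monomial, hasseDeriv_monomial]
  rcases lt_or_ge n k with hk | hk
  · rw [Nat.choose_eq_zero_of_lt hk, Nat.cast_zero, zero_mul, monomial_zero_right]
    refine Finset.sum_eq_zero fun m hm => HahnSeries.coeff_single_of_ne ?_
    have := Finset.mem_range.1 hm
    omega
  · rw [Finset.sum_eq_single (n - k)]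
    · rw [show -(n - ((n - k : ℕ) : ℤ)) = -(k : ℤ) by omega, HahnSeries.coeff_single_same,
        one_pow, Nat.choose_symm hk, X_pow_eq_monomial, smul_monomial, smul_eq_mul,
        mul_one, mul_one]
    · intro m hm hne
      refine HahnSeries.coeff_single_of_ne ?_
      have := Finset.mem_range.1 hm
      omega
    · intro h
      exact absurd (Finset.mem_range.2 (by omega)) h

theorem taylorCoeff_taylorCoeff (k i : ℤ) (φ : ℂ[X]) : taylorCoeff k (taylorCoeff i φ)
    = (if 0 ≤ k then ((Ring.choose (i + k) k.toNat : ℤ) : ℂ) else 0) • taylorCoeff (i + k) φ := by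
  rcases lt_or_ge k 0 with hk | hk
  · rw [taylorCoeff_of_neg hk, if_neg (not_le.2 hk), zero_smul, LinearMap.zero_apply]
  obtain ⟨k, rfl⟩ := Int.eq_ofNat_of_zero_le hk
  rw [if_pos hk, Int.toNat_natCast]
  rcases lt_or_ge i 0 with hi | hi
  · rw [taylorCoeff_of_neg hi, LinearMap.zero_apply, map_zero]
    rcases lt_or_ge (i + k) 0 with h | h
    · rw [taylorCoeff_of_neg h, LinearMap.zero_apply, smul_zero]
    · obtain ⟨n, hn⟩ := Int.eq_ofNat_of_zero_le h
      rw [hn, Ring.choose_natCast, Nat.choose_eq_zero_of_lt (by omega), Nat.cast_zero,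
        Int.cast_zero, zero_smul]
  · obtain ⟨i, rfl⟩ := Int.eq_ofNat_of_zero_le hi
    have h := LinearMap.congr_fun (hasseDeriv_comp (R := ℂ) k i) φ
    rw [LinearMap.comp_apply, LinearMap.smul_apply] at h
    rw [taylorCoeff_natCast, taylorCoeff_natCast, h, ← Nat.cast_add, taylorCoeff_natCast,
      Ring.choose_natCast, add_comm i k, Int.cast_natCast, Nat.cast_smul_eq_nsmul]

/-- The coefficient of `w ^ k` in `g(x, y + w)`. -/
def taylorRight (k : ℤ) : Poly₂ →ₗ[ℂ] Poly₂ := (taylorCoeff k).lTensor ℂ[X]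

/-- The coefficient of `w ^ k` in `g(x + w, y)`. -/
def taylorLeft (k : ℤ) : Poly₂ →ₗ[ℂ] Poly₂ := (taylorCoeff k).rTensor ℂ[X]

theorem taylorLeft_apply (k : ℤ) (g : Poly₂) : taylorLeft k g = swap (taylorRight k (swap g)) := by
  induction g using TensorProduct.induction_on with
  | zero => simp
  | add g g' hg hg' => simp only [map_add, hg, hg']
  | tmul φ ψ => rfl

theorem factorial_smul_taylorRight (k : ℕ) (g : Poly₂) :
    (k.factorial : ℂ) • taylorRight k g = dy^[k] g := by
  have h : ∀ φ ψ : ℂ[X], dy^[k] (φ ⊗ₜ[ℂ] ψ) = φ ⊗ₜ[ℂ] (derivative^[k] ψ) := by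
    intro φ ψ
    induction k with
    | zero => rfl
    | succ k ih => rw [Function.iterate_succ_apply', Function.iterate_succ_apply', ih]; rfl
  have hadd : ∀ g g' : Poly₂, dy^[k] (g + g') = dy^[k] g + dy^[k] g' := iterate_map_add dy k
  induction g using TensorProduct.induction_on with
  | zero => rw [map_zero, smul_zero]; exact (iterate_map_zero dy k).symm
  | add g g' hg hg' => rw [map_add, smul_add, hg, hg', hadd]
  | tmul φ ψ =>
    have h2 := congrFun (factorial_smul_hasseDeriv (R := ℂ) (k := k)) ψ
    rw [h, ← h2, taylorRight, LinearMap.lTensor_tmul, taylorCoeff_natCast, LinearMap.smul_apply,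
      ← Nat.cast_smul_eq_nsmul ℂ, TensorProduct.tmul_smul]

theorem iterate_derivation_pow {R : Type*} [CommRing R] [Algebra ℂ R] (δ : Derivation ℂ R R) {z : R}
    (hz : δ z = 1) (l k : ℕ) : δ^[k] (z ^ l) = (l.descFactorial k : ℂ) • z ^ (l - k) := by
  induction k with
  | zero => simp
  | succ k ih =>
    rw [Function.iterate_succ_apply', ih, Derivation.map_smul, Derivation.leibniz_pow, hz,
      Nat.descFactorial_succ, Nat.sub_sub, smul_eq_mul, mul_one, ← Nat.cast_smul_eq_nsmul ℂ,
      smul_smul]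
    push_cast
    rw [mul_comm]

theorem taylorRight_sub_pow (l k : ℕ) : taylorRight k ((inr X - inl X) ^ l)
    = (l.choose k : ℂ) • (inr X - inl X) ^ (l - k) := by
  have h0 : (k.factorial : ℂ) ≠ 0 := Nat.cast_ne_zero.2 (Nat.factorial_ne_zero k)
  have hz : dy (inr X - inl X) = 1 := by rw [map_sub, dy_inr_X, dy_inl_X, sub_zero]
  have h := factorial_smul_taylorRight k ((inr X - inl X) ^ l)
  rw [iterate_derivation_pow dy hz, Nat.descFactorial_eq_factorial_mul_choose, Nat.cast_mul,
    ← smul_smul] at h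
  exact smul_right_injective _ h0 h

theorem interaction_coeff (n : ℤ) : interaction.coeff n
    = if 2 ≤ n then (((n - 2).toNat : ℂ) + 1) • (inr X - inl X) ^ (n - 2).toNat else 0 := by
  have h2 : ∀ {R : Type} [CommRing R] [Algebra ℂ R] (k : ℕ) (x : R),
      ((k : R) + 1) * x = ((k : ℂ) + 1) • x := by
    intro R _ _ k x
    rw [Algebra.smul_def, map_add, map_natCast, map_one]
  rw [interaction, invSq_coeff]
  split_ifs
  · exact h2 _ _
  · rfl

theorem taylorRight_interaction (k n : ℤ) : taylorRight k (interaction.coeff n)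
    = (if 0 ≤ k then deltaCoeff (k - n) k.toNat else 0) • interaction.coeff (n - k) := by
  rcases lt_or_ge k 0 with hk | hk
  · rw [taylorRight, taylorCoeff_of_neg hk, if_neg (not_le.2 hk), zero_smul,
      LinearMap.lTensor_zero, LinearMap.zero_apply]
  obtain ⟨k, rfl⟩ := Int.eq_ofNat_of_zero_le hk
  rw [if_pos hk, Int.toNat_natCast, interaction_coeff, interaction_coeff]
  rcases lt_or_ge n 2 with hn | hn
  · rw [if_neg (by omega), if_neg (by omega), map_zero, smul_zero]
  obtain ⟨l, rfl⟩ : ∃ l : ℕ, n = l + 2 := ⟨(n - 2).toNat, by omega⟩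
  rw [if_pos hn, show ((l : ℤ) + 2 - 2).toNat = l by omega, map_smul, taylorRight_sub_pow]
  rcases lt_or_ge l k with hl | hl
  · rw [if_neg (by omega), smul_zero, Nat.choose_eq_zero_of_lt hl, Nat.cast_zero, zero_smul,
      smul_zero]
  · obtain ⟨r, rfl⟩ := Nat.exists_eq_add_of_le hl
    rw [if_pos (by push_cast; omega), show (((k + r : ℕ) : ℤ) + 2 - k - 2).toNat = r by omega,
      Nat.add_sub_cancel_left, smul_smul, smul_smul,
      show (k : ℤ) - ((k + r : ℕ) + 2) = -((r + 1 : ℕ) : ℤ) - 1 by push_cast; ring,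
      deltaCoeff_neg_succ]
    congr 1
    have h := congrArg (Nat.cast : ℕ → ℂ) (Nat.add_one_mul_choose_eq (k + r) r)
    rw [← Nat.choose_symm_add, add_assoc, add_comm k (r + 1), @Nat.choose_symm_add (r + 1) k] at h
    push_cast at h ⊢
    linear_combination h

theorem swap_interaction (n : ℤ) :
    swap (interaction.coeff n) = (-1 : ℂ) ^ n • interaction.coeff n := by
  rw [interaction_coeff]
  split_ifs with h
  · obtain ⟨l, rfl⟩ : ∃ l : ℕ, n = l + 2 := ⟨(n - 2).toNat, by omega⟩
    have hs : swap (inr X - inl X) = inl X - inr X := by rw [map_sub]; rfl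
    have hz : (-1 : ℂ) ^ ((l : ℤ) + 2) = (-1) ^ l := by
      rw [zpow_add₀ (by norm_num), zpow_natCast]; norm_num
    have h2 : ∀ {R : Type} [CommRing R] [Algebra ℂ R] (x y : R) (c : ℂ),
        c • (x - y) ^ l = (-1 : ℂ) ^ l • c • (y - x) ^ l := by
      intro R _ _ x y c
      rw [← neg_sub, neg_pow, smul_smul, mul_comm, ← smul_smul, Algebra.smul_def ((-1 : ℂ) ^ l),
        map_pow, map_neg, map_one, Algebra.smul_def c, Algebra.smul_def c]
      ring
    rw [map_smul, map_pow, hs, hz, show ((l : ℤ) + 2 - 2).toNat = l by omega]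
    exact h2 _ _ _
  · rw [map_zero, smul_zero]

theorem taylorLeft_interaction (k n : ℤ) : taylorLeft k (interaction.coeff n)
    = (if 0 ≤ k then ((Ring.choose (k - n) k.toNat : ℤ) : ℂ) else 0)
      • interaction.coeff (n - k) := by
  rw [taylorLeft_apply, swap_interaction, map_smul, taylorRight_interaction, map_smul, map_smul,
    swap_interaction, smul_smul, smul_smul]
  congr 1
  split_ifs with hk
  · obtain ⟨k, rfl⟩ := Int.eq_ofNat_of_zero_le hk
    rw [deltaCoeff, Int.toNat_natCast]
    have h : (-1 : ℂ) ^ n * (-1) ^ k * (-1) ^ (n - (k : ℤ)) = 1 := by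
      rw [← zpow_natCast, ← zpow_add₀ (by norm_num), ← zpow_add₀ (by norm_num),
        show n + (k : ℤ) + (n - k) = 2 * n by ring, zpow_mul]
      norm_num
    linear_combination ((Ring.choose ((k : ℤ) - n) k : ℤ) : ℂ) * h
  · simp

end M2Brane

namespace M2Brane

open Polynomial LaurentSeries VertexCoalg

variable (ε₁ ε₂ : ℂ)

/-! ### The iterated coproducts of the generators -/

theorem coproduct_cur_coeff (φ : ℂ[X]) (j : ℤ) : (coproduct ε₁ ε₂ (cur ε₁ ε₂ 0 φ)).coeff j
    = inA ε₁ ε₂ (cur ε₁ ε₂ 0 (taylorCoeff (-j) φ))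
      + if j = 0 then inB ε₁ ε₂ (cur ε₁ ε₂ 0 φ) else 0 := by
  induction φ using Polynomial.induction_on' with
  | add p q hp hq =>
    simp only [map_add, HahnSeries.coeff_add, hp, hq]
    split_ifs
    · abel
    · abel
  | monomial n c =>
    rw [← mul_one c, ← smul_eq_mul, ← smul_monomial, ← X_pow_eq_monomial]
    simp only [map_smul, HahnSeries.coeff_smul]
    rw [cur_X_pow, coproduct_t0, HahnSeries.coeff_add, smul_add, lcur, lmap_coeff,
      shift_one_pow_coeff, HahnSeries.C_apply, HahnSeries.coeff_single]
    congr 1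
    split_ifs
    · rfl
    · exact smul_zero c

theorem coproduct_t20_coeff (j : ℤ) : (coproduct ε₁ ε₂ (t ε₁ ε₂ 2 0)).coeff j
    = (if j = 0 then inA ε₁ ε₂ (t ε₁ ε₂ 2 0) + inB ε₁ ε₂ (t ε₁ ε₂ 2 0) else 0)
      + (2 * σ₃ ε₁ ε₂) • rho ε₁ ε₂ 0 0 (interaction.coeff j) := by
  rw [coproduct_t20, ← lrho_interaction, HahnSeries.coeff_add, HahnSeries.coeff_add,
    HahnSeries.C_apply, HahnSeries.C_apply, HahnSeries.coeff_single, HahnSeries.coeff_single,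
    HahnSeries.coeff_smul]
  split_ifs
  · rfl
  · rw [add_zero]
    rfl

theorem in₂₃_inA (a : M2Algebra ε₁ ε₂) : in₂₃ (inA ε₁ ε₂ a) = only₂ a := rfl

theorem in₂₃_inB (a : M2Algebra ε₁ ε₂) : in₂₃ (inB ε₁ ε₂ a) = only₃ a := rfl

theorem in₁₂_inA (a : M2Algebra ε₁ ε₂) : in₁₂ (inA ε₁ ε₂ a) = only₁ a := rfl

theorem in₁₂_inB (a : M2Algebra ε₁ ε₂) : in₁₂ (inB ε₁ ε₂ a) = only₂ a := rfl

theorem idTensor_inA_coeff (a : M2Algebra ε₁ ε₂) (p : ℤ) :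
    (idTensor (coproduct ε₁ ε₂) (inA ε₁ ε₂ a)).coeff p = if p = 0 then only₁ a else 0 := by
  rw [Algebra.TensorProduct.includeLeft_apply, idTensor_tmul_coeff, map_one, HahnSeries.coeff_one]
  split_ifs
  · rw [map_one, mul_one]
  · rw [map_zero, mul_zero]

theorem idTensor_inB_coeff (a : M2Algebra ε₁ ε₂) (p : ℤ) :
    (idTensor (coproduct ε₁ ε₂) (inB ε₁ ε₂ a)).coeff p
      = in₂₃ ((coproduct ε₁ ε₂ a).coeff p) := by
  rw [Algebra.TensorProduct.includeRight_apply, idTensor_tmul_coeff, map_one, one_mul]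

theorem tensorId_inA_coeff (a : M2Algebra ε₁ ε₂) (p : ℤ) :
    (tensorId (coproduct ε₁ ε₂) (inA ε₁ ε₂ a)).coeff p
      = in₁₂ ((coproduct ε₁ ε₂ a).coeff p) := by
  rw [Algebra.TensorProduct.includeLeft_apply, tensorId_tmul_coeff, map_one, mul_one]

theorem tensorId_inB_coeff (a : M2Algebra ε₁ ε₂) (p : ℤ) :
    (tensorId (coproduct ε₁ ε₂) (inB ε₁ ε₂ a)).coeff p = if p = 0 then only₃ a else 0 := by
  rw [Algebra.TensorProduct.includeRight_apply, tensorId_tmul_coeff, map_one, HahnSeries.coeff_one]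
  split_ifs
  · rw [map_one, one_mul]
  · rw [map_zero, zero_mul]

theorem idTensor_rho_coeff (g : Poly₂) (p : ℤ) :
    (idTensor (coproduct ε₁ ε₂) (rho ε₁ ε₂ 0 0 g)).coeff p
      = in₁₂ (rho ε₁ ε₂ 0 0 (taylorRight (-p) g))
        + if p = 0 then in₁₃ (rho ε₁ ε₂ 0 0 g) else 0 := by
  induction g using TensorProduct.induction_on with
  | zero => simp
  | add g g' hg hg' =>
    simp only [map_add, HahnSeries.coeff_add, hg, hg']
    split_ifs <;> abel
  | tmul φ ψ =>
    rw [rho_tmul, idTensor_tmul_coeff, coproduct_cur_coeff, map_add, mul_add, taylorRight,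
      LinearMap.lTensor_tmul, rho_tmul, in₂₃_inA, only₁_apply, only₂_apply, tmul₃_mul, in₁₂_tmul]
    congr 1
    · rw [mul_one, one_mul, mul_one]
    · split_ifs
      · rw [in₂₃_inB, only₃_apply, tmul₃_mul, in₁₃_tmul, mul_one, one_mul, one_mul]
      · rw [map_zero, mul_zero]

theorem tensorId_rho_coeff (g : Poly₂) (p : ℤ) :
    (tensorId (coproduct ε₁ ε₂) (rho ε₁ ε₂ 0 0 g)).coeff p
      = in₁₃ (rho ε₁ ε₂ 0 0 (taylorLeft (-p) g))
        + if p = 0 then in₂₃ (rho ε₁ ε₂ 0 0 g) else 0 := by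
  induction g using TensorProduct.induction_on with
  | zero => simp
  | add g g' hg hg' =>
    simp only [map_add, HahnSeries.coeff_add, hg, hg']
    split_ifs <;> abel
  | tmul φ ψ =>
    rw [rho_tmul, tensorId_tmul_coeff, coproduct_cur_coeff, map_add, add_mul, taylorLeft,
      LinearMap.rTensor_tmul, rho_tmul, in₁₂_inA, only₁_apply, only₃_apply, tmul₃_mul, in₁₃_tmul]
    congr 1
    · simp only [mul_one, one_mul]
    · split_ifs
      · rw [in₁₂_inB, only₂_apply, tmul₃_mul, in₂₃_tmul, mul_one, mul_one, one_mul]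
      · rw [map_zero, zero_mul]

theorem swapFirst_only₁ (a : M2Algebra ε₁ ε₂) : swapFirst (only₁ a) = only₂ a := rfl

theorem swapFirst_only₂ (a : M2Algebra ε₁ ε₂) : swapFirst (only₂ a) = only₁ a := rfl

theorem swapFirst_only₃ (a : M2Algebra ε₁ ε₂) : swapFirst (only₃ a) = only₃ a := rfl

theorem swapFirst_in₁₂_rho (g : Poly₂) :
    swapFirst (in₁₂ (rho ε₁ ε₂ 0 0 g)) = in₁₂ (rho ε₁ ε₂ 0 0 (swap g)) := by
  induction g using TensorProduct.induction_on with
  | zero => simp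
  | add g g' hg hg' => simp only [map_add, hg, hg']
  | tmul φ ψ => rfl

theorem swapFirst_in₁₃ (x : M2Algebra ε₁ ε₂ ⊗[ℂ] M2Algebra ε₁ ε₂) :
    swapFirst (in₁₃ x) = in₂₃ x := by
  induction x using TensorProduct.induction_on with
  | zero => simp
  | add g g' hg hg' => simp only [map_add, hg, hg']
  | tmul φ ψ => rfl

theorem swapFirst_in₂₃ (x : M2Algebra ε₁ ε₂ ⊗[ℂ] M2Algebra ε₁ ε₂) :
    swapFirst (in₂₃ x) = in₁₃ x := by
  induction x using TensorProduct.induction_on with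
  | zero => simp
  | add g g' hg hg' => simp only [map_add, hg, hg']
  | tmul φ ψ => rfl

end M2Brane

namespace M2Brane

open Polynomial LaurentSeries VertexCoalg

variable (ε₁ ε₂ : ℂ)

/-! ### The Jacobi identity -/

theorem iterated_fst_coeff (v : M2Algebra ε₁ ε₂) (n : ℤ) :
    (iterated (coproduct ε₁ ε₂) v).1.coeff n
      = idTensor (coproduct ε₁ ε₂) ((coproduct ε₁ ε₂ v).coeff n) := rfl

theorem iterated_snd_fst_coeff (v : M2Algebra ε₁ ε₂) (n p : ℤ) :
    ((iterated (coproduct ε₁ ε₂) v).2.1.coeff n).coeff p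
      = swapFirst (((iterated (coproduct ε₁ ε₂) v).1.coeff n).coeff p) := rfl

theorem iterated_snd_snd_coeff (v : M2Algebra ε₁ ε₂) (n : ℤ) :
    (iterated (coproduct ε₁ ε₂) v).2.2.coeff n
      = tensorId (coproduct ε₁ ε₂) ((coproduct ε₁ ε₂ v).coeff n) := rfl

theorem iterated_t0_fst_coeff (r : ℕ) (n p : ℤ) :
    ((iterated (coproduct ε₁ ε₂) (t ε₁ ε₂ 0 r)).1.coeff n).coeff p
      = (if p = 0 then only₁ (cur ε₁ ε₂ 0 (taylorCoeff (-n) (X ^ r))) else 0)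
        + (if n = 0 then only₂ (cur ε₁ ε₂ 0 (taylorCoeff (-p) (X ^ r)))
            + (if p = 0 then only₃ (cur ε₁ ε₂ 0 (X ^ r)) else 0) else 0) := by
  rw [iterated_fst_coeff, ← cur_X_pow, coproduct_cur_coeff, map_add, HahnSeries.coeff_add,
    idTensor_inA_coeff]
  congr 1
  split_ifs with hn hp
  · rw [idTensor_inB_coeff, coproduct_cur_coeff, if_pos hp, map_add, in₂₃_inA, in₂₃_inB]
  · rw [idTensor_inB_coeff, coproduct_cur_coeff, if_neg hp, map_add, in₂₃_inA, map_zero]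
  all_goals
    rw [map_zero]
    rfl

theorem iterated_t0_snd_snd_coeff (r : ℕ) (n p : ℤ) :
    ((iterated (coproduct ε₁ ε₂) (t ε₁ ε₂ 0 r)).2.2.coeff n).coeff p
      = (if 0 ≤ -p then ((Ring.choose (-(n + p)) (-p).toNat : ℤ) : ℂ) else 0)
          • only₁ (cur ε₁ ε₂ 0 (taylorCoeff (-(n + p)) (X ^ r)))
        + (if p = 0 then only₂ (cur ε₁ ε₂ 0 (taylorCoeff (-n) (X ^ r)))
            + (if n = 0 then only₃ (cur ε₁ ε₂ 0 (X ^ r)) else 0) else 0) := by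
  rw [iterated_snd_snd_coeff, ← cur_X_pow, coproduct_cur_coeff, map_add, HahnSeries.coeff_add,
    tensorId_inA_coeff, coproduct_cur_coeff, taylorCoeff_taylorCoeff, map_add, in₁₂_inA, map_smul,
    map_smul, ← neg_add, add_assoc]
  congr 1
  split_ifs with hp hn hn
  · rw [in₁₂_inB, tensorId_inB_coeff, if_pos hp]
  · rw [in₁₂_inB, map_zero]
    rfl
  · rw [map_zero, zero_add, tensorId_inB_coeff, if_neg hp]
  · rw [map_zero, map_zero, zero_add]
    rfl

/-- The iterated coproduct of `t_{0,r}` is the common expansion of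
`t_0((x + w₁) ^ r) ⊗ 1 ⊗ 1 + 1 ⊗ t_0((x + w₂) ^ r) ⊗ 1 + 1 ⊗ 1 ⊗ t_{0,r}`. -/
theorem iterated_t0_mem (r : ℕ) :
    iterated (coproduct ε₁ ε₂) (t ε₁ ε₂ 0 r) ∈ commonExpansions _ := by
  let α (j : M2Algebra ε₁ ε₂ →ₐ[ℂ] TensorCube (M2Algebra ε₁ ε₂)) :
      LaurentSeries (TensorCube (M2Algebra ε₁ ε₂)) :=
    lmap (j.toLinearMap ∘ₗ cur ε₁ ε₂ 0) (shift 1 ^ r)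
  have hα : ∀ j n, (α j).coeff n = j (cur ε₁ ε₂ 0 (taylorCoeff (-n) (X ^ r))) := fun j n => by
    rw [← shift_one_pow_coeff]
    rfl
  have hβ : ∀ n, (α only₂ + HahnSeries.C (only₃ (cur ε₁ ε₂ 0 (X ^ r)))).coeff n
      = only₂ (cur ε₁ ε₂ 0 (taylorCoeff (-n) (X ^ r)))
        + if n = 0 then only₃ (cur ε₁ ε₂ 0 (X ^ r)) else 0 := fun n => by
    rw [HahnSeries.coeff_add, hα, HahnSeries.C_apply, HahnSeries.coeff_single]
    split_ifs <;> rfl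
  refine mem_commonExpansions (α only₁) (α only₂ + HahnSeries.C (only₃ (cur ε₁ ε₂ 0 (X ^ r)))) 0
    (fun n p => ?_) (fun n p => ?_) (fun n p => ?_)
  · rw [hα, hβ, HahnSeries.coeff_zero, smul_zero, add_zero]
    exact iterated_t0_fst_coeff ε₁ ε₂ r n p
  · rw [hα, hβ, HahnSeries.coeff_zero, smul_zero, add_zero]
    refine (iterated_snd_fst_coeff ε₁ ε₂ _ n p).trans ?_
    rw [iterated_t0_fst_coeff, map_add, apply_ite swapFirst, apply_ite swapFirst, map_add,
      apply_ite swapFirst, swapFirst_only₁, swapFirst_only₂, swapFirst_only₃, map_zero]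
    split_ifs <;> abel
  · rw [hα, hβ, HahnSeries.coeff_zero, ite_self, add_zero]
    exact iterated_t0_snd_snd_coeff ε₁ ε₂ r n p

theorem iterated_t20_fst_coeff (n p : ℤ) :
    ((iterated (coproduct ε₁ ε₂) (t ε₁ ε₂ 2 0)).1.coeff n).coeff p
      = (if p = 0 then (2 * σ₃ ε₁ ε₂) • in₁₃ (rho ε₁ ε₂ 0 0 (interaction.coeff n)) else 0)
        + (if n = 0 then (if p = 0 then only₁ (t ε₁ ε₂ 2 0) + only₂ (t ε₁ ε₂ 2 0)
              + only₃ (t ε₁ ε₂ 2 0) else 0)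
            + (2 * σ₃ ε₁ ε₂) • in₂₃ (rho ε₁ ε₂ 0 0 (interaction.coeff p)) else 0)
        + (if 0 ≤ -p then deltaCoeff (-(n + p)) (-p).toNat else 0)
          • (2 * σ₃ ε₁ ε₂) • in₁₂ (rho ε₁ ε₂ 0 0 (interaction.coeff (n + p))) := by
  have h1 : (idTensor (coproduct ε₁ ε₂) ((2 * σ₃ ε₁ ε₂) • rho ε₁ ε₂ 0 0
        (interaction.coeff n))).coeff p
      = (if p = 0 then (2 * σ₃ ε₁ ε₂) • in₁₃ (rho ε₁ ε₂ 0 0 (interaction.coeff n)) else 0)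
        + (if 0 ≤ -p then deltaCoeff (-(n + p)) (-p).toNat else 0)
          • (2 * σ₃ ε₁ ε₂) • in₁₂ (rho ε₁ ε₂ 0 0 (interaction.coeff (n + p))) := by
    rw [map_smul, HahnSeries.coeff_smul, idTensor_rho_coeff, taylorRight_interaction, map_smul,
      map_smul, smul_add, smul_comm (2 * σ₃ ε₁ ε₂), show -p - n = -(n + p) by ring, sub_neg_eq_add,
      add_comm]
    congr 1
    split_ifs
    · rfl
    · exact smul_zero _
  have h2 : (idTensor (coproduct ε₁ ε₂)
        (inA ε₁ ε₂ (t ε₁ ε₂ 2 0) + inB ε₁ ε₂ (t ε₁ ε₂ 2 0))).coeff p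
      = (if p = 0 then only₁ (t ε₁ ε₂ 2 0) + only₂ (t ε₁ ε₂ 2 0) + only₃ (t ε₁ ε₂ 2 0) else 0)
            + (2 * σ₃ ε₁ ε₂) • in₂₃ (rho ε₁ ε₂ 0 0 (interaction.coeff p)) := by
    rw [map_add, HahnSeries.coeff_add, idTensor_inA_coeff, idTensor_inB_coeff, coproduct_t20_coeff,
      map_add, map_smul, apply_ite in₂₃, map_add, in₂₃_inA, in₂₃_inB, map_zero]
    split_ifs <;> abel
  rw [iterated_fst_coeff, coproduct_t20_coeff, map_add, HahnSeries.coeff_add, h1, ← add_assoc]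
  congr 1
  rw [add_comm]
  congr 1
  by_cases hn : n = 0
  · rw [if_pos hn, if_pos hn]
    exact h2
  · rw [if_neg hn, if_neg hn, map_zero]
    rfl

theorem iterated_t20_snd_snd_coeff (n p : ℤ) :
    ((iterated (coproduct ε₁ ε₂) (t ε₁ ε₂ 2 0)).2.2.coeff n).coeff p
      = (if 0 ≤ -p then ((Ring.choose (-(n + p)) (-p).toNat : ℤ) : ℂ) else 0)
          • (2 * σ₃ ε₁ ε₂) • in₁₃ (rho ε₁ ε₂ 0 0 (interaction.coeff (n + p)))
        + (if p = 0 then (if n = 0 then only₁ (t ε₁ ε₂ 2 0) + only₂ (t ε₁ ε₂ 2 0)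
              + only₃ (t ε₁ ε₂ 2 0) else 0)
            + (2 * σ₃ ε₁ ε₂) • in₂₃ (rho ε₁ ε₂ 0 0 (interaction.coeff n)) else 0)
        + (if n = 0 then (2 * σ₃ ε₁ ε₂) • in₁₂ (rho ε₁ ε₂ 0 0 (interaction.coeff p)) else 0) := by
  have h1 : (tensorId (coproduct ε₁ ε₂) ((2 * σ₃ ε₁ ε₂) • rho ε₁ ε₂ 0 0
        (interaction.coeff n))).coeff p
      = (if 0 ≤ -p then ((Ring.choose (-(n + p)) (-p).toNat : ℤ) : ℂ) else 0)
          • (2 * σ₃ ε₁ ε₂) • in₁₃ (rho ε₁ ε₂ 0 0 (interaction.coeff (n + p)))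
        + (if p = 0 then (2 * σ₃ ε₁ ε₂) • in₂₃ (rho ε₁ ε₂ 0 0 (interaction.coeff n)) else 0) := by
    rw [map_smul, HahnSeries.coeff_smul, tensorId_rho_coeff, taylorLeft_interaction, map_smul,
      map_smul, smul_add, smul_comm (2 * σ₃ ε₁ ε₂), show -p - n = -(n + p) by ring, sub_neg_eq_add]
    congr 1
    split_ifs
    · rfl
    · exact smul_zero _
  have h2 : (tensorId (coproduct ε₁ ε₂)
        (inA ε₁ ε₂ (t ε₁ ε₂ 2 0) + inB ε₁ ε₂ (t ε₁ ε₂ 2 0))).coeff p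
      = (if p = 0 then only₁ (t ε₁ ε₂ 2 0) + only₂ (t ε₁ ε₂ 2 0) + only₃ (t ε₁ ε₂ 2 0) else 0)
            + (2 * σ₃ ε₁ ε₂) • in₁₂ (rho ε₁ ε₂ 0 0 (interaction.coeff p)) := by
    rw [map_add, HahnSeries.coeff_add, tensorId_inA_coeff, tensorId_inB_coeff, coproduct_t20_coeff,
      map_add, map_smul, apply_ite in₁₂, map_add, in₁₂_inA, in₁₂_inB, map_zero]
    split_ifs <;> abel
  rw [iterated_snd_snd_coeff, coproduct_t20_coeff, map_add, HahnSeries.coeff_add, h1]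
  by_cases hn : n = 0
  · rw [if_pos hn, if_pos hn, if_pos hn, h2]
    split_ifs <;> abel
  · rw [if_neg hn, if_neg hn, if_neg hn, map_zero, zero_add, add_zero, HahnSeries.coeff_zero,
      zero_add]

/-- The iterated coproduct of `t_{2,0}` is the common expansion of the sum of the three `t_{2,0}`
and the three pairwise interactions, in `w₁` for the outer factors, in `w₂` for the last two factors
and in `w₁ - w₂` for the first two. -/
theorem iterated_t20_mem :
    iterated (coproduct ε₁ ε₂) (t ε₁ ε₂ 2 0) ∈ commonExpansions _ := by
  let α (j : M2Algebra ε₁ ε₂ ⊗[ℂ] M2Algebra ε₁ ε₂ →ₐ[ℂ] TensorCube (M2Algebra ε₁ ε₂)) :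
      LaurentSeries (TensorCube (M2Algebra ε₁ ε₂)) :=
    lmap ((2 * σ₃ ε₁ ε₂) • (j.toLinearMap ∘ₗ rho ε₁ ε₂ 0 0)) interaction
  have hα : ∀ j n, (α j).coeff n = (2 * σ₃ ε₁ ε₂) • j (rho ε₁ ε₂ 0 0 (interaction.coeff n)) :=
    fun j n => rfl
  let s := only₁ (t ε₁ ε₂ 2 0) + only₂ (t ε₁ ε₂ 2 0) + only₃ (t ε₁ ε₂ 2 0)
  have hβ : ∀ n, (HahnSeries.C s + α in₂₃).coeff n = (if n = 0 then s else 0)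
      + (2 * σ₃ ε₁ ε₂) • in₂₃ (rho ε₁ ε₂ 0 0 (interaction.coeff n)) := fun n => by
    rw [HahnSeries.coeff_add, hα, HahnSeries.C_apply, HahnSeries.coeff_single]
    split_ifs <;> rfl
  have hs : swapFirst s = s := by
    simp only [s, map_add, swapFirst_only₁, swapFirst_only₂, swapFirst_only₃]
    abel
  refine mem_commonExpansions (α in₁₃) (HahnSeries.C s + α in₂₃) (α in₁₂)
    (fun n p => ?_) (fun n p => ?_) (fun n p => ?_)
  · rw [hα, hα, hβ]
    exact iterated_t20_fst_coeff ε₁ ε₂ n p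
  · rw [hα, hα, hβ]
    refine (iterated_snd_fst_coeff ε₁ ε₂ _ n p).trans ?_
    rw [iterated_t20_fst_coeff, map_add, map_add, apply_ite swapFirst, apply_ite swapFirst, map_add,
      apply_ite swapFirst, hs, map_zero, map_smul, map_smul, map_smul, map_smul, swapFirst_in₁₃,
      swapFirst_in₂₃, swapFirst_in₁₂_rho, swap_interaction, map_smul, map_smul,
      smul_comm (2 * σ₃ ε₁ ε₂) ((-1 : ℂ) ^ (n + p)), smul_smul _ ((-1 : ℂ) ^ (n + p)),
      mul_comm _ ((-1 : ℂ) ^ (n + p))]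
    congr 1
    split_ifs <;> abel
  · rw [hα, hα, hβ]
    exact iterated_t20_snd_snd_coeff ε₁ ε₂ n p

theorem iterated_mem (v : M2Algebra ε₁ ε₂) :
    iterated (coproduct ε₁ ε₂) v ∈ commonExpansions _ := by
  induction v using generator_induction with
  | t0 n => exact iterated_t0_mem ε₁ ε₂ n
  | t20 => exact iterated_t20_mem ε₁ ε₂
  | algebraMap r =>
    rw [AlgHom.commutes]
    exact Subalgebra.algebraMap_mem _ r
  | add x y hx hy =>
    rw [map_add]
    exact add_mem hx hy
  | mul x y hx hy =>
    rw [map_mul]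
    exact mul_mem hx hy

theorem isVertexCoalgebra_coproduct :
    IsVertexCoalgebra (coproduct ε₁ ε₂).toLinearMap (augmentation ε₁ ε₂).toLinearMap where
  left_counit := left_counit ε₁ ε₂
  cocreation_polynomial v i hi := by
    rw [rid_coeffW]
    exact (isPolynomialAt_coproduct ε₁ ε₂ v).coeff_pos _ (by omega)
  cocreation_limit v := by
    rw [rid_coeffW, neg_zero]
    exact (isPolynomialAt_coproduct ε₁ ε₂ v).coeff_zero
  jacobi v a b d := jacobi_of_iterated_mem _ (iterated_mem ε₁ ε₂ v) a b d

end M2Brane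

end

theorem theorem1 (ε₁ ε₂ : ℂ) :
    ∃ Δ : M2Algebra ε₁ ε₂ →ₐ[ℂ]
        LaurentSeries (TensorProduct ℂ (M2Algebra ε₁ ε₂) (M2Algebra ε₁ ε₂)),
      M2Brane.IsMeromorphicCoproduct ε₁ ε₂ Δ ∧
      (∀ Δ', M2Brane.IsMeromorphicCoproduct ε₁ ε₂ Δ' → Δ' = Δ) ∧
      VertexCoalg.IsVertexCoalgebra Δ.toLinearMap (M2Brane.augmentation ε₁ ε₂).toLinearMap := by
  exact ⟨M2Brane.coproduct ε₁ ε₂, M2Brane.isMeromorphicCoproduct_coproduct ε₁ ε₂,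
    fun _ h => h.eq_coproduct, M2Brane.isVertexCoalgebra_coproduct ε₁ ε₂⟩
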